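/- Fix an integer $k\ge 1$. Let $\{a^{(l)}_{ij} : 1\le i\le j,\ 0\le l\le\lfloor k/2\rfloor\}$ be independent, identically distributed real random variables of variance one on a probability space, and put $a^{(l)}_{ji}=a^{(l)}_{ij}$. Let $\mathbf A_{ij}$ be the $k\times k$ symmetric circulant matrix with entries $$(\mathbf A_{ij})_{pq}=\tfrac1{\sqrt k}\,a^{(\min(m,k-m))}_{ij},\qquad m\in\{0,\dots,k-1\},\ m\equiv q-p \pmod k ,$$ and let $\mathbb K_{n,k}=(\mathbf A_{ij})_{i,j=1}^n$, a $kn\times kn$ symmetric block matrix. For a real symmetric $N\times N$ matrix $\mathbf M$ with eigenvalues $\lambda_1,\dots,\lambda_N$ let $\mu_{\mathbf M}=\frac1N\sum_j\delta_{\lambda_j}$ be its spectral measure. For $v>0$ let $\gamma_{\alpha,v}$ be the semicircle law with density $\frac1{2\pi v}\sqrt{4v-(x-\alpha)^2}$ on $[\alpha-2\sqrt v,\alpha+2\sqrt v]$, let $\gamma_{\alpha,0}=\delta_\alpha$, and put $$\nu_k=\begin{cases}\frac{k-1}{k}\,\gamma_{0,\frac{k-1}{k}}+\frac1k\,\gamma_{0,\frac{2k-1}{k}},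 & k \text{ odd},\\[2pt] \frac{k-2}{k}\,\gamma_{0,\frac{k-2}{k}}+\frac2k\,\gamma_{0,\frac{2k-2}{k}}, & k\text{ even}.\end{cases}$$ Then: 1. Almost surely, $\mu_{\frac1{\sqrt n}\mathbb K_{n,k}}$ converges weakly to $\nu_k$ as $n\to\infty$. 2. The entries of $\mathbb K_{n,k}$ are $(k-1)$-dependent up to symmetry: the matrices $\mathbb K_{n,k}$ are the upper left corners $(X_{ij})_{i,j=1}^{nk}$ of one infinite array $(X_{ij})_{i,j\ge1}$, and for all sets $S,T\subset\{(i,j): 1\le i\le j\}$ such that $\max\{|i-i'|,|j-j'|\}>k-1$ whenever $(i,j)\in S$, $(i',j')\in T$, the $\sigma$-fields $\sigma(X_{ij}:(i,j)\in S)$ and $\sigma(X_{ij}:(i,j)\in T)$ are independent. 3. If $k\ge3$, then $\nu_k\ne\gamma_{\alpha,v}$ for all $\alpha\in\mathbb R$ and $v\ge0$; hence the limiting spectral measure of a symmetric random matrix with $(k-1)$-dependent entries need not be a semicircle law. -/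

import Mathlib

open MeasureTheory ProbabilityTheory Filter Topology
open scoped NNReal ENNReal

noncomputable section

namespace CirculantBlocks

/-! ### Spectral measures -/

/-- The spectral measure `(1/N) ∑ δ_{λ_j}` of a real symmetric `N × N` matrix, `N ≥ 1`. -/
def spectralMeasure {ι : Type*} [Fintype ι] [DecidableEq ι] [Nonempty ι]
    (A : Matrix ι ι ℝ) (hA : A.IsHermitian) : ProbabilityMeasure ℝ :=
  ⟨(Fintype.card ι : ℝ≥0∞)⁻¹ • ∑ j, Measure.dirac (hA.eigenvalues j), ⟨by
    simp only [Measure.smul_apply, Measure.finsetSum_apply, measure_univ, Finset.sum_const,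
      Finset.card_univ, nsmul_eq_mul, mul_one, smul_eq_mul]
    exact ENNReal.inv_mul_cancel (by simp) (by simp)⟩⟩

/-! ### Semicircle laws -/

/-- The density of the semicircle law with mean `α` and variance `v > 0`. -/
def semicirclePDF (α : ℝ) (v : ℝ≥0) : ℝ → ℝ :=
  (Set.Icc (α - 2 * √v) (α + 2 * √v)).indicator
    fun x => 1 / (2 * Real.pi * v) * √(4 * v - (x - α) ^ 2)

lemma integral_semicircle (α : ℝ) {v : ℝ≥0} (hv : v ≠ 0) :
    ∫ x in (α - 2 * √v)..(α + 2 * √v),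
      1 / (2 * Real.pi * v) * √(4 * v - (x - α) ^ 2) = 1 := by
  have hv' : (0 : ℝ) < v := by exact_mod_cast pos_iff_ne_zero.mpr hv
  set s : ℝ := √(v : ℝ) with hs
  have hs0 : 0 < s := Real.sqrt_pos.mpr hv'
  have hsq : s ^ 2 = v := Real.sq_sqrt hv'.le
  have h1 : ∀ x : ℝ, 1 / (2 * Real.pi * v) * √(4 * v - (x - α) ^ 2)
      = (1 / (Real.pi * s)) * √(1 - (x / (2 * s) - α / (2 * s)) ^ 2) := by
    intro x
    have : 4 * (v : ℝ) - (x - α) ^ 2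
        = (2 * s) ^ 2 * (1 - (x / (2 * s) - α / (2 * s)) ^ 2) := by
      rw [← hsq]; field_simp; ring
    rw [this, Real.sqrt_mul (by positivity), Real.sqrt_sq (by positivity), ← hsq]
    field_simp
  simp_rw [h1]
  rw [intervalIntegral.integral_const_mul,
    intervalIntegral.integral_comp_div_sub
      (f := fun y => √(1 - y ^ 2)) (c := 2 * s) (by positivity) (α / (2 * s))]
  have e1 : (α - 2 * s) / (2 * s) - α / (2 * s) = -1 := by field_simp; ring
  have e2 : (α + 2 * s) / (2 * s) - α / (2 * s) = 1 := by field_simp; ring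
  rw [e1, e2, integral_sqrt_one_sub_sq, smul_eq_mul]
  have := Real.pi_pos
  field_simp

lemma lintegral_semicirclePDF (α : ℝ) {v : ℝ≥0} (hv : v ≠ 0) :
    ∫⁻ x, ENNReal.ofReal (semicirclePDF α v x) = 1 := by
  have hle : α - 2 * √(v : ℝ) ≤ α + 2 * √(v : ℝ) := by
    have := Real.sqrt_nonneg (v : ℝ); linarith
  have hc : Continuous fun x : ℝ => 1 / (2 * Real.pi * v) * √(4 * v - (x - α) ^ 2) := by
    fun_prop
  have hi : Integrable (semicirclePDF α v) :=
    (hc.continuousOn.integrableOn_Icc).integrable_indicator measurableSet_Icc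
  have hn : 0 ≤ semicirclePDF α v := fun x =>
    Set.indicator_nonneg (fun y _ => by positivity) x
  rw [← ofReal_integral_eq_lintegral_ofReal hi (Eventually.of_forall hn)]
  have : ∫ x, semicirclePDF α v x = 1 := by
    unfold semicirclePDF
    rw [integral_indicator measurableSet_Icc, integral_Icc_eq_integral_Ioc,
      ← intervalIntegral.integral_of_le hle]
    exact integral_semicircle α hv
  simp [this]

/-- The semicircle law `γ_{α,v}` with mean `α` and variance `v`
(the point mass at `α` if `v = 0`). -/
def semicircle (α : ℝ) (v : ℝ≥0) : ProbabilityMeasure ℝ :=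
  ⟨if v = 0 then Measure.dirac α
    else volume.withDensity fun x => ENNReal.ofReal (semicirclePDF α v x), by
    split_ifs with hv
    · infer_instance
    · exact ⟨by simpa using lintegral_semicirclePDF α hv⟩⟩

/-- The mixture `w μ + w' μ'` of two probability measures, where `w + w' = 1`. -/
def mixture (w w' : ℝ≥0) (h : w + w' = 1) (μ μ' : ProbabilityMeasure ℝ) :
    ProbabilityMeasure ℝ :=
  ⟨w • (μ : Measure ℝ) + w' • (μ' : Measure ℝ), ⟨by
    simp only [Measure.add_apply, Measure.smul_apply, measure_univ, ENNReal.smul_def,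
      smul_eq_mul, mul_one]
    exact_mod_cast h⟩⟩

lemma weights_odd {k : ℕ} (hk : k ≠ 0) :
    ((k - 1 : ℕ) : ℝ≥0) / k + 1 / k = 1 := by
  have hk' : (k : ℝ≥0) ≠ 0 := by exact_mod_cast hk
  rw [← add_div, div_eq_one_iff_eq hk']
  exact_mod_cast Nat.sub_add_cancel (Nat.one_le_iff_ne_zero.mpr hk)

lemma weights_even {k : ℕ} (hk : k ≠ 0) (h : ¬ Odd k) :
    ((k - 2 : ℕ) : ℝ≥0) / k + 2 / k = 1 := by
  have hk' : (k : ℝ≥0) ≠ 0 := by exact_mod_cast hk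
  have h2 : 2 ≤ k := by
    rcases Nat.not_odd_iff_even.mp h with ⟨m, rfl⟩
    omega
  rw [← add_div, div_eq_one_iff_eq hk']
  exact_mod_cast Nat.sub_add_cancel h2

/-- The limit law `ν_k`. -/
def nu (k : ℕ) [NeZero k] : ProbabilityMeasure ℝ :=
  if h : Odd k then
    mixture (((k - 1 : ℕ) : ℝ≥0) / k) (1 / k) (weights_odd (NeZero.ne k))
      (semicircle 0 (((k - 1 : ℕ) : ℝ≥0) / k)) (semicircle 0 (((2 * k - 1 : ℕ) : ℝ≥0) / k))
  else
    mixture (((k - 2 : ℕ) : ℝ≥0) / k) (2 / k) (weights_even (NeZero.ne k) h)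
      (semicircle 0 (((k - 2 : ℕ) : ℝ≥0) / k)) (semicircle 0 (((2 * k - 2 : ℕ) : ℝ≥0) / k))

/-! ### The block matrix -/

/-- The letter (numbered from `0`) that stands in position `m` of the first row of the symmetric
circulant: positions `m` and `k - m` carry the same letter. -/
def letter (k : ℕ) (m : Fin k) : Fin (k / 2 + 1) :=
  ⟨min (m : ℕ) (k - m), by omega⟩

/-- The `k × k` symmetric circulant in the letters `a`, normalized by `1/√k`: its `(p, q)` entry
is `1/√k` times the letter in position `q - p` (mod `k`) of the first row. -/
def symCirculant (k : ℕ) (a : Fin (k / 2 + 1) → ℝ) : Matrix (Fin k) (Fin k) ℝ :=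
  (√(k : ℝ))⁻¹ • Matrix.of fun p q => a (letter k (q - p))

/-- The `kn × kn` block matrix whose `(i, j)` block is the symmetric circulant in the letters
`x (s(i, j), 0), x (s(i, j), 1), …`; rows and columns are listed block by block. -/
def blockMatrix (k n : ℕ) (x : Sym2 ℕ × Fin (k / 2 + 1) → ℝ) :
    Matrix (Fin (n * k)) (Fin (n * k)) ℝ :=
  Matrix.reindex finProdFinEquiv finProdFinEquiv
    (Matrix.comp (Fin n) (Fin n) (Fin k) (Fin k) ℝ
      (Matrix.of fun i j => symCirculant k fun l => x (s((i : ℕ), (j : ℕ)), l)))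

lemma letter_sub_comm (k : ℕ) (p q : Fin k) : letter k (p - q) = letter k (q - p) := by
  have hp := p.isLt
  have hq := q.isLt
  apply Fin.ext
  simp only [letter, Fin.val_sub]
  rcases lt_trichotomy (p : ℕ) q with h | h | h
  · rw [Nat.mod_eq_of_lt (by omega : k - (q : ℕ) + p < k),
      (by omega : k - (p : ℕ) + q = (q - p) + k), Nat.add_mod_right,
      Nat.mod_eq_of_lt (by omega : (q : ℕ) - p < k)]
    omega
  · rw [h]
  · rw [Nat.mod_eq_of_lt (by omega : k - (p : ℕ) + q < k),
      (by omega : k - (q : ℕ) + p = (p - q) + k), Nat.add_mod_right,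
      Nat.mod_eq_of_lt (by omega : (p : ℕ) - q < k)]
    omega

lemma isHermitian_smul_blockMatrix (c : ℝ) (k n : ℕ) (x : Sym2 ℕ × Fin (k / 2 + 1) → ℝ) :
    (c • blockMatrix k n x).IsHermitian := by
  ext i j
  simp only [blockMatrix, symCirculant, Matrix.conjTranspose_apply, Matrix.smul_apply,
    Matrix.reindex_apply, Matrix.submatrix_apply, Matrix.comp_apply, Matrix.of_apply,
    star_trivial]
  rw [letter_sub_comm, Sym2.eq_swap]

/-! ### Finitely dependent random fields -/

/-- The random field `(X i j)`, `i ≤ j`, is `m`-dependent: for any two sets of indices at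
distance larger than `m` (the distance on `ℕ × ℕ` being the maximum of the coordinate distances),
the σ-fields generated by the corresponding variables are independent. -/
def IsDependentField {Ω : Type*} [MeasurableSpace Ω] (P : Measure Ω) (m : ℕ)
    (X : ℕ → ℕ → Ω → ℝ) : Prop :=
  ∀ S T : Set (ℕ × ℕ), (∀ s ∈ S, s.1 ≤ s.2) → (∀ t ∈ T, t.1 ≤ t.2) →
    (∀ s ∈ S, ∀ t ∈ T, (m : ℝ) < dist s t) →
    Indep (⨆ s ∈ S, MeasurableSpace.comap (X s.1 s.2) inferInstance)
      (⨆ t ∈ T, MeasurableSpace.comap (X t.1 t.2) inferInstance) P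

end CirculantBlocks

end

/-! A symmetric circulant is diagonalized by the discrete Fourier transform, whatever its letters
are. Conjugating the block matrix by (identity) ⊗ (Fourier matrix) therefore turns it into a direct
sum of `k` symmetric `n × n` matrices, the `r`-th of which has as entries the `r`-th eigenvalues of
the blocks (`stieltjes_spectralMeasure_blockMatrix`). For fixed `r` these entries are independent
and identically distributed up to symmetry, so each summand is a Wigner matrix. Different summands
are in general dependent, which is harmless: almost sure convergence of each of the `k` summands is
enough, and the limit is the average of `k` semicircle laws.

The variance of an eigenvalue is found by noting that positions `m` and `-m` share a letter, so
every letter counts twice except those at the one or two positions with `2m = 0`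
(`sum_sum_cosCoeff`). It depends only on whether the character `r` is real, and this produces the
two components of the limit law (`stieltjes_nu`).

Wigner's law with only two moments (`ae_tendsto_trRes`) is proved through the normalized trace `s`
of the resolvent. Removing one symmetric pair of entries and expanding to first order gives `1 + z E
s + v E s² → 0`, with a Lindeberg type error controlled by dominated convergence
(`norm_self_consistent_le`). A change of one row of the lower triangle is a perturbation of rank at
most two and moves `s` by `O(1/n)`, so bounded differences and Borel–Cantelli give `s - E s → 0`
almost surely (`ae_tendsto_trRes_sub_integral`). Hence `E s` satisfies in the limit the quadratic
equation of the semicircle law, and positivity of imaginary parts selects the root. Convergence of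
Stieltjes transforms gives weak convergence by Stone–Weierstrass (`tendsto_of_tendsto_stieltjes`).

For finite dependence, two upper triangular positions that carry the same variable lie in the same
block, hence at distance at most `k - 1`. Finally, a semicircle law is determined by its null sets,
and a genuine mixture has the null sets of its wider component without being equal to it
(`mixture_semicircle_ne_semicircle`). -/

noncomputable section

namespace CirculantBlocks

open scoped Matrix.Norms.L2Operator Matrix

/-! ### Resolvents of Hermitian matrices -/

section Resolvent

variable {ι : Type*} [Fintype ι] [DecidableEq ι]

/-- The resolvent `(H - z)⁻¹`. -/
def res (H : Matrix ι ι ℂ) (z : ℂ) : Matrix ι ι ℂ := (H - z • (1 : Matrix ι ι ℂ))⁻¹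

lemma norm_apply_le (M : Matrix ι ι ℂ) (i j : ι) : ‖M i j‖ ≤ ‖M‖ := by
  have h := Matrix.l2_opNorm_mulVec M (EuclideanSpace.single j 1)
  have h2 := PiLp.norm_apply_le ((EuclideanSpace.equiv ι ℂ).symm
    (M *ᵥ (EuclideanSpace.single j (1 : ℂ)))) i
  rw [PiLp.norm_single, norm_one, mul_one] at h
  refine le_trans (le_of_eq ?_) (h2.trans h)
  simp

lemma norm_single_le (i j : ι) : ‖(Matrix.single i j 1 : Matrix ι ι ℂ)‖ ≤ 1 := by
  have h := Matrix.l2_opNorm_conjTranspose_mul_self (Matrix.single i j 1 : Matrix ι ι ℂ)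
  rw [Matrix.conjTranspose_single, Matrix.single_mul_single_same, ← Matrix.diagonal_single,
    Matrix.l2_opNorm_diagonal] at h
  have h1 : ‖(Pi.single j (star (1:ℂ) * 1) : ι → ℂ)‖ ≤ 1 := by
    rw [pi_norm_le_iff_of_nonneg zero_le_one]
    intro a
    by_cases hh : a = j
    · subst hh; simp
    · simp [hh]
  nlinarith [norm_nonneg (Matrix.single i j 1 : Matrix ι ι ℂ)]

/-- The sum is the `(j, j)` entry of `Mᴴ * M`, whose norm is `‖M‖ ^ 2`. -/
lemma sum_norm_sq_apply_le (M : Matrix ι ι ℂ) (j : ι) : ∑ i, ‖M i j‖ ^ 2 ≤ ‖M‖ ^ 2 := by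
  have h := norm_apply_le (Mᴴ * M) j j
  rw [Matrix.l2_opNorm_conjTranspose_mul_self, ← sq] at h
  refine le_trans (le_of_eq ?_) h
  have : (Mᴴ * M) j j = ((∑ i, ‖M i j‖ ^ 2 : ℝ) : ℂ) := by
    rw [Matrix.mul_apply]
    push_cast
    refine Finset.sum_congr rfl fun i _ => ?_
    rw [Matrix.conjTranspose_apply, Complex.star_def, Complex.conj_mul']
  rw [this, Complex.norm_real, Real.norm_of_nonneg (by positivity)]

/-- The trace can be computed on the range of `M`, in an orthonormal basis with `M.rank` elements,
and each diagonal coefficient is at most `‖M‖`. -/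
lemma norm_trace_le_rank_mul (M : Matrix ι ι ℂ) : ‖M.trace‖ ≤ M.rank * ‖M‖ := by
  set T := M.toEuclideanLin with hT
  have htr : M.trace = LinearMap.trace ℂ _ T := by
    rw [hT, Matrix.toEuclideanLin_eq_toLin_orthonormal, Matrix.trace_toLin_eq]
  have hrk : M.rank = Module.finrank ℂ (LinearMap.range T) := by
    rw [Matrix.rank_eq_finrank_range_toLin M (EuclideanSpace.basisFun ι ℂ).toBasis
      (EuclideanSpace.basisFun ι ℂ).toBasis, ← Matrix.toEuclideanLin_eq_toLin_orthonormal]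
  rw [htr, ← LinearMap.trace_restrict_eq_of_forall_mem (LinearMap.range T) T
    (fun x => LinearMap.mem_range_self T x),
    LinearMap.trace_eq_sum_inner _ (stdOrthonormalBasis ℂ (LinearMap.range T)), hrk]
  refine (norm_sum_le _ _).trans ?_
  calc _ ≤ ∑ _i : Fin (Module.finrank ℂ (LinearMap.range T)), ‖M‖ := by
        refine Finset.sum_le_sum fun i _ => ?_
        refine (norm_inner_le_norm _ _).trans ?_
        rw [OrthonormalBasis.norm_eq_one, one_mul, Submodule.coe_norm, LinearMap.coe_restrict_apply]
        have := Matrix.l2_opNorm_mulVec M ((stdOrthonormalBasis ℂ (LinearMap.range T)) i)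
        rw [← Submodule.coe_norm, OrthonormalBasis.norm_eq_one, mul_one] at this
        exact this
    _ = _ := by simp

variable {H H' : Matrix ι ι ℂ} {z : ℂ}

lemma isUnit_sub_smul_one (hH : H.IsHermitian) (hz : z.im ≠ 0) :
    IsUnit (H - z • (1 : Matrix ι ι ℂ)) := by
  have hsa : IsSelfAdjoint H := hH
  have : z ∉ spectrum ℂ H := fun hmem => hz (by
    rw [hsa.mem_spectrum_eq_re hmem]; simp)
  rw [spectrum.notMem_iff] at this
  have h2 := this.neg
  rwa [neg_sub, Algebra.algebraMap_eq_smul_one] at h2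

lemma sub_smul_one_mul_res (hH : H.IsHermitian) (hz : z.im ≠ 0) :
    (H - z • (1 : Matrix ι ι ℂ)) * res H z = 1 :=
  Matrix.mul_nonsing_inv _ ((Matrix.isUnit_iff_isUnit_det _).1 (isUnit_sub_smul_one hH hz))

lemma mul_res (hH : H.IsHermitian) (hz : z.im ≠ 0) : H * res H z = 1 + z • res H z := by
  have := sub_smul_one_mul_res hH hz
  rw [sub_mul, smul_mul_assoc, one_mul] at this
  rw [← this]; abel

lemma res_sub_res (hH : H.IsHermitian) (hH' : H'.IsHermitian) (hz : z.im ≠ 0) :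
    res H' z - res H z = - (res H' z * (H' - H) * res H z) := by
  unfold res
  rw [Matrix.inv_sub_inv (iff_of_true (isUnit_sub_smul_one hH' hz) (isUnit_sub_smul_one hH hz)),
    sub_sub_sub_cancel_right, ← neg_sub H' H, mul_neg, neg_mul]

lemma res_sub_res_point (hH : H.IsHermitian) (hz : z.im ≠ 0) {w : ℂ} (hw : w.im ≠ 0) :
    res H z - res H w = (z - w) • (res H z * res H w) := by
  unfold res
  rw [Matrix.inv_sub_inv (iff_of_true (isUnit_sub_smul_one hH hz) (isUnit_sub_smul_one hH hw)),
    sub_sub_sub_cancel_left, ← sub_smul, mul_smul_comm, mul_one, smul_mul_assoc]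

lemma conjTranspose_res (hH : H.IsHermitian) : (res H z)ᴴ = res H (star z) := by
  unfold res
  rw [Matrix.conjTranspose_nonsing_inv, Matrix.conjTranspose_sub, hH.eq,
    Matrix.conjTranspose_smul, Matrix.conjTranspose_one]

/-- The resolvent identity at `star z` and `z` reads `Gᴴ - G = (star z - z) • (Gᴴ * G)`. Taking
norms with the C⋆-identity gives `2 |Im z| ‖G‖² ≤ 2 ‖G‖`. -/
lemma norm_res_le (hH : H.IsHermitian) (hz : z.im ≠ 0) : ‖res H z‖ ≤ |z.im|⁻¹ := by
  have hz' : (star z).im ≠ 0 := by simpa using hz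
  have h := res_sub_res_point hH hz' hz
  rw [← conjTranspose_res hH] at h
  have h2 : ‖(res H z)ᴴ - res H z‖ ≤ 2 * ‖res H z‖ := by
    refine (norm_sub_le _ _).trans ?_
    rw [Matrix.l2_opNorm_conjTranspose]; linarith
  rw [h, norm_smul, Matrix.l2_opNorm_conjTranspose_mul_self] at h2
  have h3 : ‖star z - z‖ = 2 * |z.im| := by
    have : star z - z = ((-2 * z.im : ℝ) : ℂ) * Complex.I := by
      apply Complex.ext <;> simp; ring
    rw [this, norm_mul, Complex.norm_I, Complex.norm_real, Real.norm_eq_abs, abs_mul]; norm_num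
  rw [h3] at h2
  have hpos : 0 < |z.im| := abs_pos.2 hz
  rcases (norm_nonneg (res H z)).eq_or_lt with h0 | h0
  · rw [← h0]; positivity
  · rw [← one_div, le_div_iff₀ hpos]
    nlinarith

lemma norm_res_sub_res_le (hH : H.IsHermitian) (hH' : H'.IsHermitian) (hz : z.im ≠ 0) :
    ‖res H' z - res H z‖ ≤ 2 * |z.im|⁻¹ :=
  (norm_sub_le _ _).trans (by linarith [norm_res_le hH hz, norm_res_le hH' hz])

/-- The trace of the resolvent is stable under perturbations of low rank. -/
lemma norm_trace_res_sub_le (hH : H.IsHermitian) (hH' : H'.IsHermitian) (hz : z.im ≠ 0) {r : ℕ}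
    (hr : (H' - H).rank ≤ r) :
    ‖(res H' z).trace - (res H z).trace‖ ≤ r * (2 * |z.im|⁻¹) := by
  rw [← Matrix.trace_sub]
  refine (norm_trace_le_rank_mul _).trans ?_
  have h1 : (res H' z - res H z).rank ≤ r := by
    rw [res_sub_res hH hH' hz, ← neg_mul, ← neg_mul]
    calc _ ≤ (-res H' z * (H' - H)).rank := Matrix.rank_mul_le_left _ _
      _ ≤ _ := (Matrix.rank_mul_le_right _ _).trans hr
  have h2 := norm_res_sub_res_le hH hH' hz
  gcongr

lemma rank_matrix_add_le {ι : Type*} [Fintype ι] (M N : Matrix ι ι ℂ) : (M + N).rank ≤ M.rank + N.rank := by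
  unfold Matrix.rank
  rw [Matrix.mulVecLin_add]
  refine le_trans (Submodule.finrank_mono ?_)
    (Submodule.finrank_add_le_finrank_add_finrank _ _)
  rintro _ ⟨v, rfl⟩
  exact Submodule.add_mem_sup ⟨v, rfl⟩ ⟨v, rfl⟩

/-- Such a matrix is the sum of its row `a` and the rest of its column `a`, each of rank at most
one. -/
lemma rank_le_of_support (M : Matrix ι ι ℂ) (a : ι)
    (hM : ∀ i j, i ≠ a → j ≠ a → M i j = 0) : M.rank ≤ 2 := by
  have h : M = Matrix.vecMulVec (Pi.single a 1) (M a) +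
      Matrix.vecMulVec (fun i => if i = a then 0 else M i a) (Pi.single a 1) := by
    ext i j
    by_cases hi : i = a <;> by_cases hj : j = a
    · subst hi; subst hj; simp [Matrix.vecMulVec_apply]
    · subst hi; simp [Matrix.vecMulVec_apply]
    · subst hj; simp [Matrix.vecMulVec_apply, hi]
    · simp [Matrix.vecMulVec_apply, hi, hj, hM i j hi hj]
  rw [h]
  refine (rank_matrix_add_le _ _).trans ?_
  linarith [Matrix.rank_vecMulVec_le (Pi.single a 1) (M a),
    Matrix.rank_vecMulVec_le (fun i => if i = a then 0 else M i a) (Pi.single a 1)]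

lemma norm_trace_le (M : Matrix ι ι ℂ) : ‖M.trace‖ ≤ Fintype.card ι * ‖M‖ :=
  (norm_trace_le_rank_mul M).trans (by gcongr; exact Matrix.rank_le_card_width M)

/-- First order expansion of the resolvent. -/
lemma res_expand (hH : H.IsHermitian) (hH' : H'.IsHermitian) (hz : z.im ≠ 0) :
    res H' z = res H z - res H z * (H' - H) * res H z
      + res H' z * (H' - H) * res H z * (H' - H) * res H z := by
  have h := res_sub_res hH hH' hz
  have h1 : res H' z = res H z - res H' z * (H' - H) * res H z := by
    rw [sub_eq_add_neg, ← h]; abel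
  have h2 : res H' z * (H' - H) * res H z = res H z * (H' - H) * res H z
      - res H' z * (H' - H) * res H z * (H' - H) * res H z := by
    nth_rw 1 [h1]
    noncomm_ring
  rw [h2] at h1
  nth_rw 1 [h1]
  abel

end Resolvent

end CirculantBlocks
end

noncomputable section

namespace CirculantBlocks

/-! ### Concentration by bounded differences -/

section BoundedDifferences

variable {E : Type*} [MeasurableSpace E]

/-- The exponential moment bound behind McDiarmid's bounded differences inequality. -/
theorem integral_exp_le_of_bounded_differences {c : ℝ} (hc : 0 ≤ c) (t : ℝ) :
    ∀ {n : ℕ} (μ : Fin n → Measure E) [∀ i, IsProbabilityMeasure (μ i)] {f : (Fin n → E) → ℝ}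
      (_ : Measurable f) {B : ℝ} (_ : ∀ x, |f x| ≤ B)
      (_ : ∀ x i e, |f (Function.update x i e) - f x| ≤ c),
      ∫ x, Real.exp (t * (f x - ∫ y, f y ∂(Measure.pi μ))) ∂(Measure.pi μ)
        ≤ Real.exp (n * (c ^ 2 * t ^ 2 / 2)) := by
  intro n
  induction n with
  | zero =>
    intro μ _ f hf B hB hd
    have : ∀ x : Fin 0 → E, f x = f default := fun x => by rw [Subsingleton.elim x default]
    simp [this]
  | succ n ih =>
    intro μ _ f hf B hB hd
    set ν := Measure.pi fun j : Fin n => μ j.succ with hν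
    set F : E × (Fin n → E) → ℝ := fun p => f (Fin.cons p.1 p.2) with hF
    have hmp := (measurePreserving_piFinSuccAbove μ 0)
    have hmp' : MeasurePreserving (MeasurableEquiv.piFinSuccAbove (fun _ => E) 0)
        (Measure.pi μ) ((μ 0).prod ν) := by simpa using hmp
    have hFm : Measurable F := by
      have := hf.comp (MeasurableEquiv.piFinSuccAbove (fun _ : Fin (n+1) => E) 0).symm.measurable
      convert this using 1
      ext p
      simp [F, MeasurableEquiv.piFinSuccAbove]
      rfl
    have hFf : ∀ x, f x = F (MeasurableEquiv.piFinSuccAbove (fun _ => E) 0 x) := fun x => by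
      simp only [F, MeasurableEquiv.piFinSuccAbove_apply, Fin.insertNthEquiv, Equiv.coe_fn_symm_mk]
      congr 1
      exact (Fin.cons_self_tail x).symm
    have hFB : ∀ p, |F p| ≤ B := fun p => hB _
    have hint : ∀ G : E × (Fin n → E) → ℝ,
        ∫ x, G (MeasurableEquiv.piFinSuccAbove (fun _ => E) 0 x) ∂(Measure.pi μ)
          = ∫ p, G p ∂((μ 0).prod ν) := fun G => hmp'.integral_comp' G
    have hFi : Integrable F ((μ 0).prod ν) :=
      Integrable.of_bound hFm.aestronglyMeasurable B (Eventually.of_forall hFB)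
    -- Induction integrates out the first coordinate: the average `g` inherits the bound, the
    -- difference constant and the mean of `f`.
    set g : (Fin n → E) → ℝ := fun y => ∫ e, F (e, y) ∂(μ 0) with hg
    have hgm : Measurable g :=
      (hFm.stronglyMeasurable.integral_prod_left (μ := μ 0)).measurable
    have hFye : ∀ y, Integrable (fun e => F (e, y)) (μ 0) := fun y =>
      Integrable.of_bound (hFm.comp (by fun_prop)).aestronglyMeasurable B
        (Eventually.of_forall fun e => hFB _)
    have hgB : ∀ y, |g y| ≤ B := fun y => by
      have := norm_integral_le_of_norm_le_const (μ := μ 0) (C := B)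
        (f := fun e => F (e, y)) (Eventually.of_forall fun e => hFB _)
      simpa using this
    have hgd : ∀ y i e, |g (Function.update y i e) - g y| ≤ c := fun y i e => by
      simp only [hg]
      rw [← integral_sub (hFye _) (hFye _)]
      have := norm_integral_le_of_norm_le_const (μ := μ 0) (C := c)
        (f := fun a => F (a, Function.update y i e) - F (a, y)) (Eventually.of_forall fun a => by
          simp only [F]
          rw [Fin.cons_update]
          exact hd _ _ _)
      simpa using this
    have hEf : ∫ y, f y ∂(Measure.pi μ) = ∫ y, g y ∂ν := by
      rw [integral_congr_ae (Eventually.of_forall hFf), hint F, integral_prod_symm F hFi]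
    rw [hEf]
    set m := ∫ y, g y ∂ν
    have hmB : |m| ≤ B := by
      have := norm_integral_le_of_norm_le_const (μ := ν) (C := B)
        (f := g) (Eventually.of_forall fun e => hgB _)
      simpa using this
    have h1 : ∫ x, Real.exp (t * (f x - m)) ∂(Measure.pi μ)
        = ∫ p, Real.exp (t * (F p - m)) ∂((μ 0).prod ν) := by
      rw [← hint]
      exact integral_congr_ae (Eventually.of_forall fun x => by simp only [hFf x])
    have hexp : ∀ a : ℝ, |a| ≤ 2 * B → ‖Real.exp (t * a)‖ ≤ Real.exp (|t| * (2 * B)) := fun a ha => by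
      rw [Real.norm_eq_abs, Real.abs_exp, Real.exp_le_exp]
      refine (le_abs_self _).trans ?_
      rw [abs_mul]
      gcongr
    have habs : ∀ a b : ℝ, |a| ≤ B → |b| ≤ B → |a - b| ≤ 2 * B := fun a b ha hb => by
      refine (abs_sub _ _).trans ?_
      linarith
    have hi1 : Integrable (fun p => Real.exp (t * (F p - m))) ((μ 0).prod ν) :=
      Integrable.of_bound (by fun_prop) (Real.exp (|t| * (2 * B)))
        (Eventually.of_forall fun p => hexp _ (habs _ _ (hFB p) hmB))
    have hi2 : Integrable (fun y => Real.exp (t * (g y - m))) ν :=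
      Integrable.of_bound (by fun_prop) (Real.exp (|t| * (2 * B)))
        (Eventually.of_forall fun p => hexp _ (habs _ _ (hgB p) hmB))
    rw [h1, integral_prod_symm _ hi1]
    have key : ∀ y, ∫ e, Real.exp (t * (F (e, y) - m)) ∂(μ 0)
        ≤ Real.exp (t * (g y - m)) * Real.exp (c ^ 2 * t ^ 2 / 2) := fun y => by
      have e1 : ∀ e, Real.exp (t * (F (e, y) - m))
          = Real.exp (t * (g y - m)) * Real.exp (t * (F (e, y) - g y)) := fun e => by
        rw [← Real.exp_add]; ring_nf
      simp_rw [e1]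
      rw [integral_const_mul]
      gcongr
      -- With the other coordinates frozen, the values lie within `c` of the value at a reference
      -- point `e0`. Hoeffding's lemma on an interval of length `2 * c` gives variance proxy `c ^
      -- 2`.
      obtain ⟨e0⟩ : Nonempty E := (μ 0).nonempty_of_neZero
      have hs := hasSubgaussianMGF_of_mem_Icc (μ := μ 0) (X := fun e => F (e, y))
        (a := F (e0, y) - c) (b := F (e0, y) + c) (hFm.comp (by fun_prop)).aemeasurable
        (Eventually.of_forall fun e => by
          have := hd (Fin.cons e0 y) 0 e
          rw [Fin.update_cons_zero, abs_le] at this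
          constructor <;> simp only [F] <;> linarith)
      have := hs.mgf_le t
      refine this.trans (le_of_eq ?_)
      congr 2
      have : F (e0, y) + c - (F (e0, y) - c) = 2 * c := by ring
      rw [this]
      simp [abs_of_nonneg hc]
    calc _ ≤ ∫ y, Real.exp (t * (g y - m)) * Real.exp (c ^ 2 * t ^ 2 / 2) ∂ν :=
          integral_mono hi1.integral_prod_right (hi2.mul_const _) key
      _ ≤ Real.exp (n * (c ^ 2 * t ^ 2 / 2)) * Real.exp (c ^ 2 * t ^ 2 / 2) := by
          rw [integral_mul_const]
          gcongr
          exact ih (fun j => μ j.succ) hgm hgB hgd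
      _ = _ := by
          rw [← Real.exp_add]; push_cast; ring_nf

variable {Ω : Type*} [MeasurableSpace Ω] {P : Measure Ω} [IsProbabilityMeasure P]

lemma hasSubgaussianMGF_of_bounded_differences {n : ℕ} {X : Fin n → Ω → E}
    (hX : ∀ i, Measurable (X i)) (hind : iIndepFun X P) {f : (Fin n → E) → ℝ} (hf : Measurable f)
    {B : ℝ} (hB : ∀ x, |f x| ≤ B) {c : ℝ≥0}
    (hd : ∀ x i e, |f (Function.update x i e) - f x| ≤ c) :
    HasSubgaussianMGF (fun ω => f (fun i => X i ω) - ∫ ω', f (fun i => X i ω') ∂P)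
      (n * c ^ 2) P := by
  have hXm : Measurable fun ω i => X i ω := measurable_pi_iff.2 hX
  have hmap := hind.map_fun_eq_pi_map fun i => (hX i).aemeasurable
  have : ∀ i, IsProbabilityMeasure (P.map (X i)) := fun i =>
    Measure.isProbabilityMeasure_map (hX i).aemeasurable
  have hint : ∀ g : (Fin n → E) → ℝ, Measurable g → ∫ ω, g (fun i => X i ω) ∂P
      = ∫ x, g x ∂(Measure.pi fun i => P.map (X i)) := fun g hg => by
    rw [← hmap, integral_map hXm.aemeasurable hg.aestronglyMeasurable]
  set m := ∫ ω', f (fun i => X i ω') ∂P with hm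
  have hmB : |m| ≤ B := by
    have := norm_integral_le_of_norm_le_const (μ := P) (C := B)
      (f := fun ω' => f (fun i => X i ω')) (Eventually.of_forall fun e => hB _)
    simpa using this
  refine ⟨fun t => ?_, fun t => ?_⟩
  · have hfm : Measurable fun ω => f (fun i => X i ω) := hf.comp hXm
    refine Integrable.of_bound
      (Real.measurable_exp.comp ((hfm.sub_const m).const_mul t)).aestronglyMeasurable
      (Real.exp (|t| * (2 * B))) (Eventually.of_forall fun ω => ?_)
    rw [Real.norm_eq_abs, Real.abs_exp, Real.exp_le_exp]
    refine (le_abs_self _).trans ?_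
    rw [abs_mul]
    gcongr
    refine (abs_sub _ _).trans ?_
    linarith [hB fun i => X i ω]
  · have h := integral_exp_le_of_bounded_differences c.2 t (fun i => P.map (X i)) hf hB hd
    rw [← hint f hf, ← hm, ← hint (fun x => Real.exp (t * (f x - m))) (by fun_prop)] at h
    refine h.trans (le_of_eq ?_)
    congr 1
    push_cast
    simp
    ring

/-- Functionals of `n` independent variables with differences `O(1/n)` concentrate. -/
theorem ae_tendsto_sub_integral_real {X : ℕ → Ω → E} (hX : ∀ i, Measurable (X i))
    (hind : iIndepFun X P) {f : ∀ n, (Fin n → E) → ℝ} (hf : ∀ n, Measurable (f n)) {B : ℝ}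
    (hB : ∀ n x, |f n x| ≤ B) {C : ℝ≥0} (hC : 0 < C)
    (hd : ∀ n x i e, |f n (Function.update x i e) - f n x| ≤ C / n) :
    ∀ᵐ ω ∂P, Tendsto (fun n => f n (fun i => X i ω) - ∫ ω', f n (fun i => X i ω') ∂P)
      atTop (𝓝 0) := by
  set Y : ℕ → Ω → ℝ := fun n ω => f n (fun i => X i ω) - ∫ ω', f n (fun i => X i ω') ∂P with hY
  have hs : ∀ n, HasSubgaussianMGF (Y n) (n * (C / n) ^ 2) P := fun n =>
    hasSubgaussianMGF_of_bounded_differences (X := fun i : Fin n => X i) (fun i => hX i)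
      (hind.precomp Fin.val_injective) (hf n) (hB n) (by simpa using hd n)
  have htail : ∀ ε : ℝ, 0 < ε → ∀ᵐ ω ∂P, ∀ᶠ n in atTop, |Y n ω| < ε := by
    intro ε hε
    have hbound : ∀ n : ℕ, P {ω | ε ≤ |Y n ω|}
        ≤ ENNReal.ofReal (2 * Real.exp (-(ε ^ 2 / (2 * C ^ 2)) * n)) := by
      intro n
      have h1 := (hs n).measure_ge_le hε.le
      have h2 := (hs n).neg.measure_ge_le hε.le
      -- The proxy `n * (C / n) ^ 2` equals `C ^ 2 / n`, so the tails decay exponentially in `n` and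
      -- Borel–Cantelli applies.
      have hexp : -ε ^ 2 / (2 * ((n * (C / n) ^ 2 : ℝ≥0) : ℝ)) = -(ε ^ 2 / (2 * C ^ 2)) * n := by
        push_cast
        rcases Nat.eq_zero_or_pos n with rfl | hn
        · simp
        · have : (0:ℝ) < n := by exact_mod_cast hn
          have : (0:ℝ) < C := hC
          field_simp
      rw [hexp] at h1 h2
      have hsub : {ω | ε ≤ |Y n ω|} ⊆ {ω | ε ≤ Y n ω} ∪ {ω | ε ≤ (-Y n) ω} := by
        intro ω hω
        simpa [le_abs] using hω
      have h3 := (measureReal_mono hsub (by finiteness)).trans (measureReal_union_le (μ := P) _ _)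
      rw [← ofReal_measureReal]
      exact ENNReal.ofReal_le_ofReal (by linarith)
    have hsum : ∑' n, P {ω | ε ≤ |Y n ω|} ≠ ∞ := by
      refine ne_top_of_le_ne_top ?_ (ENNReal.tsum_le_tsum hbound)
      rw [← ENNReal.ofReal_tsum_of_nonneg (fun n => by positivity)]
      · exact ENNReal.ofReal_ne_top
      · refine Summable.mul_left _ ?_
        have : -(ε ^ 2 / (2 * (C:ℝ) ^ 2)) < 0 := by
          have : (0:ℝ) < C := hC
          have : 0 < ε ^ 2 / (2 * (C:ℝ) ^ 2) := by positivity
          linarith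
        simpa [mul_comm] using Real.summable_exp_nat_mul_iff.2 this
    have := ae_eventually_notMem hsum
    filter_upwards [this] with ω hω
    filter_upwards [hω] with n hn
    simpa using hn
  have hall : ∀ᵐ ω ∂P, ∀ k : ℕ, ∀ᶠ n in atTop, |Y n ω| < 1 / ((k:ℝ) + 1) :=
    ae_all_iff.2 fun k => htail _ (by positivity)
  filter_upwards [hall] with ω hω
  rw [Metric.tendsto_atTop']
  intro ε hε
  obtain ⟨k, hk⟩ := exists_nat_one_div_lt hε
  obtain ⟨N, hN⟩ := eventually_atTop.1 (hω k)
  exact ⟨N, fun n hn => by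
    rw [Real.dist_eq, sub_zero]; exact (hN n hn.le).trans hk⟩

theorem ae_tendsto_sub_integral {X : ℕ → Ω → E} (hX : ∀ i, Measurable (X i))
    (hind : iIndepFun X P) {f : ∀ n, (Fin n → E) → ℂ} (hf : ∀ n, Measurable (f n)) {B : ℝ}
    (hB : ∀ n x, ‖f n x‖ ≤ B) {C : ℝ≥0} (hC : 0 < C)
    (hd : ∀ n x i e, ‖f n (Function.update x i e) - f n x‖ ≤ C / n) :
    ∀ᵐ ω ∂P, Tendsto (fun n => f n (fun i => X i ω) - ∫ ω', f n (fun i => X i ω') ∂P)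
      atTop (𝓝 0) := by
  have hre := ae_tendsto_sub_integral_real hX hind (f := fun n x => (f n x).re)
    (fun n => Complex.measurable_re.comp (hf n))
    (fun n x => (Complex.abs_re_le_norm _).trans (hB n x)) hC
    (fun n x i e => by
      rw [← Complex.sub_re]; exact (Complex.abs_re_le_norm _).trans (hd n x i e))
  have him := ae_tendsto_sub_integral_real hX hind (f := fun n x => (f n x).im)
    (fun n => Complex.measurable_im.comp (hf n))
    (fun n x => (Complex.abs_im_le_norm _).trans (hB n x)) hC
    (fun n x i e => by
      rw [← Complex.sub_im]; exact (Complex.abs_im_le_norm _).trans (hd n x i e))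
  have hi : ∀ n, Integrable (fun ω => f n (fun i => X i ω)) P := fun n =>
    Integrable.of_bound ((hf n).comp (measurable_pi_iff.2 fun i => hX i)).aestronglyMeasurable B
      (Eventually.of_forall fun ω => hB _ _)
  filter_upwards [hre, him] with ω h1 h2
  have h3 := ((Complex.continuous_ofReal.tendsto 0).comp h1).add
    (((Complex.continuous_ofReal.tendsto 0).comp h2).mul_const Complex.I)
  simp only [Complex.ofReal_zero, zero_mul, add_zero] at h3
  refine h3.congr fun n => ?_
  have e1 : ∫ ω', (f n (fun i => X i ω')).re ∂P = (∫ ω', f n (fun i => X i ω') ∂P).re :=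
    integral_re (hi n)
  have e2 : ∫ ω', (f n (fun i => X i ω')).im ∂P = (∫ ω', f n (fun i => X i ω') ∂P).im :=
    integral_im (hi n)
  apply Complex.ext <;> simp [e1, e2]

end BoundedDifferences

end CirculantBlocks
end

noncomputable section

namespace CirculantBlocks

/-! ### The Stieltjes transform of the semicircle law -/

section SemicircleStieltjes

/-- The Stieltjes transform of a measure on the line. -/
def stieltjes (μ : Measure ℝ) (z : ℂ) : ℂ := ∫ x, ((x : ℂ) - z)⁻¹ ∂μ

lemma sub_ne_zero_of_im {z : ℂ} (hz : z.im ≠ 0) (x : ℝ) : (x : ℂ) - z ≠ 0 := fun h => hz (by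
  have := congrArg Complex.im h
  simpa using this)

lemma norm_inv_sub_le {z : ℂ} (hz : z.im ≠ 0) (x : ℝ) : ‖((x : ℂ) - z)⁻¹‖ ≤ |z.im|⁻¹ := by
  rw [norm_inv]
  refine inv_anti₀ (abs_pos.2 hz) ?_
  have := Complex.abs_im_le_norm ((x : ℂ) - z)
  simpa using this

lemma continuous_inv_sub {z : ℂ} (hz : z.im ≠ 0) : Continuous fun x : ℝ => ((x : ℂ) - z)⁻¹ :=
  Continuous.inv₀ (by fun_prop) (sub_ne_zero_of_im hz)

lemma integrable_inv_sub (μ : Measure ℝ) [IsFiniteMeasure μ] {z : ℂ} (hz : z.im ≠ 0) :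
    Integrable (fun x : ℝ => ((x : ℂ) - z)⁻¹) μ :=
  Integrable.of_bound (continuous_inv_sub hz).aestronglyMeasurable _
    (Eventually.of_forall (norm_inv_sub_le hz))

lemma stieltjes_im_nonneg (μ : Measure ℝ) [IsFiniteMeasure μ] {z : ℂ} (hz : 0 < z.im) :
    0 ≤ (stieltjes μ z).im := by
  unfold stieltjes
  have h : ∫ x, (((x : ℂ) - z)⁻¹).im ∂μ = (∫ x, ((x : ℂ) - z)⁻¹ ∂μ).im :=
    integral_im (integrable_inv_sub μ hz.ne')
  rw [← h]
  refine integral_nonneg fun x => ?_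
  simp only [Complex.inv_im, Complex.sub_im, Complex.ofReal_im, zero_sub, neg_neg, Pi.zero_apply]
  exact div_nonneg hz.le (Complex.normSq_nonneg _)

/-- Every nonreal number is `-(w + w⁻¹)` for some `w` in the punctured unit disc. -/
lemma exists_joukowski {z : ℂ} (hz : z.im ≠ 0) : ∃ w : ℂ, ‖w‖ < 1 ∧ w ≠ 0 ∧ w ^ 2 + z * w + 1 = 0 := by
  obtain ⟨d, hd⟩ := IsAlgClosed.exists_pow_nat_eq (z ^ 2 - 4) (n := 2) (by norm_num)
  set a := (-z + d) / 2 with ha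
  set b := (-z - d) / 2 with hb
  have hab : a * b = 1 := by
    have : a * b = (z ^ 2 - d ^ 2) / 4 := by rw [ha, hb]; ring
    rw [this, hd]; ring
  have hsum : a + b = -z := by rw [ha, hb]; ring
  have hroot : ∀ w, w = a ∨ w = b → w ≠ 0 ∧ w ^ 2 + z * w + 1 = 0 := by
    have h0 : a ≠ 0 ∧ b ≠ 0 := by
      constructor <;> rintro h <;> simp [h] at hab
    have hz' : z = -(a + b) := by rw [hsum]; ring
    rintro w (rfl | rfl)
    · exact ⟨h0.1, by rw [hz', ← hab]; ring⟩
    · exact ⟨h0.2, by rw [hz', ← hab]; ring⟩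
  have hn : ‖a‖ * ‖b‖ = 1 := by rw [← norm_mul, hab, norm_one]
  -- The roots have product one. If both were on the unit circle they would be conjugate, and `-z =
  -- a + b` would be real.
  have hne : ‖a‖ ≠ 1 := by
    intro h1
    have hb' : b = star a := by
      have : a * star a = 1 := by
        rw [Complex.star_def, Complex.mul_conj']; simp [h1]
      have ha0 : a ≠ 0 := (hroot a (Or.inl rfl)).1
      exact mul_left_cancel₀ ha0 (hab.trans this.symm)
    rw [hb'] at hsum
    apply hz
    have := congrArg Complex.im hsum
    simp at this
    exact this
  rcases lt_or_gt_of_ne hne with h | h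
  · exact ⟨a, h, hroot a (Or.inl rfl)⟩
  · refine ⟨b, ?_, hroot b (Or.inr rfl)⟩
    by_contra hcon
    push Not at hcon
    nlinarith

/-- Difference of two geometric series with ratios `-w e^{iθ}` and `-w e^{-iθ}`; this is the
generating function of the Chebyshev polynomials of the second kind. -/
lemma hasSum_sin_mul_pow {w : ℂ} (hw : ‖w‖ < 1) (θ : ℝ) :
    HasSum (fun n : ℕ => (-w) ^ n * (Real.sin ((n + 1) * θ) : ℂ))
      (Real.sin θ / (1 + 2 * w * Real.cos θ + w ^ 2)) := by
  set e := Complex.exp (θ * Complex.I) with he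
  set f := Complex.exp (-θ * Complex.I) with hf
  have hne : ‖e‖ = 1 := Complex.norm_exp_ofReal_mul_I θ
  have hnf : ‖f‖ = 1 := by rw [hf, ← Complex.ofReal_neg]; exact Complex.norm_exp_ofReal_mul_I _
  have hef : e * f = 1 := by rw [he, hf, ← Complex.exp_add]; simp
  have h1 := (hasSum_geometric_of_norm_lt_one (ξ := -w * e) (by rw [norm_mul, norm_neg, hne]; simpa)).mul_left e
  have h2 := (hasSum_geometric_of_norm_lt_one (ξ := -w * f) (by rw [norm_mul, norm_neg, hnf]; simpa)).mul_left f
  have h3 := (h1.sub h2).mul_left (-Complex.I / 2)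
  have hsin : ∀ n : ℕ, (Real.sin ((n + 1) * θ) : ℂ) = -Complex.I / 2 * (e ^ (n + 1) - f ^ (n + 1)) := by
    intro n
    rw [he, hf, ← Complex.exp_nat_mul, ← Complex.exp_nat_mul, Complex.ofReal_sin, Complex.sin]
    push_cast
    ring_nf
  have hd1 : 1 - -w * e ≠ 0 := fun h => by
    have : ‖-w * e‖ = 1 := by rw [← sub_eq_zero.1 h]; simp
    rw [norm_mul, norm_neg, hne] at this; linarith
  have hd2 : 1 - -w * f ≠ 0 := fun h => by
    have : ‖-w * f‖ = 1 := by rw [← sub_eq_zero.1 h]; simp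
    rw [norm_mul, norm_neg, hnf] at this; linarith
  have hcos : (Real.cos θ : ℂ) = (e + f) / 2 := by
    rw [he, hf, Complex.ofReal_cos, Complex.cos]
  have hs1 : (Real.sin θ : ℂ) = -Complex.I / 2 * (e - f) := by simpa using hsin 0
  have hprod : 1 + 2 * w * Real.cos θ + w ^ 2 = (1 - -w * e) * (1 - -w * f) := by
    rw [hcos]
    have : w ^ 2 = w ^ 2 * (e * f) := by rw [hef, mul_one]
    rw [this]; ring
  convert! h3 using 1
  · funext n
    rw [hsin]; ring
  · rw [hprod, hs1]
    have hAB : e - f = e * (1 - -w * f) - f * (1 - -w * e) := by ring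
    rw [hAB]
    generalize 1 - -w * e = A at hd1
    generalize 1 - -w * f = B at hd2
    field_simp

lemma integral_sin_mul_sin (n : ℕ) :
    ∫ θ in (0:ℝ)..Real.pi, Real.sin θ * Real.sin ((n + 1) * θ) = if n = 0 then Real.pi / 2 else 0 := by
  split_ifs with h
  · subst h
    have : ∀ θ : ℝ, Real.sin θ * Real.sin (((0:ℕ) + 1) * θ) = Real.sin θ ^ 2 := fun θ => by
      rw [sq]; simp
    simp_rw [this]
    rw [integral_sin_sq]; simp
  · have h0 : (n : ℝ) ≠ 0 := by exact_mod_cast h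
    have h2 : (n : ℝ) + 2 ≠ 0 := by positivity
    have e1 : ∀ θ : ℝ, Real.sin θ * Real.sin ((n + 1) * θ)
        = (1 / 2) * Real.cos (n * θ) - (1 / 2) * Real.cos ((n + 2) * θ) := fun θ => by
      have ea : (n : ℝ) * θ = (n + 1) * θ - θ := by ring
      have eb : ((n : ℝ) + 2) * θ = (n + 1) * θ + θ := by ring
      rw [ea, eb, Real.cos_sub, Real.cos_add]; ring
    simp_rw [e1]
    rw [intervalIntegral.integral_sub (by apply Continuous.intervalIntegrable; fun_prop)
      (by apply Continuous.intervalIntegrable; fun_prop),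
      intervalIntegral.integral_const_mul, intervalIntegral.integral_const_mul,
      intervalIntegral.integral_comp_mul_left _ h0, intervalIntegral.integral_comp_mul_left _ h2,
      integral_cos, integral_cos]
    have e2 : Real.sin (((n : ℝ) + 2) * Real.pi) = 0 := by
      have := Real.sin_nat_mul_pi (n + 2); push_cast at this; exact this
    simp [e2]

/-- Expand the quotient in the functions `sin ((n + 1) θ)` and integrate termwise: by orthogonality
to `sin θ` only `n = 0` survives, so the value does not depend on `w`. -/
lemma integral_sin_sq_div {w : ℂ} (hw : ‖w‖ < 1) :
    ∫ θ in (0:ℝ)..Real.pi, (Real.sin θ : ℂ) * (Real.sin θ / (1 + 2 * w * Real.cos θ + w ^ 2))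
      = (Real.pi / 2 : ℂ) := by
  have hs := intervalIntegral.hasSum_integral_of_dominated_convergence (μ := volume) (a := 0) (b := Real.pi)
    (F := fun (n : ℕ) θ => (Real.sin θ : ℂ) * ((-w) ^ n * (Real.sin ((n + 1) * θ) : ℂ)))
    (f := fun θ => (Real.sin θ : ℂ) * (Real.sin θ / (1 + 2 * w * Real.cos θ + w ^ 2)))
    (fun n _ => ‖w‖ ^ n) (fun n => by apply Continuous.aestronglyMeasurable; fun_prop)
    (fun n => Eventually.of_forall fun θ _ => by
      rw [norm_mul, norm_mul, norm_pow, norm_neg, Complex.norm_real, Complex.norm_real]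
      have h1 : ‖Real.sin θ‖ ≤ 1 := Real.abs_sin_le_one _
      have h2 : ‖Real.sin ((n + 1) * θ)‖ ≤ 1 := Real.abs_sin_le_one _
      calc _ ≤ 1 * (‖w‖ ^ n * 1) := by gcongr
        _ = _ := by ring)
    (Eventually.of_forall fun θ _ => summable_geometric_of_lt_one (norm_nonneg _) hw)
    intervalIntegrable_const
    (Eventually.of_forall fun θ _ => (hasSum_sin_mul_pow hw θ).mul_left _)
  refine hs.unique ?_
  have e1 : ∀ n : ℕ, ∫ θ in (0:ℝ)..Real.pi, (Real.sin θ : ℂ) * ((-w) ^ n * (Real.sin ((n + 1) * θ) : ℂ))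
      = if n = 0 then (Real.pi / 2 : ℂ) else 0 := fun n => by
    have : ∀ θ : ℝ, (Real.sin θ : ℂ) * ((-w) ^ n * (Real.sin ((n + 1) * θ) : ℂ))
        = (-w) ^ n * ((Real.sin θ * Real.sin ((n + 1) * θ) : ℝ) : ℂ) := fun θ => by push_cast; ring
    simp_rw [this]
    rw [intervalIntegral.integral_const_mul, intervalIntegral.integral_ofReal, integral_sin_mul_sin]
    split_ifs with h
    · simp [h]
    · simp
  simp_rw [e1]
  exact hasSum_ite_eq 0 _

/-- The substitution `x = 2 √v cos θ`, under which the square root in the density becomes `2 √v sin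
θ`. -/
lemma integral_semicircle_eq {v : ℝ≥0} (hv : v ≠ 0) {g : ℝ → ℂ} (hg : Continuous g) :
    ∫ x, g x ∂(semicircle 0 v : Measure ℝ)
      = (2 / Real.pi : ℝ) * ∫ θ in (0:ℝ)..Real.pi,
          (Real.sin θ : ℂ) * (Real.sin θ * g (2 * √v * Real.cos θ)) := by
  have hv' : (0 : ℝ) < v := by exact_mod_cast pos_iff_ne_zero.mpr hv
  set s : ℝ := √(v : ℝ) with hs
  have hs0 : 0 < s := Real.sqrt_pos.mpr hv'
  have hsq : s ^ 2 = v := Real.sq_sqrt hv'.le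
  have hm : Measurable (semicirclePDF 0 v) := by
    unfold semicirclePDF
    exact Measurable.indicator (by fun_prop) measurableSet_Icc
  have hn : ∀ x, 0 ≤ semicirclePDF 0 v x := fun x =>
    Set.indicator_nonneg (fun y _ => by positivity) x
  have h1 : (semicircle 0 v : Measure ℝ)
      = volume.withDensity fun x => ENNReal.ofReal (semicirclePDF 0 v x) := if_neg hv
  rw [h1, integral_withDensity_eq_integral_toReal_smul (by fun_prop)
    (Eventually.of_forall fun x => ENNReal.ofReal_lt_top)]
  have h2 : ∀ x, (ENNReal.ofReal (semicirclePDF 0 v x)).toReal • g x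
      = (Set.Icc (-(2 * s)) (2 * s)).indicator
        (fun x => ((1 / (2 * Real.pi * v) * √(4 * v - x ^ 2) : ℝ) : ℂ) * g x) x := fun x => by
    rw [ENNReal.toReal_ofReal (hn x)]
    unfold semicirclePDF
    by_cases hx : x ∈ Set.Icc (-(2 * s)) (2 * s)
    · rw [Set.indicator_of_mem hx, Set.indicator_of_mem (by simpa using hx)]
      simp
    · rw [Set.indicator_of_notMem hx, Set.indicator_of_notMem (by simpa using hx)]
      simp
  simp_rw [h2]
  rw [integral_indicator measurableSet_Icc, integral_Icc_eq_integral_Ioc,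
    ← intervalIntegral.integral_of_le (by linarith)]
  have h3 := intervalIntegral.integral_deriv_smul_comp (a := Real.pi) (b := 0)
    (f := fun θ => 2 * s * Real.cos θ) (f' := fun θ => -(2 * s * Real.sin θ))
    (g := fun x => ((1 / (2 * Real.pi * v) * √(4 * v - x ^ 2) : ℝ) : ℂ) * g x)
    (fun θ _ => by
      have := (Real.hasDerivAt_cos θ).const_mul (2 * s)
      convert! this using 1; ring) (by fun_prop) (by fun_prop)
  simp only [Real.cos_pi, Real.cos_zero, mul_neg, mul_one] at h3
  rw [← h3, intervalIntegral.integral_symm, ← intervalIntegral.integral_neg,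
    ← intervalIntegral.integral_const_mul]
  refine intervalIntegral.integral_congr fun θ hθ => ?_
  rw [Set.uIcc_of_le Real.pi_pos.le] at hθ
  have hsin := Real.sin_nonneg_of_nonneg_of_le_pi hθ.1 hθ.2
  have hroot : √(4 * v - (2 * s * Real.cos θ) ^ 2) = 2 * s * Real.sin θ := by
    rw [← hsq, ← Real.sqrt_sq (by positivity : 0 ≤ 2 * s * Real.sin θ)]
    congr 1
    have := Real.sin_sq_add_cos_sq θ
    linear_combination (-4 * s ^ 2) * this
  simp only [Function.comp, hroot, neg_smul, neg_neg]
  rw [Complex.real_smul, ← hsq]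
  have hpi := Real.pi_pos
  push_cast
  have : (s : ℂ) ≠ 0 := by exact_mod_cast hs0.ne'
  have : (Real.pi : ℂ) ≠ 0 := by exact_mod_cast hpi.ne'
  field_simp

/-- The quadratic equation for the Stieltjes transform of a centered semicircle law. -/
theorem stieltjes_semicircle (v : ℝ≥0) {z : ℂ} (hz : z.im ≠ 0) :
    (v : ℂ) * stieltjes (semicircle 0 v) z ^ 2 + z * stieltjes (semicircle 0 v) z + 1 = 0 := by
  have hz0 : z ≠ 0 := fun h => hz (by simp [h])
  by_cases hv : v = 0
  · subst hv
    have : (semicircle 0 0 : Measure ℝ) = Measure.dirac 0 := if_pos rfl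
    unfold stieltjes
    rw [this, integral_dirac]
    simp [hz0]
  have hv' : (0 : ℝ) < v := by exact_mod_cast pos_iff_ne_zero.mpr hv
  set s : ℝ := √(v : ℝ) with hs
  have hs0 : 0 < s := Real.sqrt_pos.mpr hv'
  have hsc : (s : ℂ) ≠ 0 := by exact_mod_cast hs0.ne'
  have hsq : (s : ℂ) ^ 2 = ((v : ℝ) : ℂ) := by rw [← Real.sq_sqrt hv'.le]; push_cast; rfl
  -- After rescaling to variance one, `z = -√v (w + w⁻¹)` with `w` in the unit disc makes the
  -- denominator factor as required by `integral_sin_sq_div`; the transform is then `w / √v`.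
  obtain ⟨w, hw, hw0, hwz⟩ := exists_joukowski (z := z / s) (by
    rw [Complex.div_ofReal_im]; exact div_ne_zero hz hs0.ne')
  have hzw : z = -(s * (w + w⁻¹)) := by
    field_simp at hwz ⊢
    linear_combination hwz
  have hm : stieltjes (semicircle 0 v) z = w / s := by
    unfold stieltjes
    rw [integral_semicircle_eq hv (continuous_inv_sub hz)]
    have : ∀ θ : ℝ, (Real.sin θ : ℂ) * (Real.sin θ * (((2 * √(v:ℝ) * Real.cos θ : ℝ) : ℂ) - z)⁻¹)
        = w / s * ((Real.sin θ : ℂ) * (Real.sin θ / (1 + 2 * w * Real.cos θ + w ^ 2))) := fun θ => by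
      have e : (((2 * √(v:ℝ) * Real.cos θ : ℝ) : ℂ) - z)
          = s / w * (1 + 2 * w * Real.cos θ + w ^ 2) := by
        rw [hzw, ← hs]; push_cast; field_simp; ring
      rw [e, mul_inv, inv_div, div_eq_mul_inv _ (1 + 2 * w * _ + _)]
      ring
    simp_rw [this]
    rw [intervalIntegral.integral_const_mul, integral_sin_sq_div hw]
    have : (Real.pi : ℂ) ≠ 0 := by exact_mod_cast Real.pi_pos.ne'
    push_cast
    field_simp
  rw [hm, hzw]
  have : ((v : ℝ≥0) : ℂ) = (s:ℂ) ^ 2 := by rw [hsq]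
  rw [this]
  field_simp
  ring

end SemicircleStieltjes

end CirculantBlocks
end

noncomputable section

namespace CirculantBlocks

/-! ### From Stieltjes transforms to weak convergence -/

section StieltjesContinuity

/-- The `ε/3` argument, with approximation uniform in `n`. It is applied once to points `z` in a
dense set and once to test functions in a dense span. -/
lemma tendsto_of_approx {A : Type*} {F : ℕ → A → ℂ} {F₀ : A → ℂ} {x : A}
    (h : ∀ ε > 0, ∃ y, Tendsto (F · y) atTop (𝓝 (F₀ y)) ∧ (∀ n, dist (F n x) (F n y) ≤ ε) ∧
      dist (F₀ x) (F₀ y) ≤ ε) : Tendsto (F · x) atTop (𝓝 (F₀ x)) := by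
  rw [Metric.tendsto_atTop]
  intro ε hε
  obtain ⟨y, h1, h2, h3⟩ := h (ε / 4) (by positivity)
  obtain ⟨N, hN⟩ := Metric.tendsto_atTop.1 h1 (ε / 4) (by positivity)
  refine ⟨N, fun n hn => ?_⟩
  have h4 := dist_triangle4 (F n x) (F n y) (F₀ y) (F₀ x)
  rw [dist_comm (F₀ y)] at h4
  linarith [hN n hn, h2 n]

lemma norm_inv_sub_sub_inv_sub_le {z w : ℂ} (hz : z.im ≠ 0) (hw : w.im ≠ 0) (x : ℝ) :
    ‖((x : ℂ) - z)⁻¹ - ((x : ℂ) - w)⁻¹‖ ≤ ‖z - w‖ * (|z.im|⁻¹ * |w.im|⁻¹) := by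
  have e : ((x : ℂ) - z)⁻¹ - ((x : ℂ) - w)⁻¹ = (z - w) * (((x : ℂ) - z)⁻¹ * ((x : ℂ) - w)⁻¹) := by
    have h1 := sub_ne_zero_of_im hz x
    have h2 := sub_ne_zero_of_im hw x
    field_simp
    ring
  rw [e, norm_mul, norm_mul]
  gcongr
  · exact norm_inv_sub_le hz x
  · exact norm_inv_sub_le hw x

lemma norm_stieltjes_sub_le (μ : Measure ℝ) [IsProbabilityMeasure μ] {z w : ℂ} (hz : z.im ≠ 0)
    (hw : w.im ≠ 0) :
    ‖stieltjes μ z - stieltjes μ w‖ ≤ ‖z - w‖ * (|z.im|⁻¹ * |w.im|⁻¹) := by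
  unfold stieltjes
  rw [← integral_sub (integrable_inv_sub μ hz) (integrable_inv_sub μ hw)]
  simpa using norm_integral_le_of_norm_le_const (μ := μ)
    (Eventually.of_forall (norm_inv_sub_sub_inv_sub_le hz hw))

lemma stieltjes_conj (μ : Measure ℝ) (z : ℂ) :
    stieltjes μ (starRingEnd ℂ z) = starRingEnd ℂ (stieltjes μ z) := by
  unfold stieltjes
  rw [← integral_conj]
  simp

/-- Transforms of probability measures are Lipschitz away from the real axis, with a constant
independent of the measure. This reduces an almost sure statement to countably many `z`. -/
lemma tendsto_stieltjes_of_dense {μs : ℕ → ProbabilityMeasure ℝ} {μ : ProbabilityMeasure ℝ}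
    {D : Set ℂ} (hD : Dense D)
    (h : ∀ z ∈ D, 0 < z.im → Tendsto (fun n => stieltjes (μs n) z) atTop (𝓝 (stieltjes μ z)))
    {z : ℂ} (hz : 0 < z.im) : Tendsto (fun n => stieltjes (μs n) z) atTop (𝓝 (stieltjes μ z)) := by
  refine tendsto_of_approx (F := fun n z => stieltjes (μs n) z) (F₀ := fun z => stieltjes μ z)
    fun ε hε => ?_
  set η := z.im with hη
  obtain ⟨w, hwD, hw⟩ := Metric.dense_iff.1 hD z (min (η / 2) (ε * (η * (η / 2)))) (by positivity)
  rw [Metric.mem_ball, lt_min_iff, dist_comm, dist_eq_norm] at hwD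
  have hwim : η / 2 < w.im := by
    have := (Complex.abs_im_le_norm (z - w)).trans_lt hwD.1
    rw [Complex.sub_im, abs_lt] at this
    linarith [this.2]
  have hw0 : 0 < w.im := by linarith [half_pos hz]
  have key : ‖z - w‖ * (|z.im|⁻¹ * |w.im|⁻¹) ≤ ε := by
    rw [abs_of_pos hz, abs_of_pos hw0, ← mul_inv, ← div_eq_mul_inv, div_le_iff₀ (by positivity)]
    refine hwD.2.le.trans ?_
    gcongr
  refine ⟨w, h w hw hw0, fun n => ?_, ?_⟩
  · rw [dist_eq_norm]; exact (norm_stieltjes_sub_le _ hz.ne' hw0.ne').trans key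
  · rw [dist_eq_norm]; exact (norm_stieltjes_sub_le _ hz.ne' hw0.ne').trans key

/-- The function `x ↦ (x - z)⁻¹` on the one-point compactification of the line. -/
def cauchyKernel (z : ℂ) (hz : z.im ≠ 0) : C(OnePoint ℝ, ℂ) :=
  OnePoint.continuousMapMk ⟨fun x : ℝ => ((x : ℂ) - z)⁻¹, continuous_inv_sub hz⟩ 0 (by
    rw [coclosedCompact_eq_cocompact]
    refine tendsto_inv₀_cobounded.comp ?_
    have h1 : Tendsto (fun x : ℝ => ‖(x : ℂ) - z‖) (cocompact ℝ) atTop := by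
      refine tendsto_atTop_mono (fun x => norm_sub_norm_le (x : ℂ) z) ?_
      simp only [Complex.norm_real]
      exact tendsto_atTop_add_const_right _ _ (tendsto_norm_cocompact_atTop (E := ℝ))
    exact tendsto_norm_atTop_iff_cobounded.1 h1)

lemma cauchyKernel_coe (z : ℂ) (hz : z.im ≠ 0) (x : ℝ) :
    cauchyKernel z hz (x : OnePoint ℝ) = ((x : ℂ) - z)⁻¹ := rfl

lemma cauchyKernel_infty (z : ℂ) (hz : z.im ≠ 0) : cauchyKernel z hz OnePoint.infty = 0 := rfl

/-- The set of all Cauchy kernels. -/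
def cauchyKernels : Set C(OnePoint ℝ, ℂ) := {f | ∃ z, ∃ hz : z.im ≠ 0, f = cauchyKernel z hz}

lemma norm_cauchyKernel_sub_le {z w : ℂ} (hz : z.im ≠ 0) (hw : w.im ≠ 0) :
    ‖cauchyKernel z hz - cauchyKernel w hw‖ ≤ ‖z - w‖ * (|z.im|⁻¹ * |w.im|⁻¹) := by
  rw [ContinuousMap.norm_le _ (by positivity)]
  intro x
  induction x using OnePoint.rec with
  | infty => rw [ContinuousMap.sub_apply, cauchyKernel_infty, cauchyKernel_infty]; simp; positivity
  | coe x => exact norm_inv_sub_sub_inv_sub_le hz hw x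

/-- The partial fraction identity keeps products of kernels in their linear span, so that
convergence on single kernels controls the whole algebra they generate. -/
lemma cauchyKernel_mul {z w : ℂ} (hz : z.im ≠ 0) (hw : w.im ≠ 0) (hzw : z ≠ w) :
    cauchyKernel z hz * cauchyKernel w hw
      = (z - w)⁻¹ • (cauchyKernel z hz - cauchyKernel w hw) := by
  ext x
  induction x using OnePoint.rec with
  | infty =>
    rw [ContinuousMap.mul_apply, ContinuousMap.smul_apply, ContinuousMap.sub_apply]
    simp [cauchyKernel_infty]
  | coe x =>
    rw [ContinuousMap.mul_apply, ContinuousMap.smul_apply, ContinuousMap.sub_apply,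
      cauchyKernel_coe, cauchyKernel_coe, smul_eq_mul]
    have h1 := sub_ne_zero_of_im hz x
    have h2 := sub_ne_zero_of_im hw x
    have h3 := sub_ne_zero.2 hzw
    field_simp
    ring

/-- The closed span of the constants and the Cauchy kernels. -/
def cauchySpan : Submodule ℂ C(OnePoint ℝ, ℂ) :=
  (Submodule.span ℂ (insert 1 cauchyKernels)).topologicalClosure

lemma mem_cauchySpan_of_mem {f : C(OnePoint ℝ, ℂ)} (hf : f ∈ insert 1 cauchyKernels) :
    f ∈ cauchySpan := Submodule.le_topologicalClosure _ (Submodule.subset_span hf)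

lemma cauchyKernel_mem (z : ℂ) (hz : z.im ≠ 0) : cauchyKernel z hz ∈ cauchySpan :=
  mem_cauchySpan_of_mem (Or.inr ⟨z, hz, rfl⟩)

lemma cauchyKernel_mul_mem (z : ℂ) (hz : z.im ≠ 0) (w : ℂ) (hw : w.im ≠ 0) :
    cauchyKernel z hz * cauchyKernel w hw ∈ cauchySpan := by
  have hne : ∀ (w : ℂ) (hw : w.im ≠ 0), z ≠ w →
      cauchyKernel z hz * cauchyKernel w hw ∈ cauchySpan := fun w hw h => by
    rw [cauchyKernel_mul hz hw h]
    exact cauchySpan.smul_mem _ (cauchySpan.sub_mem (cauchyKernel_mem _ _) (cauchyKernel_mem _ _))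
  by_cases h : z = w
  swap
  · exact hne w hw h
  subst h
  -- On the diagonal partial fractions fail. The second point is moved to `z + i Im z / (n + 1)`,
  -- which stays off the real axis, and the closedness of the span gives the limit.
  have him : ∀ n : ℕ, (z + ((z.im / ((n : ℝ) + 1) : ℝ) : ℂ) * Complex.I).im ≠ 0 := fun n => by
    have : (z + ((z.im / ((n : ℝ) + 1) : ℝ) : ℂ) * Complex.I).im = z.im * (1 + 1 / ((n : ℝ) + 1)) := by
      rw [Complex.add_im, Complex.im_ofReal_mul, Complex.I_im]
      ring
    rw [this]
    exact mul_ne_zero hz (by positivity)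
  have hlim : Tendsto (fun n : ℕ => cauchyKernel _ (him n)) atTop (𝓝 (cauchyKernel z hz)) := by
    rw [tendsto_iff_norm_sub_tendsto_zero]
    have hb : ∀ n : ℕ, ‖cauchyKernel _ (him n) - cauchyKernel z hz‖
        ≤ 1 / ((n : ℝ) + 1) * |z.im|⁻¹ := fun n => by
      refine (norm_cauchyKernel_sub_le (him n) hz).trans ?_
      have h1 : (z + ((z.im / ((n : ℝ) + 1) : ℝ) : ℂ) * Complex.I).im
          = z.im * (1 + 1 / ((n : ℝ) + 1)) := by
        rw [Complex.add_im, Complex.im_ofReal_mul, Complex.I_im]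
        ring
      have h0 : 0 < |z.im| := abs_pos.2 hz
      have hp : (0:ℝ) < 1 + 1 / ((n : ℝ) + 1) := by positivity
      rw [h1, add_sub_cancel_left, norm_mul, Complex.norm_I, mul_one, Complex.norm_real,
        Real.norm_eq_abs, abs_div, abs_mul, abs_of_pos hp,
        abs_of_pos (by positivity : (0:ℝ) < (n:ℝ) + 1)]
      have h2 : (|z.im| * (1 + 1 / ((n : ℝ) + 1)))⁻¹ ≤ |z.im|⁻¹ := by
        refine inv_anti₀ h0 ?_
        have : 0 < |z.im| * (1 / ((n : ℝ) + 1)) := by positivity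
        linarith
      calc _ ≤ |z.im| / ((n:ℝ) + 1) * (|z.im|⁻¹ * |z.im|⁻¹) := by gcongr
        _ = _ := by field_simp
    refine squeeze_zero (fun n => norm_nonneg _) hb ?_
    simpa using tendsto_one_div_add_atTop_nhds_zero_nat.mul_const (|z.im|⁻¹)
  have hcl : IsClosed (cauchySpan : Set C(OnePoint ℝ, ℂ)) :=
    Submodule.isClosed_topologicalClosure _
  refine hcl.mem_of_tendsto (hlim.const_mul (cauchyKernel z hz)) (Eventually.of_forall fun n => ?_)
  refine hne _ (him n) fun heq => ?_
  have := congrArg Complex.im heq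
  rw [Complex.add_im, Complex.im_ofReal_mul, Complex.I_im, mul_one, left_eq_add] at this
  exact (div_ne_zero hz (by positivity)) this

lemma cauchyKernel_mul_mem_of_mem (z : ℂ) (hz : z.im ≠ 0) {f : C(OnePoint ℝ, ℂ)}
    (hf : f ∈ cauchySpan) : cauchyKernel z hz * f ∈ cauchySpan := by
  have hcont : Continuous (LinearMap.mulLeft ℂ (cauchyKernel z hz)) := by
    change Continuous fun f => cauchyKernel z hz * f
    fun_prop
  have hle : cauchySpan ≤ cauchySpan.comap (LinearMap.mulLeft ℂ (cauchyKernel z hz)) := by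
    refine Submodule.topologicalClosure_minimal _ (Submodule.span_le.2 ?_) ?_
    · rintro g (rfl | ⟨w, hw, rfl⟩)
      · simpa using cauchyKernel_mem z hz
      · exact cauchyKernel_mul_mem z hz w hw
    · exact (Submodule.isClosed_topologicalClosure _).preimage hcont
  exact hle hf

/-- Stone–Weierstrass on the one-point compactification: the kernels are closed under conjugation,
the kernel at `i` alone separates all points including infinity (where it vanishes), and the algebra
generated stays in the closed span. -/
lemma cauchySpan_eq_top : cauchySpan = ⊤ := by
  set A := StarAlgebra.adjoin ℂ cauchyKernels with hA
  have hstar : star cauchyKernels = cauchyKernels := by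
    ext f
    rw [Set.mem_star]
    have hst : ∀ (z : ℂ) (hz : z.im ≠ 0), ∃ hz' : (star z).im ≠ 0,
        star (cauchyKernel z hz) = cauchyKernel (star z) hz' := fun z hz => by
      refine ⟨by simpa using hz, ?_⟩
      ext x
      induction x using OnePoint.rec with
      | infty => rw [ContinuousMap.star_apply]; simp [cauchyKernel_infty]
      | coe x =>
        rw [ContinuousMap.star_apply]; simp [cauchyKernel_coe]
    constructor
    · rintro ⟨z, hz, h⟩
      obtain ⟨hz', h'⟩ := hst z hz
      exact ⟨_, hz', by rw [← h', ← h, star_star]⟩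
    · rintro ⟨z, hz, rfl⟩
      obtain ⟨hz', h'⟩ := hst z hz
      exact ⟨_, hz', h'⟩
  have hAle : ∀ f ∈ A, f ∈ cauchySpan := by
    intro f hf
    have hf' : f ∈ A.toSubalgebra := hf
    rw [hA, StarAlgebra.adjoin_toSubalgebra, hstar, Set.union_self,
      ← Subalgebra.mem_toSubmodule, Algebra.adjoin_eq_span] at hf'
    refine (Submodule.span_le.2 ?_) hf'
    intro g hg
    induction hg using Submonoid.closure_induction_left with
    | one => exact mem_cauchySpan_of_mem (Or.inl rfl)
    | mul_left x hx y _ ih =>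
      obtain ⟨z, hz, rfl⟩ := hx
      exact cauchyKernel_mul_mem_of_mem z hz ih
  have hsep : A.SeparatesPoints := by
    intro x y hxy
    have hI : Complex.I.im ≠ 0 := by simp
    refine ⟨_, ⟨cauchyKernel Complex.I hI, StarAlgebra.subset_adjoin ℂ _ ⟨_, hI, rfl⟩, rfl⟩, ?_⟩
    change cauchyKernel Complex.I hI x ≠ cauchyKernel Complex.I hI y
    induction x using OnePoint.rec with
    | infty =>
      induction y using OnePoint.rec with
      | infty => exact absurd rfl hxy
      | coe y =>
        rw [cauchyKernel_infty, cauchyKernel_coe]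
        exact (inv_ne_zero (sub_ne_zero_of_im hI y)).symm
    | coe x =>
      induction y using OnePoint.rec with
      | infty =>
        rw [cauchyKernel_infty, cauchyKernel_coe]
        exact (inv_ne_zero (sub_ne_zero_of_im hI x))
      | coe y =>
        rw [cauchyKernel_coe, cauchyKernel_coe]
        intro h
        apply hxy
        have := inv_injective h
        simpa using this
  have htop := ContinuousMap.starSubalgebra_topologicalClosure_eq_top_of_separatesPoints A hsep
  rw [eq_top_iff]
  intro f _
  have hf : f ∈ A.topologicalClosure := by rw [htop]; trivial
  have hf2 : f ∈ closure (A : Set C(OnePoint ℝ, ℂ)) := hf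
  exact closure_minimal hAle (Submodule.isClosed_topologicalClosure _) hf2

variable {μs : ℕ → ProbabilityMeasure ℝ} {μ : ProbabilityMeasure ℝ}

lemma integrable_onePoint (μ : Measure ℝ) [IsFiniteMeasure μ] (f : C(OnePoint ℝ, ℂ)) :
    Integrable (fun x : ℝ => f x) μ :=
  Integrable.of_bound (f.continuous.comp OnePoint.continuous_coe).aestronglyMeasurable ‖f‖
    (Eventually.of_forall fun _ => f.norm_coe_le_norm _)

lemma tendsto_integral_onePoint
    (h : ∀ z : ℂ, 0 < z.im → Tendsto (fun n => stieltjes (μs n) z) atTop (𝓝 (stieltjes μ z)))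
    (f : C(OnePoint ℝ, ℂ)) :
    Tendsto (fun n => ∫ x : ℝ, f x ∂(μs n)) atTop (𝓝 (∫ x : ℝ, f x ∂μ)) := by
  have hspan : ∀ g ∈ Submodule.span ℂ (insert 1 cauchyKernels),
      Tendsto (fun n => ∫ x : ℝ, g x ∂(μs n)) atTop (𝓝 (∫ x : ℝ, g x ∂μ)) := by
    intro g hg
    induction hg using Submodule.span_induction with
    | mem g hg =>
      rcases hg with rfl | ⟨z, hz, rfl⟩
      · simp
      -- Kernels with pole in the lower half-plane are conjugates of kernels with pole in the upper
      -- one.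
      · rcases lt_or_gt_of_ne hz with hneg | hpos
        · have := h (starRingEnd ℂ z) (by simpa using hneg)
          simp only [stieltjes_conj] at this
          have h2 := (Complex.continuous_conj.tendsto _).comp this
          have h3 : Tendsto (fun n => stieltjes (μs n) z) atTop (𝓝 (stieltjes μ z)) := by
            simpa [Function.comp_def] using h2
          exact h3
        · exact h z hpos
    | zero => simp
    | add f g _ _ hf hg =>
      simp only [ContinuousMap.add_apply]
      simp_rw [integral_add (integrable_onePoint _ f) (integrable_onePoint _ g)]
      exact hf.add hg
    | smul a f _ hf =>
      simp only [ContinuousMap.smul_apply]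
      simp_rw [integral_smul]
      exact hf.const_smul a
  refine tendsto_of_approx (F := fun n f => ∫ x : ℝ, f x ∂(μs n))
    (F₀ := fun f : C(OnePoint ℝ, ℂ) => ∫ x : ℝ, f x ∂μ) fun ε hε => ?_
  have hf : f ∈ closure (Submodule.span ℂ (insert 1 cauchyKernels) : Set C(OnePoint ℝ, ℂ)) := by
    have : f ∈ cauchySpan := by rw [cauchySpan_eq_top]; trivial
    exact this
  obtain ⟨g, hg, hfg⟩ := Metric.mem_closure_iff.1 hf ε hε
  have hb : ∀ ν : ProbabilityMeasure ℝ, dist (∫ x : ℝ, f x ∂ν) (∫ x : ℝ, g x ∂ν) ≤ ε := fun ν => by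
    rw [dist_eq_norm, ← integral_sub (integrable_onePoint _ f) (integrable_onePoint _ g)]
    have := norm_integral_le_of_norm_le_const (μ := (ν : Measure ℝ)) (C := ε)
      (f := fun x : ℝ => f x - g x) (Eventually.of_forall fun x => by
        rw [← dist_eq_norm]
        exact (ContinuousMap.dist_apply_le_dist _).trans hfg.le)
    simpa using this
  exact ⟨g, hspan g hg, fun n => hb _, hb _⟩

/-- Convergence of Stieltjes transforms on the upper half-plane implies weak convergence. -/
theorem tendsto_of_tendsto_stieltjes
    (h : ∀ z : ℂ, 0 < z.im → Tendsto (fun n => stieltjes (μs n) z) atTop (𝓝 (stieltjes μ z))) :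
    Tendsto μs atTop (𝓝 μ) := by
  -- Portmanteau: a lower bound on open sets suffices. Inner regularity replaces `G` by a compact
  -- `K`, and a compactly supported Urysohn function between them extends by zero to infinity. No
  -- tightness argument is needed because the limit is assumed to be a probability measure.
  refine tendsto_of_forall_isOpen_le_liminf' fun G hG => ?_
  rw [hG.measure_eq_iSup_isCompact]
  refine iSup₂_le fun K hKG => iSup_le fun hK => ?_
  obtain ⟨f, hf1, hf0, hfc, hf01⟩ := exists_continuous_one_zero_of_isCompact hK hG.isClosed_compl
    (by rwa [Set.disjoint_compl_right_iff_subset])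
  have hzero : Tendsto (fun x => (f x : ℂ)) (coclosedCompact ℝ) (𝓝 0) := by
    rw [coclosedCompact_eq_cocompact]
    have := (Complex.continuous_ofReal.tendsto 0).comp hfc.is_zero_at_infty
    simpa [Function.comp_def] using this
  have hlim := tendsto_integral_onePoint h
    (OnePoint.continuousMapMk ⟨fun x => (f x : ℂ), by fun_prop⟩ 0 hzero)
  have hcoe : ∀ ν : ProbabilityMeasure ℝ, ∫ x : ℝ, (OnePoint.continuousMapMk
      ⟨fun x => (f x : ℂ), by fun_prop⟩ 0 hzero) (x : OnePoint ℝ) ∂ν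
        = ((∫ x, f x ∂ν : ℝ) : ℂ) := fun ν => integral_ofReal
  simp_rw [hcoe] at hlim
  have hlim' : Tendsto (fun n => ∫ x, f x ∂(μs n)) atTop (𝓝 (∫ x, f x ∂μ)) := by
    simpa [Function.comp_def] using (Complex.continuous_re.tendsto _).comp hlim
  have hnn : ∀ x, 0 ≤ f x := fun x => (hf01 x).1
  have hint : ∀ ν : ProbabilityMeasure ℝ, Integrable f ν := fun ν =>
    Integrable.of_bound f.continuous.aestronglyMeasurable 1 (Eventually.of_forall fun x => by
      rw [Real.norm_of_nonneg (hnn x)]; exact (hf01 x).2)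
  have hl := (ENNReal.continuous_ofReal.tendsto _).comp hlim'
  have hK' : (μ : Measure ℝ) K ≤ ENNReal.ofReal (∫ x, f x ∂μ) := by
    rw [ofReal_integral_eq_lintegral_ofReal (hint μ) (Eventually.of_forall hnn),
      ← lintegral_indicator_one hK.measurableSet]
    refine lintegral_mono fun x => ?_
    by_cases hx : x ∈ K
    · simp [hx, hf1 hx]
    · simp [hx]
  have hG' : ∀ n, ENNReal.ofReal (∫ x, f x ∂(μs n)) ≤ (μs n : Measure ℝ) G := fun n => by
    rw [ofReal_integral_eq_lintegral_ofReal (hint _) (Eventually.of_forall hnn),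
      ← lintegral_indicator_one hG.measurableSet]
    refine lintegral_mono fun x => ?_
    by_cases hx : x ∈ G
    · simp only [hx, Set.indicator_of_mem, Pi.one_apply]
      exact ENNReal.ofReal_le_one.2 (hf01 x).2
    · have : f x = 0 := hf0 hx
      simp [this]
  calc _ ≤ _ := hK'
    _ = _ := hl.liminf_eq.symm
    _ ≤ _ := liminf_le_liminf (Eventually.of_forall hG')

end StieltjesContinuity

end CirculantBlocks
end

noncomputable section

namespace CirculantBlocks

open scoped Matrix.Norms.L2Operator Matrix

/-! ### Deterministic estimates for symmetric matrices -/

section WignerMatrix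

/-- The normalized real symmetric `n × n` matrix with entries `y s(i, j) / √n`. -/
def wig (n : ℕ) (y : Sym2 ℕ → ℝ) : Matrix (Fin n) (Fin n) ℂ :=
  Matrix.of fun i j => (((√(n : ℝ))⁻¹ * y s((i : ℕ), (j : ℕ)) : ℝ) : ℂ)

lemma wig_apply (n : ℕ) (y : Sym2 ℕ → ℝ) (i j : Fin n) :
    wig n y i j = (((√(n : ℝ))⁻¹ * y s((i : ℕ), (j : ℕ)) : ℝ) : ℂ) := rfl

lemma wig_isHermitian (n : ℕ) (y : Sym2 ℕ → ℝ) : (wig n y).IsHermitian := by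
  ext i j
  rw [Matrix.conjTranspose_apply, wig_apply, wig_apply, Sym2.eq_swap]
  exact Complex.conj_ofReal _

/-- The normalized trace of the resolvent. -/
def trRes (n : ℕ) (y : Sym2 ℕ → ℝ) (z : ℂ) : ℂ := (n : ℂ)⁻¹ * (res (wig n y) z).trace

variable {n : ℕ} {z : ℂ}

lemma continuous_wig : Continuous (wig n) :=
  continuous_matrix fun i j => by simp only [wig_apply]; fun_prop

/-- Cramer's rule, with a determinant that does not vanish off the real axis. It supplies all
measurability in the entries. -/
lemma continuous_res_wig (hz : z.im ≠ 0) : Continuous fun y => res (wig n y) z := by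
  unfold res
  simp_rw [Matrix.inv_def, Ring.inverse_eq_inv]
  have hc : Continuous fun y => wig n y - z • (1 : Matrix (Fin n) (Fin n) ℂ) :=
    continuous_wig.sub continuous_const
  refine Continuous.smul (hc.matrix_det.inv₀ fun y => ?_) hc.matrix_adjugate
  exact ((Matrix.isUnit_iff_isUnit_det _).1 (isUnit_sub_smul_one (wig_isHermitian n y) hz)).ne_zero

lemma continuous_res_wig_apply (hz : z.im ≠ 0) (i j : Fin n) :
    Continuous fun y => res (wig n y) z i j := (continuous_res_wig hz).matrix_elem i j

lemma continuous_trRes (hz : z.im ≠ 0) : Continuous fun y => trRes n y z :=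
  continuous_const.mul (continuous_res_wig hz).matrix_trace

lemma norm_res_wig_le (hz : z.im ≠ 0) (y : Sym2 ℕ → ℝ) : ‖res (wig n y) z‖ ≤ |z.im|⁻¹ :=
  norm_res_le (wig_isHermitian n y) hz

lemma norm_trRes_le (hz : z.im ≠ 0) (y : Sym2 ℕ → ℝ) : ‖trRes n y z‖ ≤ |z.im|⁻¹ := by
  unfold trRes
  rcases Nat.eq_zero_or_pos n with rfl | hn
  · simp
  have hn' : (0 : ℝ) < n := by exact_mod_cast hn
  rw [norm_mul, norm_inv, Complex.norm_natCast, inv_mul_le_iff₀ hn']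
  refine (norm_trace_le _).trans ?_
  rw [Fintype.card_fin]
  gcongr
  exact norm_res_wig_le hz y

/-- The matrix with a one in the positions `(i, j)` and `(j, i)`, and zeros elsewhere. -/
def symUnit (i j : Fin n) : Matrix (Fin n) (Fin n) ℂ :=
  Matrix.single i j 1 + if i = j then 0 else Matrix.single j i 1

lemma norm_symUnit_le (i j : Fin n) : ‖symUnit i j‖ ≤ 2 := by
  unfold symUnit
  refine (norm_add_le _ _).trans ?_
  have h1 := norm_single_le i j
  have h2 := norm_single_le j i
  split_ifs
  · rw [norm_zero]; linarith
  · linarith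

/-- Up to sign, this is the derivative of `G j i` in the entry at `(i, j)`. Summed over `i` and `j`,
the products of diagonal entries give the square of the trace, and the squares are of lower order.
-/
lemma mul_symUnit_mul_apply (G : Matrix (Fin n) (Fin n) ℂ) (i j : Fin n) :
    (G * symUnit i j * G) j i = G i i * G j j + if i = j then 0 else G j i ^ 2 := by
  unfold symUnit
  have h : ∀ a b c d : Fin n, (G * Matrix.single a b (1 : ℂ) * G) c d = G c a * G b d := by
    intro a b c d
    rw [Matrix.mul_assoc, Matrix.mul_apply]
    rw [Finset.sum_eq_single a]
    · rw [Matrix.single_mul_apply_same, one_mul]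
    · intro x _ hx
      rw [Matrix.single_mul_apply_of_ne _ _ _ _ _ hx, mul_zero]
    · simp
  split_ifs with hij
  · subst hij; rw [add_zero, h, add_zero]
  · rw [mul_add, add_mul, Matrix.add_apply, h, h]
    ring

lemma wig_sub_wig_update (y : Sym2 ℕ → ℝ) (i j : Fin n) :
    wig n y - wig n (Function.update y s((i : ℕ), (j : ℕ)) 0)
      = (((√(n : ℝ))⁻¹ * y s((i : ℕ), (j : ℕ)) : ℝ) : ℂ) • symUnit i j := by
  ext a b
  rw [Matrix.sub_apply, Matrix.smul_apply, wig_apply, wig_apply]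
  have hs : symUnit i j a b = if s((a : ℕ), (b : ℕ)) = s((i : ℕ), (j : ℕ)) then 1 else 0 := by
    unfold symUnit
    rw [Matrix.add_apply, Matrix.single_apply]
    simp only [Sym2.eq_iff, Fin.val_inj]
    by_cases hij : i = j
    · subst hij
      rw [if_pos rfl, Matrix.zero_apply, add_zero]
      grind
    · rw [if_neg hij, Matrix.single_apply]
      by_cases ha : a = i <;> by_cases hb : b = i <;> by_cases ha' : a = j <;> by_cases hb' : b = j <;>
        grind
  rw [hs]
  by_cases h : s((a : ℕ), (b : ℕ)) = s((i : ℕ), (j : ℕ))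
  · rw [h, Function.update_self, if_pos rfl]; simp
  · rw [Function.update_of_ne h, if_neg h]; simp

/-- The constant in the error terms of the expansion of the resolvent in one entry. -/
def expConst (z : ℂ) : ℝ := 8 * |z.im|⁻¹ ^ 2 + 8 * |z.im|⁻¹ ^ 3

variable (y : Sym2 ℕ → ℝ) (i j : Fin n)

lemma norm_res_update_sub_le (hz : z.im ≠ 0) :
    ‖res (wig n y) z - res (wig n (Function.update y s((i : ℕ), (j : ℕ)) 0)) z‖
      ≤ 2 * |z.im|⁻¹ ^ 2 * |(√(n : ℝ))⁻¹ * y s((i : ℕ), (j : ℕ))| := by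
  rw [res_sub_res (wig_isHermitian _ _) (wig_isHermitian _ _) hz, wig_sub_wig_update, norm_neg]
  refine (norm_mul_le _ _).trans ?_
  have h1 := norm_res_wig_le hz y (n := n)
  have h2 := norm_res_wig_le hz (Function.update y s((i : ℕ), (j : ℕ)) 0) (n := n)
  have h3 := norm_symUnit_le i j
  set h := (√(n : ℝ))⁻¹ * y s((i : ℕ), (j : ℕ))
  calc _ ≤ (‖res (wig n y) z‖ * ‖(h : ℂ) • symUnit i j‖) * _ := by
        gcongr; exact norm_mul_le _ _
    _ ≤ (|z.im|⁻¹ * (|h| * 2)) * |z.im|⁻¹ := by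
        rw [norm_smul, Complex.norm_real, Real.norm_eq_abs]
        gcongr
    _ = _ := by ring

/-- First order expansion around the matrix with one entry `h` removed. The remainder is `O(h²)` by
`res_expand` and `O(|h|)` trivially; keeping the minimum of both means that after multiplication by
`h` a second moment is enough, without truncation. -/
lemma norm_expansion_le (hz : z.im ≠ 0) :
    ‖res (wig n y) z j i - res (wig n (Function.update y s((i : ℕ), (j : ℕ)) 0)) z j i
      + (((√(n : ℝ))⁻¹ * y s((i : ℕ), (j : ℕ)) : ℝ) : ℂ)
        * (res (wig n (Function.update y s((i : ℕ), (j : ℕ)) 0)) z * symUnit i j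
          * res (wig n (Function.update y s((i : ℕ), (j : ℕ)) 0)) z) j i‖
      ≤ expConst z * (|(√(n : ℝ))⁻¹ * y s((i : ℕ), (j : ℕ))|
        * min 1 |(√(n : ℝ))⁻¹ * y s((i : ℕ), (j : ℕ))|) := by
  have h1 := norm_res_wig_le hz y (n := n)
  have h2 := norm_res_wig_le hz (Function.update y s((i : ℕ), (j : ℕ)) 0) (n := n)
  have h3 := norm_symUnit_le i j
  have hex := res_expand (wig_isHermitian n (Function.update y s((i : ℕ), (j : ℕ)) 0))
    (wig_isHermitian n y) hz
  have hd := norm_res_update_sub_le y i j hz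
  rw [wig_sub_wig_update] at hex
  set h := (√(n : ℝ))⁻¹ * y s((i : ℕ), (j : ℕ)) with hh
  set G := res (wig n y) z
  set G₀ := res (wig n (Function.update y s((i : ℕ), (j : ℕ)) 0)) z
  set Δ := symUnit i j
  set η := |z.im|⁻¹ with hη
  have hη0 : 0 ≤ η := by positivity
  have e1 : G j i - G₀ j i + (h : ℂ) * (G₀ * Δ * G₀) j i = (G - G₀ + (h : ℂ) • (G₀ * Δ * G₀)) j i := by
    simp [Matrix.add_apply, Matrix.sub_apply, Matrix.smul_apply]
  rw [e1]
  refine (norm_apply_le _ _ _).trans ?_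
  have hG0 : ‖G₀ * Δ * G₀‖ ≤ 2 * η ^ 2 := by
    calc _ ≤ ‖G₀‖ * ‖Δ‖ * ‖G₀‖ := (norm_mul_le _ _).trans (by gcongr; exact norm_mul_le _ _)
      _ ≤ η * 2 * η := by gcongr
      _ = _ := by ring
  have b1 : ‖G - G₀ + (h : ℂ) • (G₀ * Δ * G₀)‖ ≤ 4 * η ^ 2 * |h| := by
    refine (norm_add_le _ _).trans ?_
    rw [norm_smul, Complex.norm_real, Real.norm_eq_abs]
    have := mul_le_mul_of_nonneg_left hG0 (abs_nonneg h)
    linarith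
  have b2 : ‖G - G₀ + (h : ℂ) • (G₀ * Δ * G₀)‖ ≤ 4 * η ^ 3 * (|h| * |h|) := by
    have e2 : G - G₀ + (h : ℂ) • (G₀ * Δ * G₀) = ((h : ℂ) * h) • (G * Δ * (G₀ * Δ * G₀)) := by
      have : G - G₀ = - (G₀ * ((h : ℂ) • Δ) * G₀) + G * ((h : ℂ) • Δ) * G₀ * ((h : ℂ) • Δ) * G₀ := by
        conv_lhs => rw [hex]
        abel
      rw [this]
      simp only [mul_smul_comm, smul_mul_assoc, smul_smul, Matrix.mul_assoc]
      abel
    rw [e2, norm_smul, norm_mul, Complex.norm_real, Real.norm_eq_abs]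
    have : ‖G * Δ * (G₀ * Δ * G₀)‖ ≤ 4 * η ^ 3 := by
      calc _ ≤ ‖G‖ * ‖Δ‖ * ‖G₀ * Δ * G₀‖ := (norm_mul_le _ _).trans (by gcongr; exact norm_mul_le _ _)
        _ ≤ η * 2 * (2 * η ^ 2) := by gcongr
        _ = _ := by ring
    calc _ ≤ |h| * |h| * (4 * η ^ 3) := by gcongr
      _ = _ := by ring
  unfold expConst
  rw [← hη]
  have hp2 : 0 ≤ η ^ 2 := by positivity
  have hp3 : 0 ≤ η ^ 3 := by positivity
  rcases le_total 1 |h| with hc | hc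
  · rw [min_eq_left hc, mul_one]
    refine b1.trans ?_
    gcongr
    linarith
  · rw [min_eq_right hc]
    refine b2.trans ?_
    gcongr
    linarith

/-- Compares the derivative term at the full matrix with that at the matrix with the entry removed:
the latter is independent of the entry, the former enters the trace identity. -/
lemma norm_derivative_sub_le (hz : z.im ≠ 0) :
    ‖(res (wig n y) z * symUnit i j * res (wig n y) z) j i
      - (res (wig n (Function.update y s((i : ℕ), (j : ℕ)) 0)) z * symUnit i j
          * res (wig n (Function.update y s((i : ℕ), (j : ℕ)) 0)) z) j i‖
      ≤ expConst z * min 1 |(√(n : ℝ))⁻¹ * y s((i : ℕ), (j : ℕ))| := by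
  have h1 := norm_res_wig_le hz y (n := n)
  have h2 := norm_res_wig_le hz (Function.update y s((i : ℕ), (j : ℕ)) 0) (n := n)
  have h3 := norm_symUnit_le i j
  have hd := norm_res_update_sub_le y i j hz
  have hd' := norm_res_sub_res_le (wig_isHermitian n (Function.update y s((i : ℕ), (j : ℕ)) 0))
    (wig_isHermitian n y) hz
  set h := (√(n : ℝ))⁻¹ * y s((i : ℕ), (j : ℕ)) with hh
  set G := res (wig n y) z
  set G₀ := res (wig n (Function.update y s((i : ℕ), (j : ℕ)) 0)) z
  set Δ := symUnit i j
  set η := |z.im|⁻¹ with hη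
  have hη0 : 0 ≤ η := by positivity
  rw [← Matrix.sub_apply]
  refine (norm_apply_le _ _ _).trans ?_
  have e1 : G * Δ * G - G₀ * Δ * G₀ = (G - G₀) * Δ * G + G₀ * Δ * (G - G₀) := by noncomm_ring
  have b : ‖G * Δ * G - G₀ * Δ * G₀‖ ≤ 4 * η * ‖G - G₀‖ := by
    rw [e1]
    refine (norm_add_le _ _).trans ?_
    calc _ ≤ ‖G - G₀‖ * ‖Δ‖ * ‖G‖ + ‖G₀‖ * ‖Δ‖ * ‖G - G₀‖ := by
          gcongr
          · exact (norm_mul_le _ _).trans (by gcongr; exact norm_mul_le _ _)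
          · exact (norm_mul_le _ _).trans (by gcongr; exact norm_mul_le _ _)
      _ ≤ ‖G - G₀‖ * 2 * η + η * 2 * ‖G - G₀‖ := by gcongr
      _ = _ := by ring
  unfold expConst
  rw [← hη]
  have hp2 : 0 ≤ η ^ 2 := by positivity
  have hp3 : 0 ≤ η ^ 3 := by positivity
  rcases le_total 1 |h| with hc | hc
  · rw [min_eq_left hc, mul_one]
    have := mul_le_mul_of_nonneg_left hd' (by positivity : 0 ≤ 4 * η)
    nlinarith
  · rw [min_eq_right hc]
    have := mul_le_mul_of_nonneg_left hd (by positivity : 0 ≤ 4 * η)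
    have h5 : 4 * η * (2 * η ^ 2 * |h|) = 8 * η ^ 3 * |h| := by ring
    have h6 : 0 ≤ 8 * η ^ 2 * |h| := by positivity
    nlinarith

lemma trace_wig_mul_res (hz : z.im ≠ 0) (hn : n ≠ 0) :
    (n : ℂ)⁻¹ * ∑ i : Fin n, ∑ j : Fin n,
      (((√(n : ℝ))⁻¹ * y s((i : ℕ), (j : ℕ)) : ℝ) : ℂ) * res (wig n y) z j i
      = 1 + z * trRes n y z := by
  have h : ∑ i : Fin n, ∑ j : Fin n,
      (((√(n : ℝ))⁻¹ * y s((i : ℕ), (j : ℕ)) : ℝ) : ℂ) * res (wig n y) z j i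
      = (wig n y * res (wig n y) z).trace := by
    simp only [Matrix.trace, Matrix.diag, Matrix.mul_apply, wig_apply]
  rw [h, mul_res (wig_isHermitian n y) hz, Matrix.trace_add, Matrix.trace_one, Matrix.trace_smul,
    Fintype.card_fin, trRes, smul_eq_mul]
  have : (n : ℂ) ≠ 0 := by exact_mod_cast hn
  field_simp

/-- The diagonal products sum exactly to `trRes n y z ^ 2`. The remaining squares of entries are
bounded column by column by the operator norm, which gains a factor `1 / n`. -/
lemma norm_sum_derivative_sub_le (hz : z.im ≠ 0) :
    ‖(n : ℂ)⁻¹ * ∑ i : Fin n, ∑ j : Fin n,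
        (n : ℂ)⁻¹ * (res (wig n y) z * symUnit i j * res (wig n y) z) j i - trRes n y z ^ 2‖
      ≤ (n : ℝ)⁻¹ * |z.im|⁻¹ ^ 2 := by
  set G := res (wig n y) z with hG
  rcases Nat.eq_zero_or_pos n with rfl | hn
  · simp [trRes]
  have hn' : (0 : ℝ) < n := by exact_mod_cast hn
  have e : (n : ℂ)⁻¹ * ∑ i : Fin n, ∑ j : Fin n, (n : ℂ)⁻¹ * (G * symUnit i j * G) j i - trRes n y z ^ 2
      = (n : ℂ)⁻¹ * (n : ℂ)⁻¹ * ∑ i : Fin n, ∑ j : Fin n, if i = j then 0 else G j i ^ 2 := by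
    simp_rw [mul_symUnit_mul_apply, ← Finset.mul_sum, Finset.sum_add_distrib, ← Finset.mul_sum,
      ← Finset.sum_mul]
    simp only [trRes, Matrix.trace, Matrix.diag, ← hG]
    ring
  rw [e, norm_mul, norm_mul, norm_inv, Complex.norm_natCast, mul_assoc]
  gcongr
  rw [inv_mul_le_iff₀ hn']
  refine (norm_sum_le _ _).trans ?_
  calc _ ≤ ∑ _i : Fin n, |z.im|⁻¹ ^ 2 := by
        refine Finset.sum_le_sum fun i _ => (norm_sum_le _ _).trans ?_
        calc _ ≤ ∑ j, ‖G j i‖ ^ 2 := Finset.sum_le_sum fun j _ => by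
              split_ifs
              · rw [norm_zero]; positivity
              · rw [norm_pow]
          _ ≤ ‖G‖ ^ 2 := sum_norm_sq_apply_le _ _
          _ ≤ _ := by gcongr; exact norm_res_wig_le hz y
    _ = _ := by simp

end WignerMatrix

end CirculantBlocks
end

noncomputable section

namespace CirculantBlocks

open scoped Matrix.Norms.L2Operator Matrix

/-! ### The self-consistent equation in expectation -/

section ExpectedResolvent

variable {Ω : Type*} [MeasurableSpace Ω] {P : Measure Ω}

omit [MeasurableSpace Ω] in
lemma comap_pi_le {ι : Type*} {X : ι → Ω → ℝ} {m : MeasurableSpace Ω}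
    (h : ∀ i, Measurable[m] (X i)) :
    MeasurableSpace.comap (fun ω i => X i ω) MeasurableSpace.pi ≤ m := by
  rw [← measurable_iff_comap_le]
  exact measurable_pi_iff.2 h

lemma indepFun_update {ι : Type*} [DecidableEq ι] {y : ι → Ω → ℝ} (hmeas : ∀ e, Measurable (y e))
    (hind : iIndepFun y P) (e : ι) :
    IndepFun (y e) (fun ω => Function.update (fun e' => y e' ω) e 0) P := by
  have h := indep_iSup_of_disjoint (fun e => (hmeas e).comap_le) hind.iIndep
    (S := {e}) (T := {e}ᶜ) (by simp)
  rw [IndepFun_iff_Indep]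
  refine indep_of_indep_of_le_left (indep_of_indep_of_le_right h ?_) (by simp)
  refine comap_pi_le (X := fun e' ω => Function.update (fun e' => y e' ω) e 0 e') fun e' => ?_
  by_cases he : e' = e
  · subst he
    simp
  · simp only [Function.update_of_ne he]
    refine Measurable.mono (comap_measurable (y e')) ?_ le_rfl
    exact le_iSup₂_of_le e' (by simpa using he) le_rfl

variable [IsProbabilityMeasure P] {y : Sym2 ℕ → Ω → ℝ}

/-- The size of the error terms in the self-consistent equation. -/
def lindebergError (P : Measure Ω) (X : Ω → ℝ) (v : ℝ) (n : ℕ) : ℝ :=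
  ∫ ω, (X ω ^ 2 + v) * min 1 |(√(n : ℝ))⁻¹ * X ω| ∂P

lemma integrable_lindeberg {X : Ω → ℝ} (hX : MemLp X 2 P) (v : ℝ) (n : ℕ) :
    Integrable (fun ω => (X ω ^ 2 + v) * min 1 |(√(n : ℝ))⁻¹ * X ω|) P := by
  have h2 : Integrable (fun ω => X ω ^ 2 + v) P := hX.integrable_sq.add (integrable_const v)
  refine h2.mul_bdd (c := 1) ?_ (Eventually.of_forall fun ω => ?_)
  · exact aestronglyMeasurable_const.inf (hX.aestronglyMeasurable.const_mul _).norm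
  · rw [Real.norm_of_nonneg (by positivity)]
    exact min_le_left _ _

/-- Dominated convergence with majorant `X ^ 2 + v`; no moment beyond the second is required. -/
lemma tendsto_lindebergError {X : Ω → ℝ} (hX : MemLp X 2 P) {v : ℝ} (hv : 0 ≤ v) :
    Tendsto (lindebergError P X v) atTop (𝓝 0) := by
  have h := tendsto_integral_of_dominated_convergence (μ := P)
    (F := fun (n : ℕ) ω => (X ω ^ 2 + v) * min 1 |(√(n : ℝ))⁻¹ * X ω|) (f := fun _ => 0)
    (fun ω => X ω ^ 2 + v) (fun n => (integrable_lindeberg hX v n).aestronglyMeasurable)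
    (hX.integrable_sq.add (integrable_const v))
    (fun n => Eventually.of_forall fun ω => by
      rw [Real.norm_of_nonneg (by positivity)]
      exact mul_le_of_le_one_right (by positivity) (min_le_left _ _))
    (Eventually.of_forall fun ω => by
      have h1 : Tendsto (fun n : ℕ => (√(n : ℝ))⁻¹) atTop (𝓝 0) :=
        (Real.tendsto_sqrt_atTop.comp tendsto_natCast_atTop_atTop).inv_tendsto_atTop
      have h2 := ((h1.mul_const (X ω)).abs).const_mul (X ω ^ 2 + v)
      simp only [zero_mul, abs_zero, mul_zero] at h2
      refine squeeze_zero (fun n => by positivity) (fun n => ?_) h2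
      gcongr
      exact min_le_right _ _)
  simp only [integral_zero] at h
  exact h

variable {v : ℝ≥0}

-- Approximate integration by parts in one entry `h` of mean zero and variance `v / n`: the
-- expectation of `h * G j i` is close to `-(v / n)` times that of `(G * symUnit i j * G) j i`. The
-- error is `1 / n` times a vanishing quantity, so it survives the sum over `n²` entries divided by
-- `n`.
set_option maxHeartbeats 1000000 in
lemma norm_integral_entry_le (hmeas : ∀ e, Measurable (y e)) (hind : iIndepFun y P)
    (hident : ∀ e e', IdentDistrib (y e) (y e') P P) (hL2 : ∀ e, MemLp (y e) 2 P)
    (hmean : ∀ e, ∫ ω, y e ω ∂P = 0) (hvar : ∀ e, ∫ ω, y e ω ^ 2 ∂P = v)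
    {z : ℂ} (hz : z.im ≠ 0) {n : ℕ} (i j : Fin n) (e₀ : Sym2 ℕ) :
    ‖∫ ω, ((((√(n : ℝ))⁻¹ * y s((i : ℕ), (j : ℕ)) ω : ℝ) : ℂ)
          * res (wig n fun e => y e ω) z j i
        + (v : ℂ) * ((n : ℂ)⁻¹ * (res (wig n fun e => y e ω) z * symUnit i j
            * res (wig n fun e => y e ω) z) j i)) ∂P‖
      ≤ expConst z * ((n : ℝ)⁻¹ * lindebergError P (y e₀) v n) := by
  set e : Sym2 ℕ := s((i : ℕ), (j : ℕ)) with he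
  have hym : Measurable fun ω e => y e ω := measurable_pi_iff.2 hmeas
  have hum : Measurable fun ω => Function.update (fun e' => y e' ω) e 0 := by
    refine measurable_pi_iff.2 fun e' => ?_
    by_cases h : e' = e
    · subst h; simp
    · simp only [Function.update_of_ne h]; exact hmeas e'
  set h : Ω → ℝ := fun ω => (√(n : ℝ))⁻¹ * y e ω with hh
  have hhm : Measurable h := (hmeas e).const_mul _
  have hhL2 : MemLp h 2 P := (hL2 e).const_mul _
  have hhi : Integrable h P := hhL2.integrable (by norm_num)
  have hh2 : Integrable (fun ω => h ω ^ 2) P := hhL2.integrable_sq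
  have hn : (0 : ℝ) < n := by exact_mod_cast (Nat.zero_le _).trans_lt i.2
  have hsq : ((√(n : ℝ))⁻¹) ^ 2 = (n : ℝ)⁻¹ := by rw [inv_pow, Real.sq_sqrt hn.le]
  have hEh : ∫ ω, h ω ∂P = 0 := by simp only [hh]; rw [integral_const_mul, hmean, mul_zero]
  have hEh2 : ∫ ω, h ω ^ 2 ∂P = (n : ℝ)⁻¹ * v := by
    simp only [hh, mul_pow]; rw [integral_const_mul, hvar, hsq]
  -- the four functionals of the matrix
  set φ : (Sym2 ℕ → ℝ) → ℂ := fun u => res (wig n u) z j i with hφ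
  set ψ : (Sym2 ℕ → ℝ) → ℂ := fun u => (res (wig n u) z * symUnit i j * res (wig n u) z) j i with hψ
  have hφm : Measurable φ := (continuous_res_wig_apply hz j i).measurable
  have hψm : Measurable ψ :=
    ((((continuous_res_wig hz).matrix_mul continuous_const).matrix_mul
      (continuous_res_wig hz)).matrix_elem j i).measurable
  set η := |z.im|⁻¹
  have hφb : ∀ u, ‖φ u‖ ≤ η := fun u =>
    (norm_apply_le (res (wig n u) z) j i).trans (norm_res_wig_le hz u)
  have hψb : ∀ u, ‖ψ u‖ ≤ η * 2 * η := fun u => by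
    refine (norm_apply_le (res (wig n u) z * symUnit i j * res (wig n u) z) j i).trans ?_
    calc _ ≤ ‖res (wig n u) z‖ * ‖symUnit i j‖ * ‖res (wig n u) z‖ :=
          (norm_mul_le _ _).trans (by gcongr; exact norm_mul_le _ _)
      _ ≤ _ := by
          gcongr
          · exact norm_res_wig_le hz u
          · exact norm_symUnit_le i j
          · exact norm_res_wig_le hz u
  set Y : Ω → Sym2 ℕ → ℝ := fun ω e => y e ω with hY
  set Y₀ : Ω → Sym2 ℕ → ℝ := fun ω => Function.update (fun e' => y e' ω) e 0 with hY₀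
  have hφi : Integrable (fun ω => φ (Y ω)) P :=
    Integrable.of_bound (hφm.comp hym).aestronglyMeasurable _ (Eventually.of_forall fun ω => hφb _)
  have hψi : Integrable (fun ω => ψ (Y ω)) P :=
    Integrable.of_bound (hψm.comp hym).aestronglyMeasurable _ (Eventually.of_forall fun ω => hψb _)
  have hψ0i : Integrable (fun ω => ψ (Y₀ ω)) P :=
    Integrable.of_bound (hψm.comp hum).aestronglyMeasurable _ (Eventually.of_forall fun ω => hψb _)
  have hhci : Integrable (fun ω => (h ω : ℂ)) P := hhi.ofReal
  have hh2ci : Integrable (fun ω => ((h ω ^ 2 : ℝ) : ℂ)) P := hh2.ofReal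
  have i1 : Integrable (fun ω => (h ω : ℂ) * φ (Y ω)) P :=
    hhci.mul_bdd (hφm.comp hym).aestronglyMeasurable (Eventually.of_forall fun ω => hφb _)
  have i2 : Integrable (fun ω => (h ω : ℂ) * φ (Y₀ ω)) P :=
    hhci.mul_bdd (hφm.comp hum).aestronglyMeasurable (Eventually.of_forall fun ω => hφb _)
  have i3 : Integrable (fun ω => ((h ω ^ 2 : ℝ) : ℂ) * ψ (Y₀ ω)) P :=
    hh2ci.mul_bdd (hψm.comp hum).aestronglyMeasurable (Eventually.of_forall fun ω => hψb _)
  have hindep : IndepFun (y e) Y₀ P := indepFun_update hmeas hind e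
  -- `Y₀` is the array without the entry `h`, hence independent of it. The zeroth order term
  -- vanishes because `h` is centered, and in the first order term (`E3`) `h²` factors out as its
  -- mean `v / n`.
  have E2 : ∫ ω, (h ω : ℂ) * φ (Y₀ ω) ∂P = 0 := by
    have hi : IndepFun (fun ω => (h ω : ℂ)) (fun ω => φ (Y₀ ω)) P :=
      hindep.comp (φ := fun t => (((√(n : ℝ))⁻¹ * t : ℝ) : ℂ)) (by fun_prop) hφm
    rw [hi.integral_fun_mul_eq_mul_integral hhci.aestronglyMeasurable
      (hφm.comp hum).aestronglyMeasurable, integral_complex_ofReal, hEh]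
    simp
  have E3 : ∫ ω, ((h ω ^ 2 : ℝ) : ℂ) * ψ (Y₀ ω) ∂P
      = (v : ℂ) * ((n : ℂ)⁻¹ * ∫ ω, ψ (Y₀ ω) ∂P) := by
    have hi : IndepFun (fun ω => ((h ω ^ 2 : ℝ) : ℂ)) (fun ω => ψ (Y₀ ω)) P :=
      hindep.comp (φ := fun t => ((((√(n : ℝ))⁻¹ * t) ^ 2 : ℝ) : ℂ)) (by fun_prop) hψm
    rw [hi.integral_fun_mul_eq_mul_integral hh2ci.aestronglyMeasurable
      (hψm.comp hum).aestronglyMeasurable, integral_complex_ofReal, hEh2]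
    push_cast
    ring
  -- What is left are two errors: `r`, the Taylor remainder multiplied by `h`, and `d`, the cost of
  -- putting `Y` back for `Y₀` in the derivative.
  set r : Ω → ℂ := fun ω => (h ω : ℂ) * (φ (Y ω) - φ (Y₀ ω) + (h ω : ℂ) * ψ (Y₀ ω)) with hr
  have hri : Integrable r P := by
    have : r = fun ω => (h ω : ℂ) * φ (Y ω) - (h ω : ℂ) * φ (Y₀ ω)
        + ((h ω ^ 2 : ℝ) : ℂ) * ψ (Y₀ ω) := by
      funext ω; simp only [hr]; push_cast; ring
    rw [this]
    exact (i1.sub i2).add i3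
  set d : Ω → ℂ := fun ω => (v : ℂ) * ((n : ℂ)⁻¹ * (ψ (Y ω) - ψ (Y₀ ω))) with hd
  have hdi : Integrable d P := ((hψi.sub hψ0i).const_mul _).const_mul _
  have hmain : ∫ ω, ((h ω : ℂ) * φ (Y ω) + (v : ℂ) * ((n : ℂ)⁻¹ * ψ (Y ω))) ∂P
      = ∫ ω, (r ω + d ω) ∂P := by
    have e1 : ∀ ω, (h ω : ℂ) * φ (Y ω) + (v : ℂ) * ((n : ℂ)⁻¹ * ψ (Y ω))
        = (r ω + d ω) + ((h ω : ℂ) * φ (Y₀ ω)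
          - (((h ω ^ 2 : ℝ) : ℂ) * ψ (Y₀ ω) - (v : ℂ) * ((n : ℂ)⁻¹ * ψ (Y₀ ω)))) := fun ω => by
      simp only [hr, hd]; push_cast; ring
    simp_rw [e1]
    have i4 : Integrable (fun ω => (v : ℂ) * ((n : ℂ)⁻¹ * ψ (Y₀ ω))) P :=
      (hψ0i.const_mul _).const_mul _
    have i5 : Integrable (fun ω => ((h ω ^ 2 : ℝ) : ℂ) * ψ (Y₀ ω)
      - (v : ℂ) * ((n : ℂ)⁻¹ * ψ (Y₀ ω))) P := i3.sub i4
    have i6 : Integrable (fun ω => (h ω : ℂ) * φ (Y₀ ω)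
          - (((h ω ^ 2 : ℝ) : ℂ) * ψ (Y₀ ω) - (v : ℂ) * ((n : ℂ)⁻¹ * ψ (Y₀ ω)))) P := i2.sub i5
    have i7 : Integrable (fun ω => r ω + d ω) P := hri.add hdi
    rw [integral_add i7 i6, integral_sub i2 i5, integral_sub i3 i4, E2, E3, integral_const_mul,
      integral_const_mul]
    ring
  rw [hmain]
  have hid : lindebergError P (y e₀) v n = lindebergError P (y e) v n :=
    ((hident e₀ e).comp (u := fun t : ℝ => (t ^ 2 + v) * min 1 |(√(n : ℝ))⁻¹ * t|)
      (by fun_prop)).integral_eq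
  rw [hid, lindebergError, ← integral_const_mul, ← integral_const_mul]
  refine norm_integral_le_of_norm_le (((integrable_lindeberg (hL2 e) v n).const_mul _).const_mul _)
    (Eventually.of_forall fun ω => ?_)
  have hrb : ‖r ω‖ ≤ |h ω| * (expConst z * (|h ω| * min 1 |h ω|)) := by
    simp only [hr]
    rw [norm_mul, Complex.norm_real, Real.norm_eq_abs]
    gcongr
    exact norm_expansion_le (fun e => y e ω) i j hz
  have hdb : ‖d ω‖ ≤ v * ((n : ℝ)⁻¹ * (expConst z * min 1 |h ω|)) := by
    simp only [hd]
    rw [norm_mul, norm_mul, norm_inv, Complex.norm_natCast]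
    have : ‖(v : ℂ)‖ = v := by
      rw [Complex.norm_real, Real.norm_eq_abs, NNReal.abs_eq]
    rw [this]
    gcongr
    exact norm_derivative_sub_le (fun e => y e ω) i j hz
  refine (norm_add_le _ _).trans ((add_le_add hrb hdb).trans (le_of_eq ?_))
  have habs : |h ω| * |h ω| = (n : ℝ)⁻¹ * y e ω ^ 2 := by
    rw [abs_mul_abs_self, ← hsq]; simp only [hh]; ring
  calc _ = expConst z * min 1 |h ω| * (|h ω| * |h ω| + v * (n : ℝ)⁻¹) := by ring
    _ = _ := by rw [habs]; ring

/-- The self-consistent equation for the expected normalized trace of the resolvent. -/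
theorem norm_self_consistent_le (hmeas : ∀ e, Measurable (y e)) (hind : iIndepFun y P)
    (hident : ∀ e e', IdentDistrib (y e) (y e') P P) (hL2 : ∀ e, MemLp (y e) 2 P)
    (hmean : ∀ e, ∫ ω, y e ω ∂P = 0) (hvar : ∀ e, ∫ ω, y e ω ^ 2 ∂P = v)
    {z : ℂ} (hz : z.im ≠ 0) {n : ℕ} (hn : n ≠ 0) (e₀ : Sym2 ℕ) :
    ‖1 + z * ∫ ω, trRes n (fun e => y e ω) z ∂P + v * ∫ ω, trRes n (fun e => y e ω) z ^ 2 ∂P‖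
      ≤ expConst z * lindebergError P (y e₀) v n + v * ((n : ℝ)⁻¹ * |z.im|⁻¹ ^ 2) := by
  have hym : Measurable fun ω e => y e ω := measurable_pi_iff.2 hmeas
  have hn' : (0 : ℝ) < n := by exact_mod_cast Nat.pos_of_ne_zero hn
  have hsm : Measurable fun ω => trRes n (fun e => y e ω) z :=
    (continuous_trRes hz).measurable.comp hym
  have hs1 : Integrable (fun ω => trRes n (fun e => y e ω) z) P :=
    Integrable.of_bound hsm.aestronglyMeasurable _ (Eventually.of_forall fun ω => norm_trRes_le hz _)
  have hs2 : Integrable (fun ω => trRes n (fun e => y e ω) z ^ 2) P :=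
    Integrable.of_bound (hsm.pow_const 2).aestronglyMeasurable (|z.im|⁻¹ ^ 2)
      (Eventually.of_forall fun ω => by
        rw [norm_pow]; gcongr; exact norm_trRes_le hz _)
  set T : Fin n → Fin n → Ω → ℂ := fun i j ω =>
    (((√(n : ℝ))⁻¹ * y s((i : ℕ), (j : ℕ)) ω : ℝ) : ℂ) * res (wig n fun e => y e ω) z j i
        + (v : ℂ) * ((n : ℂ)⁻¹ * (res (wig n fun e => y e ω) z * symUnit i j
            * res (wig n fun e => y e ω) z) j i) with hT
  have hTi : ∀ i j, Integrable (T i j) P := fun i j => by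
    have h1 : Integrable (fun ω => (((√(n : ℝ))⁻¹ * y s((i : ℕ), (j : ℕ)) ω : ℝ) : ℂ)) P :=
      (((hL2 s((i : ℕ), (j : ℕ))).integrable (by norm_num)).const_mul _).ofReal
    have h2 : Measurable fun ω => res (wig n fun e => y e ω) z j i :=
      (continuous_res_wig_apply hz j i).measurable.comp hym
    have h3 : Measurable fun ω => (res (wig n fun e => y e ω) z * symUnit i j
            * res (wig n fun e => y e ω) z) j i :=
      ((((continuous_res_wig hz).matrix_mul continuous_const).matrix_mul
      (continuous_res_wig hz)).matrix_elem j i).measurable.comp hym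
    refine (h1.mul_bdd h2.aestronglyMeasurable (Eventually.of_forall fun ω =>
      (norm_apply_le _ _ _).trans (norm_res_wig_le hz _))).add
      (((Integrable.of_bound h3.aestronglyMeasurable (|z.im|⁻¹ * 2 * |z.im|⁻¹)
        (Eventually.of_forall fun ω => ?_)).const_mul _).const_mul _)
    refine (norm_apply_le _ _ _).trans ?_
    calc _ ≤ ‖res (wig n fun e => y e ω) z‖ * ‖symUnit i j‖ * ‖res (wig n fun e => y e ω) z‖ :=
          (norm_mul_le _ _).trans (by gcongr; exact norm_mul_le _ _)
      _ ≤ _ := by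
          gcongr
          · exact norm_res_wig_le hz _
          · exact norm_symUnit_le i j
          · exact norm_res_wig_le hz _
  set R : Ω → ℂ := fun ω => (n : ℂ)⁻¹ * ∑ i, ∑ j, T i j ω with hR
  have hRi : Integrable R P :=
    (integrable_finsetSum _ fun i _ => integrable_finsetSum _ fun j _ => hTi i j).const_mul _
  have hRb : ‖∫ ω, R ω ∂P‖ ≤ expConst z * lindebergError P (y e₀) v n := by
    simp only [hR]
    rw [integral_const_mul, integral_finsetSum _ fun i _ => integrable_finsetSum _ fun j _ => hTi i j]
    simp_rw [integral_finsetSum _ fun j _ => hTi _ j]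
    rw [norm_mul, norm_inv, Complex.norm_natCast, inv_mul_le_iff₀ hn']
    refine (norm_sum_le _ _).trans ?_
    calc _ ≤ ∑ _i : Fin n, ∑ _j : Fin n,
          expConst z * ((n : ℝ)⁻¹ * lindebergError P (y e₀) v n) :=
          Finset.sum_le_sum fun i _ => (norm_sum_le _ _).trans (Finset.sum_le_sum fun j _ =>
            norm_integral_entry_le hmeas hind hident hL2 hmean hvar hz i j e₀)
      _ = _ := by
          simp only [Finset.sum_const, Finset.card_univ, Fintype.card_fin, nsmul_eq_mul]
          field_simp
  have hv : ‖(v : ℂ)‖ = v := by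
    rw [Complex.norm_real, Real.norm_eq_abs, NNReal.abs_eq]
  -- Pointwise, `R` is `1 + z s` by the trace identity, plus `v` times the derivative sum, which is
  -- `s²` up to `O(1/n)`.
  have hdiff : ∀ ω, ‖1 + z * trRes n (fun e => y e ω) z + v * trRes n (fun e => y e ω) z ^ 2 - R ω‖
      ≤ v * ((n : ℝ)⁻¹ * |z.im|⁻¹ ^ 2) := fun ω => by
    have h1 := trace_wig_mul_res (fun e => y e ω) hz hn
    have h2 := norm_sum_derivative_sub_le (fun e => y e ω) hz (n := n)
    have e1 : 1 + z * trRes n (fun e => y e ω) z + v * trRes n (fun e => y e ω) z ^ 2 - R ω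
        = -(v : ℂ) * ((n : ℂ)⁻¹ * ∑ i : Fin n, ∑ j : Fin n, (n : ℂ)⁻¹ *
          (res (wig n fun e => y e ω) z * symUnit i j * res (wig n fun e => y e ω) z) j i
            - trRes n (fun e => y e ω) z ^ 2) := by
      rw [← h1]
      simp only [hR, hT, Finset.sum_add_distrib, ← Finset.mul_sum]
      ring
    rw [e1, norm_mul, norm_neg, hv]
    gcongr
  have e2 : 1 + z * ∫ ω, trRes n (fun e => y e ω) z ∂P + v * ∫ ω, trRes n (fun e => y e ω) z ^ 2 ∂P
      = ∫ ω, R ω ∂P + ∫ ω, (1 + z * trRes n (fun e => y e ω) z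
        + v * trRes n (fun e => y e ω) z ^ 2 - R ω) ∂P := by
    have j1 : Integrable (fun _ : Ω => (1 : ℂ)) P := integrable_const _
    have j2 := hs1.const_mul z
    have j3 := hs2.const_mul (v : ℂ)
    have j4 : Integrable (fun ω => 1 + z * trRes n (fun e => y e ω) z) P := j1.add j2
    have j5 : Integrable (fun ω => 1 + z * trRes n (fun e => y e ω) z
      + v * trRes n (fun e => y e ω) z ^ 2) P := j4.add j3
    rw [integral_sub j5 hRi, integral_add j4 j3, integral_add j1 j2, integral_const_mul z,
      integral_const_mul (v : ℂ)]
    simp only [integral_const, probReal_univ, one_smul]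
    ring
  rw [e2]
  refine (norm_add_le _ _).trans (add_le_add hRb ?_)
  simpa using norm_integral_le_of_norm_le_const (μ := P) (Eventually.of_forall hdiff)

end ExpectedResolvent

end CirculantBlocks
end

noncomputable section

namespace CirculantBlocks

open scoped Matrix.Norms.L2Operator Matrix

/-! ### Wigner's law by rows and rank perturbation -/

section WignerLaw

variable {Ω : Type*} [MeasurableSpace Ω] {P : Measure Ω}

/-- Disjoint blocks of an independent family are independent. -/
lemma iIndepFun_curry {ι : Type*} {κ : ι → Type*} {X : (i : ι) → κ i → Ω → ℝ}
    (mX : ∀ i j, Measurable (X i j))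
    (h : iIndepFun (fun (p : (i : ι) × κ i) ω => X p.1 p.2 ω) P) :
    iIndepFun (fun i ω j => X i j ω) P := by
  have := h.isProbabilityMeasure
  have : ∀ i j, IsProbabilityMeasure (P.map (X i j)) :=
    fun i j => Measure.isProbabilityMeasure_map (mX i j).aemeasurable
  have e : (fun ω i j => X i j ω)
      = (MeasurableEquiv.piCurry (fun i (_ : κ i) => ℝ)) ∘ (fun ω p => X p.1 p.2 ω) := by
    ext; simp [Sigma.curry]
  have hm : Measurable (fun ω (p : (i : ι) × κ i) => X p.1 p.2 ω) :=
    measurable_pi_iff.2 fun p => mX p.1 p.2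
  rw [iIndepFun_iff_map_fun_eq_infinitePi_map (fun i => measurable_pi_iff.2 (mX i)), e,
    ← Measure.map_map (by fun_prop) hm,
    h.map_fun_eq_infinitePi_map (X := fun (p : (i : ι) × κ i) ω => X p.1 p.2 ω)
      (fun p => mX p.1 p.2),
    Measure.infinitePi_map_piCurry (fun i j => P.map (X i j))]
  congr 1
  funext i
  have hi : iIndepFun (X i) P := h.precomp (g := fun j => (⟨i, j⟩ : (i : ι) × κ i)) sigma_mk_injective
  exact (hi.map_fun_eq_infinitePi_map (mX i)).symm

/-- The array of the entries of the symmetric matrix on and below the diagonal, row by row. -/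
def lowerRow (u : Sym2 ℕ → ℝ) (j i : ℕ) : ℝ := if i ≤ j then u s(i, j) else 0

/-- The symmetric array with given rows on and below the diagonal. -/
def ofLowerRows (n : ℕ) (x : Fin n → ℕ → ℝ) (e : Sym2 ℕ) : ℝ :=
  if h : e.sup < n then x ⟨e.sup, h⟩ e.inf else 0

lemma wig_congr {n : ℕ} {u w : Sym2 ℕ → ℝ}
    (h : ∀ a b : Fin n, u s((a : ℕ), (b : ℕ)) = w s((a : ℕ), (b : ℕ))) : wig n u = wig n w := by
  ext a b
  rw [wig_apply, wig_apply, h]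

lemma wig_ofLowerRows (n : ℕ) (u : Sym2 ℕ → ℝ) :
    wig n (ofLowerRows n fun i => lowerRow u i) = wig n u := by
  refine wig_congr fun a b => ?_
  have hab : s((a : ℕ), (b : ℕ)).sup < n := by simp
  unfold ofLowerRows
  rw [dif_pos hab]
  refine (if_pos (Sym2.inf_le_sup _)).trans ?_
  change u s((a : ℕ) ⊓ b, (a : ℕ) ⊔ b) = _
  rcases le_total (a : ℕ) b with h | h
  · rw [inf_eq_left.2 h, sup_eq_right.2 h]
  · rw [inf_eq_right.2 h, sup_eq_left.2 h, Sym2.eq_swap]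

/-- The lower triangle lists every unordered pair once, so its rows are disjoint blocks of an
independent family. Using `n` rows as variables, instead of about `n² / 2` entries, is what makes
bounded differences effective. -/
lemma iIndepFun_lowerRow {y : Sym2 ℕ → Ω → ℝ} (hmeas : ∀ e, Measurable (y e))
    (hind : iIndepFun y P) : iIndepFun (fun j ω => lowerRow (fun e => y e ω) j) P := by
  have hinj : Function.Injective
      (fun p : (j : ℕ) × Fin (j + 1) => s((p.2 : ℕ), p.1)) := by
    rintro ⟨j, i⟩ ⟨j', i'⟩ h
    have hi := i.2
    have hi' := i'.2
    simp only [Sym2.eq_iff] at h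
    obtain rfl : j = j' := by omega
    have : i = i' := by ext; omega
    rw [this]
  have h1 := iIndepFun_curry (X := fun (j : ℕ) (i : Fin (j + 1)) => y s((i : ℕ), j))
    (fun j i => hmeas _) (hind.precomp hinj)
  have h2 := h1.comp (fun (j : ℕ) (r : Fin (j + 1) → ℝ) (i : ℕ) =>
    if h : i < j + 1 then r ⟨i, h⟩ else 0) (fun j => by
      refine measurable_pi_iff.2 fun i => ?_
      by_cases h : i < j + 1
      · simp only [h, dif_pos]; fun_prop
      · simp only [h, dif_neg, not_false_eq_true]; fun_prop)
  convert h2 using 2 with j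
  funext ω i
  simp only [lowerRow, Function.comp, Nat.lt_succ_iff]
  split_ifs <;> rfl

lemma rank_wig_ofLowerRows_update_sub_le {n : ℕ} (x : Fin n → ℕ → ℝ) (i : Fin n) (r : ℕ → ℝ) :
    (wig n (ofLowerRows n (Function.update x i r)) - wig n (ofLowerRows n x)).rank ≤ 2 := by
  refine rank_le_of_support _ i fun a b ha hb => ?_
  have hab : s((a : ℕ), (b : ℕ)).sup < n := by simp
  have hne : (⟨s((a : ℕ), (b : ℕ)).sup, hab⟩ : Fin n) ≠ i := by
    intro h
    have := congrArg Fin.val h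
    simp only [Sym2.sup_mk] at this
    rcases le_total (a : ℕ) b with h' | h'
    · rw [sup_eq_right.2 h'] at this; exact hb (Fin.ext this)
    · rw [sup_eq_left.2 h'] at this; exact ha (Fin.ext this)
  rw [Matrix.sub_apply, wig_apply, wig_apply]
  unfold ofLowerRows
  rw [dif_pos hab, dif_pos hab, Function.update_of_ne hne, sub_self]

lemma norm_trRes_sub_le {n : ℕ} {u w : Sym2 ℕ → ℝ} {z : ℂ} (hz : z.im ≠ 0) {r : ℕ}
    (h : (wig n u - wig n w).rank ≤ r) :
    ‖trRes n u z - trRes n w z‖ ≤ r * (2 * |z.im|⁻¹) / n := by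
  unfold trRes
  rw [← mul_sub, norm_mul, norm_inv, Complex.norm_natCast, div_eq_inv_mul]
  gcongr
  exact norm_trace_res_sub_le (wig_isHermitian n w) (wig_isHermitian n u) hz h

lemma measurable_ofLowerRows (n : ℕ) : Measurable (ofLowerRows n) := by
  refine measurable_pi_iff.2 fun e => ?_
  unfold ofLowerRows
  by_cases h : e.sup < n
  · simp only [h, dif_pos]
    exact (measurable_pi_apply _).comp (measurable_pi_apply _)
  · simp only [h, dif_neg, not_false_eq_true]; fun_prop

/-- The diagonal entries of `Gᴴ - G = (star z - z) • (Gᴴ * G)` give `Im (G i i) = Im z * ∑ j, ‖G j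
i‖ ^ 2`. The sign is used to select the root of the limiting quadratic equation. -/
lemma trRes_im_nonneg (n : ℕ) (u : Sym2 ℕ → ℝ) {z : ℂ} (hz : 0 < z.im) :
    0 ≤ (trRes n u z).im := by
  have h : ∀ i, 0 ≤ (res (wig n u) z i i).im := fun i => by
    have hz' : (star z).im ≠ 0 := by simpa using hz.ne'
    have h := res_sub_res_point (wig_isHermitian n u) hz' hz.ne'
    rw [← conjTranspose_res (wig_isHermitian n u)] at h
    have h2 := congrArg (fun M => M i i) h
    simp only [Matrix.sub_apply, Matrix.smul_apply, Matrix.conjTranspose_apply,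
      Matrix.mul_apply, smul_eq_mul] at h2
    have h3 : ∑ j, star (res (wig n u) z j i) * res (wig n u) z j i
        = ((∑ j, ‖res (wig n u) z j i‖ ^ 2 : ℝ) : ℂ) := by
      push_cast
      exact Finset.sum_congr rfl fun j _ => by rw [Complex.star_def, Complex.conj_mul']
    rw [h3] at h2
    have h4 := congrArg Complex.im h2
    rw [Complex.im_mul_ofReal] at h4
    simp only [Complex.sub_im, Complex.star_def, Complex.conj_im] at h4
    have h5 : 0 ≤ z.im * ∑ j, ‖res (wig n u) z j i‖ ^ 2 := by positivity
    linarith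
  unfold trRes
  have : ((n : ℂ)⁻¹) = (((n : ℝ)⁻¹ : ℝ) : ℂ) := by push_cast; rfl
  rw [this, Complex.im_ofReal_mul, Matrix.trace, Complex.im_sum]
  exact mul_nonneg (by positivity) (Finset.sum_nonneg fun i _ => h i)

variable [IsProbabilityMeasure P] {y : Sym2 ℕ → Ω → ℝ} {v : ℝ≥0}

/-- Replacing one row of the lower triangle perturbs the matrix by rank at most two, hence the
normalized trace by at most `4 |Im z|⁻¹ / n`. -/
lemma ae_tendsto_trRes_sub_integral (hmeas : ∀ e, Measurable (y e)) (hind : iIndepFun y P)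
    {z : ℂ} (hz : z.im ≠ 0) :
    ∀ᵐ ω ∂P, Tendsto (fun n => trRes n (fun e => y e ω) z
      - ∫ ω', trRes n (fun e => y e ω') z ∂P) atTop (𝓝 0) := by
  have hη : 0 < |z.im| := abs_pos.2 hz
  have h := ae_tendsto_sub_integral (P := P) (X := fun j ω => lowerRow (fun e => y e ω) j)
    (fun j => measurable_pi_iff.2 fun i => by
      unfold lowerRow
      split_ifs
      · exact hmeas _
      · fun_prop) (iIndepFun_lowerRow hmeas hind)
    (f := fun n x => trRes n (ofLowerRows n x) z)
    (fun n => (continuous_trRes hz).measurable.comp (measurable_ofLowerRows n))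
    (fun n x => norm_trRes_le hz _) (C := ⟨2 * (2 * |z.im|⁻¹), by positivity⟩)
    (by change (0:ℝ) < _; positivity)
    (fun n x i r => norm_trRes_sub_le hz (r := 2) (rank_wig_ofLowerRows_update_sub_le x i r))
  have e : ∀ n ω, trRes n (ofLowerRows n fun i => lowerRow (fun e => y e ω) i) z
      = trRes n (fun e => y e ω) z := fun n ω => by
    unfold trRes; rw [wig_ofLowerRows]
  simp_rw [e] at h
  exact h

lemma tendsto_integral_trRes (hmeas : ∀ e, Measurable (y e)) (hind : iIndepFun y P)
    (hident : ∀ e e', IdentDistrib (y e) (y e') P P) (hL2 : ∀ e, MemLp (y e) 2 P)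
    (hmean : ∀ e, ∫ ω, y e ω ∂P = 0) (hvar : ∀ e, ∫ ω, y e ω ^ 2 ∂P = v)
    {z : ℂ} (hz : 0 < z.im) :
    Tendsto (fun n => ∫ ω, trRes n (fun e => y e ω) z ∂P) atTop
      (𝓝 (stieltjes (semicircle 0 v) z)) := by
  have hym : Measurable fun ω e => y e ω := measurable_pi_iff.2 hmeas
  set S : ℕ → Ω → ℂ := fun n ω => trRes n (fun e => y e ω) z with hS
  set m : ℕ → ℂ := fun n => ∫ ω, S n ω ∂P with hm
  have hSm : ∀ n, Measurable (S n) := fun n => (continuous_trRes hz.ne').measurable.comp hym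
  have hSb : ∀ n ω, ‖S n ω‖ ≤ |z.im|⁻¹ := fun n ω => norm_trRes_le hz.ne' _
  have hSi : ∀ n, Integrable (S n) P := fun n =>
    Integrable.of_bound (hSm n).aestronglyMeasurable _ (Eventually.of_forall (hSb n))
  have hS2i : ∀ n, Integrable (fun ω => S n ω ^ 2) P := fun n =>
    Integrable.of_bound ((hSm n).pow_const 2).aestronglyMeasurable (|z.im|⁻¹ ^ 2)
      (Eventually.of_forall fun ω => by rw [norm_pow]; gcongr; exact hSb n ω)
  have hmb : ∀ n, ‖m n‖ ≤ |z.im|⁻¹ := fun n => by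
    simpa using norm_integral_le_of_norm_le_const (μ := P) (Eventually.of_forall (hSb n))
  have hconc := ae_tendsto_trRes_sub_integral (P := P) hmeas hind hz.ne'
  -- Concentration and boundedness make the mean of the square asymptotic to the square of the mean,
  -- which closes the equation.
  have hvarS : Tendsto (fun n => ∫ ω, S n ω ^ 2 ∂P - m n ^ 2) atTop (𝓝 0) := by
    have h1 : Tendsto (fun n => ∫ ω, (S n ω - m n) ^ 2 ∂P) atTop (𝓝 (∫ _ω, (0 : ℂ) ∂P)) := by
      refine tendsto_integral_of_dominated_convergence (fun _ => (2 * |z.im|⁻¹) ^ 2)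
        (fun n => (((hSm n).sub_const _).pow_const 2).aestronglyMeasurable) (integrable_const _)
        (fun n => Eventually.of_forall fun ω => ?_) ?_
      · rw [norm_pow]
        gcongr
        refine (norm_sub_le _ _).trans ?_
        linarith [hSb n ω, hmb n]
      · filter_upwards [hconc] with ω hω
        simpa using hω.pow 2
    rw [integral_zero] at h1
    refine h1.congr fun n => ?_
    have e1 : ∀ ω, (S n ω - m n) ^ 2 = (S n ω ^ 2 - 2 * m n * S n ω) + m n ^ 2 := fun ω => by ring
    simp_rw [e1]
    have i1 : Integrable (fun ω => 2 * m n * S n ω) P := (hSi n).const_mul _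
    have i2 : Integrable (fun ω => S n ω ^ 2 - 2 * m n * S n ω) P := (hS2i n).sub i1
    rw [integral_add i2 (integrable_const _), integral_sub (hS2i n) i1, integral_const_mul]
    simp only [integral_const, probReal_univ, one_smul, hm]
    ring
  have hself : Tendsto (fun n => 1 + z * m n + v * ∫ ω, S n ω ^ 2 ∂P) atTop (𝓝 0) := by
    rw [tendsto_zero_iff_norm_tendsto_zero]
    have hb : Tendsto (fun n : ℕ => expConst z * lindebergError P (y s(0, 0)) v n
        + v * ((n : ℝ)⁻¹ * |z.im|⁻¹ ^ 2)) atTop (𝓝 0) := by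
      have h1 := (tendsto_lindebergError (P := P) (hL2 s(0, 0)) v.2).const_mul (expConst z)
      have h2 := ((tendsto_inv_atTop_nhds_zero_nat (𝕜 := ℝ)).mul_const
        (|z.im|⁻¹ ^ 2)).const_mul (v : ℝ)
      simpa using h1.add h2
    refine squeeze_zero' (Eventually.of_forall fun n => norm_nonneg _) ?_ hb
    filter_upwards [eventually_ne_atTop 0] with n hn
    exact norm_self_consistent_le hmeas hind hident hL2 hmean hvar hz.ne' hn s(0, 0)
  have hquad : Tendsto (fun n => 1 + z * m n + v * m n ^ 2) atTop (𝓝 0) := by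
    have := hself.sub (hvarS.const_mul (v : ℂ))
    simp only [mul_zero, sub_zero] at this
    refine this.congr fun n => ?_
    ring
  set m₀ := stieltjes (semicircle 0 v) z with hm₀
  have h0 := stieltjes_semicircle v hz.ne'
  have h0im : 0 ≤ m₀.im := stieltjes_im_nonneg _ hz
  have hmim : ∀ n, 0 ≤ (m n).im := fun n => by
    have h : ∫ ω, (S n ω).im ∂P = (∫ ω, S n ω ∂P).im := integral_im (hSi n)
    simp only [hm]
    rw [← h]
    exact integral_nonneg fun ω => trRes_im_nonneg n _ hz
  rw [tendsto_iff_norm_sub_tendsto_zero]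
  -- Stability: the difference of the two quadratics factors through `v * (m n + m₀) + z`, whose
  -- imaginary part is at least `Im z` since both transforms have nonnegative imaginary part.
  have hb : ∀ n, ‖m n - m₀‖ ≤ z.im⁻¹ * ‖1 + z * m n + v * m n ^ 2‖ := fun n => by
    have e1 : 1 + z * m n + v * m n ^ 2 = (m n - m₀) * (v * (m n + m₀) + z) := by
      linear_combination h0
    rw [e1, norm_mul, ← div_eq_inv_mul, le_div_iff₀ hz]
    gcongr
    refine le_trans ?_ ((le_abs_self _).trans (Complex.abs_im_le_norm _))
    rw [Complex.add_im, Complex.im_ofReal_mul, Complex.add_im]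
    have : 0 ≤ (v : ℝ) * ((m n).im + m₀.im) := mul_nonneg v.2 (add_nonneg (hmim n) h0im)
    linarith
  refine squeeze_zero (fun n => norm_nonneg _) hb ?_
  simpa using hquad.norm.const_mul (z.im⁻¹)

/-- **Wigner's semicircle law** at the level of Stieltjes transforms, for independent identically
distributed entries with finite second moment. -/
theorem ae_tendsto_trRes (hmeas : ∀ e, Measurable (y e)) (hind : iIndepFun y P)
    (hident : ∀ e e', IdentDistrib (y e) (y e') P P) (hL2 : ∀ e, MemLp (y e) 2 P)
    (hvar : ∀ e, variance (y e) P = v) {z : ℂ} (hz : 0 < z.im) :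
    ∀ᵐ ω ∂P, Tendsto (fun n => trRes n (fun e => y e ω) z) atTop
      (𝓝 (stieltjes (semicircle 0 v) z)) := by
  set c : ℝ := ∫ ω, y s(0, 0) ω ∂P with hc
  have hce : ∀ e, ∫ ω, y e ω ∂P = c := fun e => (hident e s(0, 0)).integral_eq
  set w : Sym2 ℕ → Ω → ℝ := fun e ω => y e ω - c with hw
  have wmeas : ∀ e, Measurable (w e) := fun e => (hmeas e).sub_const c
  have wind : iIndepFun w P := hind.comp (fun _ t => t - c) (fun _ => by fun_prop)
  have wident : ∀ e e', IdentDistrib (w e) (w e') P P := fun e e' =>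
    (hident e e').comp (u := fun t => t - c) (by fun_prop)
  have wL2 : ∀ e, MemLp (w e) 2 P := fun e => (hL2 e).sub (memLp_const c)
  have wmean : ∀ e, ∫ ω, w e ω ∂P = 0 := fun e => by
    simp only [hw]
    rw [integral_sub ((hL2 e).integrable (by norm_num)) (integrable_const _), hce]
    simp
  have wvar : ∀ e, ∫ ω, w e ω ^ 2 ∂P = v := fun e => by
    rw [← hvar e, variance_eq_integral (hmeas e).aemeasurable, hce]
  have h1 := tendsto_integral_trRes wmeas wind wident wL2 wmean wvar hz
  have h2 := ae_tendsto_trRes_sub_integral (P := P) wmeas wind hz.ne'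
  filter_upwards [h2] with ω hω
  have h3 := hω.add h1
  simp only [sub_add_cancel, zero_add] at h3
  -- A common mean of the entries is a rank one perturbation, so centering costs only `O(1/n)`.
  have hdiff : ∀ n, ‖trRes n (fun e => y e ω) z - trRes n (fun e => w e ω) z‖
      ≤ (1 : ℕ) * (2 * |z.im|⁻¹) / n := fun n => by
    refine norm_trRes_sub_le hz.ne' ?_
    have : wig n (fun e => y e ω) - wig n (fun e => w e ω)
        = Matrix.vecMulVec (fun _ => (((√(n : ℝ))⁻¹ * c : ℝ) : ℂ)) (fun _ => 1) := by
      ext a b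
      rw [Matrix.sub_apply, wig_apply, wig_apply, Matrix.vecMulVec_apply]
      simp only [hw]
      push_cast
      ring
    rw [this]
    exact Matrix.rank_vecMulVec_le _ _
  have h4 : Tendsto (fun n => trRes n (fun e => y e ω) z - trRes n (fun e => w e ω) z)
      atTop (𝓝 0) :=
    squeeze_zero_norm hdiff (tendsto_const_div_atTop_nhds_zero_nat _)
  have h5 := h4.add h3
  simpa using h5

end WignerLaw

end CirculantBlocks
end

noncomputable section

namespace CirculantBlocks

open scoped Matrix Kronecker

/-! ### Resolvent traces under change of basis -/

section SpectralTrace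

variable {ι : Type*} [Fintype ι] [DecidableEq ι]

lemma trace_res_conj {M D V W : Matrix ι ι ℂ} (hVW : V * W = 1) (h : M * V = V * D) (z : ℂ) :
    (res M z).trace = (res D z).trace := by
  have hWV : W * V = 1 := mul_eq_one_comm.1 hVW
  have hM : M - z • (1 : Matrix ι ι ℂ) = V * (D - z • (1 : Matrix ι ι ℂ)) * W := by
    rw [mul_sub, sub_mul, ← h, Matrix.mul_assoc M, hVW, mul_one, mul_smul_comm, mul_one,
      smul_mul_assoc, hVW]
  have hV : V⁻¹ = W := Matrix.inv_eq_right_inv hVW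
  have hW : W⁻¹ = V := Matrix.inv_eq_right_inv hWV
  unfold res
  rw [hM, Matrix.mul_inv_rev, Matrix.mul_inv_rev, hV, hW, Matrix.trace_mul_comm, Matrix.mul_assoc,
    hWV, mul_one]

lemma trace_res_diagonal (d : ι → ℂ) {z : ℂ} (hd : ∀ i, d i - z ≠ 0) :
    (res (Matrix.diagonal d) z).trace = ∑ i, (d i - z)⁻¹ := by
  have h : res (Matrix.diagonal d) z = Matrix.diagonal fun i => (d i - z)⁻¹ := by
    refine Matrix.inv_eq_right_inv ?_
    rw [Matrix.smul_one_eq_diagonal, Matrix.diagonal_sub, Matrix.diagonal_mul_diagonal,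
      ← Matrix.diagonal_one]
    congr 1
    funext i
    exact mul_inv_cancel₀ (hd i)
  rw [h, Matrix.trace_diagonal]

lemma trace_res_reindex {κ : Type*} [Fintype κ] [DecidableEq κ] (e : ι ≃ κ) (M : Matrix ι ι ℂ)
    (z : ℂ) : (res (Matrix.reindex e e M) z).trace = (res M z).trace := by
  have h : Matrix.reindex e e M - z • (1 : Matrix κ κ ℂ)
      = Matrix.reindex e e (M - z • (1 : Matrix ι ι ℂ)) := by
    ext i j
    simp [Matrix.one_apply]
  unfold res
  rw [h, Matrix.inv_reindex]
  simp only [Matrix.trace, Matrix.diag, Matrix.reindex_apply, Matrix.submatrix_apply]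
  exact Equiv.sum_comp e.symm fun i => (M - z • (1 : Matrix ι ι ℂ))⁻¹ i i

lemma trace_res_blockDiagonal {κ : Type*} [Fintype κ] [DecidableEq κ] {D : κ → Matrix ι ι ℂ}
    (hD : ∀ r, (D r).IsHermitian) {z : ℂ} (hz : z.im ≠ 0) :
    (res (Matrix.blockDiagonal D) z).trace = ∑ r, (res (D r) z).trace := by
  have h : res (Matrix.blockDiagonal D) z = Matrix.blockDiagonal fun r => res (D r) z := by
    refine Matrix.inv_eq_right_inv ?_
    have h1 : Matrix.blockDiagonal D - z • (1 : Matrix (ι × κ) (ι × κ) ℂ)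
        = Matrix.blockDiagonal fun r => D r - z • (1 : Matrix ι ι ℂ) := by
      rw [← Matrix.blockDiagonal_one, ← Matrix.blockDiagonal_smul, ← Matrix.blockDiagonal_sub]
      rfl
    rw [h1, ← Matrix.blockDiagonal_mul, ← Matrix.blockDiagonal_one]
    congr 1
    funext r
    exact sub_smul_one_mul_res (hD r) hz
  rw [h, Matrix.trace_blockDiagonal]

/-- The Stieltjes transform of the spectral measure is the normalized trace of the resolvent. -/
lemma stieltjes_spectralMeasure [Nonempty ι] (A : Matrix ι ι ℝ) (hA : A.IsHermitian) {z : ℂ}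
    (hz : z.im ≠ 0) :
    stieltjes (spectralMeasure A hA) z
      = (Fintype.card ι : ℂ)⁻¹ * (res (A.map Complex.ofRealHom) z).trace := by
  have h1 : stieltjes (spectralMeasure A hA) z
      = (Fintype.card ι : ℂ)⁻¹ * ∑ i, (((hA.eigenvalues i : ℝ) : ℂ) - z)⁻¹ := by
    have hc : (spectralMeasure A hA : Measure ℝ)
        = (Fintype.card ι : ℝ≥0∞)⁻¹ • ∑ j, Measure.dirac (hA.eigenvalues j) := rfl
    unfold stieltjes
    rw [hc, integral_smul_measure, integral_finsetSum_measure fun i _ => integrable_inv_sub _ hz]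
    simp only [integral_dirac, ENNReal.toReal_inv, ENNReal.toReal_natCast, Complex.real_smul]
    push_cast
    rfl
  rw [h1]
  congr 1
  set U : Matrix ι ι ℝ := hA.eigenvectorUnitary.1 with hU
  have hUU : U * star U = 1 := by
    rw [hU]; exact Unitary.mul_star_self_of_mem hA.eigenvectorUnitary.2
  have hUU' : star U * U = 1 := by
    rw [hU]; exact Unitary.star_mul_self_of_mem hA.eigenvectorUnitary.2
  have hsp : A * U = U * Matrix.diagonal hA.eigenvalues := by
    have h := hA.spectral_theorem
    rw [Unitary.conjStarAlgAut_apply] at h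
    have h' : A = U * Matrix.diagonal hA.eigenvalues * star U := h
    calc A * U = U * Matrix.diagonal hA.eigenvalues * star U * U := by rw [← h']
      _ = _ := by rw [Matrix.mul_assoc, hUU', Matrix.mul_one]
  rw [trace_res_conj (V := U.map Complex.ofRealHom) (W := (star U).map Complex.ofRealHom)
    (D := Matrix.diagonal fun i => ((hA.eigenvalues i : ℝ) : ℂ)), trace_res_diagonal]
  · exact fun i => sub_ne_zero_of_im hz _
  · rw [← Matrix.map_mul, hUU, Matrix.map_one _ (map_zero _) (map_one _)]
  · rw [← Matrix.map_mul, hsp, Matrix.map_mul, Matrix.diagonal_map (map_zero _)]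
    rfl

end SpectralTrace

/-! ### Fourier diagonalization of the circulant blocks -/

section Fourier

variable {k : ℕ} [NeZero k]

/-- The additive characters of the cyclic group of order `k`. -/
def chi (r m : Fin k) : ℂ := Complex.exp (2 * Real.pi * Complex.I / k) ^ ((r : ℕ) * (m : ℕ))

lemma isPrimitiveRoot_zeta : IsPrimitiveRoot (Complex.exp (2 * Real.pi * Complex.I / k)) k :=
  Complex.isPrimitiveRoot_exp k (NeZero.ne k)

lemma chi_comm {k : ℕ} (r m : Fin k) : chi r m = chi m r := by unfold chi; rw [mul_comm (r : ℕ)]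

lemma chi_add (r m p : Fin k) : chi r (m + p) = chi r m * chi r p := by
  unfold chi
  rw [← pow_add, ← mul_add, pow_mul, pow_mul]
  have h : (Complex.exp (2 * Real.pi * Complex.I / k) ^ (r : ℕ)) ^ k = 1 := by
    rw [← pow_mul, mul_comm (r : ℕ), pow_mul, isPrimitiveRoot_zeta.pow_eq_one, one_pow]
  rw [Fin.val_add, ← pow_eq_pow_mod _ h]

lemma chi_add_left (r s m : Fin k) : chi (r + s) m = chi r m * chi s m := by
  rw [chi_comm, chi_add, chi_comm m r, chi_comm m s]

lemma chi_zero (r : Fin k) : chi r 0 = 1 := by unfold chi; simp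

lemma norm_chi (r m : Fin k) : ‖chi r m‖ = 1 := by
  unfold chi
  rw [norm_pow, isPrimitiveRoot_zeta.norm'_eq_one (NeZero.ne k), one_pow]

lemma chi_neg (r m : Fin k) : chi r (-m) = star (chi r m) := by
  have h1 : chi r (-m) * chi r m = 1 := by rw [← chi_add, neg_add_cancel, chi_zero]
  have h2 : star (chi r m) * chi r m = 1 := by
    rw [Complex.star_def, Complex.conj_mul', norm_chi]; simp
  have h3 : chi r m ≠ 0 := by rw [← norm_ne_zero_iff, norm_chi]; exact one_ne_zero
  exact mul_right_cancel₀ h3 (h1.trans h2.symm)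

lemma sum_chi (r : Fin k) : ∑ m, chi r m = if r = 0 then (k : ℂ) else 0 := by
  split_ifs with h
  · subst h
    simp [chi]
  · unfold chi
    simp_rw [pow_mul]
    rw [Fin.sum_univ_eq_sum_range (fun m => (Complex.exp (2 * Real.pi * Complex.I / k) ^ (r : ℕ)) ^ m)]
    have hne : Complex.exp (2 * Real.pi * Complex.I / k) ^ (r : ℕ) ≠ 1 := by
      refine isPrimitiveRoot_zeta.pow_ne_one_of_pos_of_lt ?_ r.2
      intro h0
      exact h (Fin.ext (by simpa using h0))
    rw [geom_sum_eq hne, ← pow_mul, mul_comm (r : ℕ), pow_mul, isPrimitiveRoot_zeta.pow_eq_one]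
    simp

lemma letter_neg (m : Fin k) : letter k (-m) = letter k m := by
  have := letter_sub_comm k 0 m
  simpa using this

/-- The coefficients of the eigenvalues of symmetric circulants. -/
def cosCoeff (r m : Fin k) : ℝ := (√(k : ℝ))⁻¹ * (chi r m).re

/-- The reflection `m ↦ -m` preserves letters and conjugates characters, so the eigenvalue is real
and only cosines remain. -/
lemma sum_letter_mul_chi (a : Fin (k / 2 + 1) → ℝ) (r : Fin k) :
    ∑ m, (a (letter k m) : ℂ) * chi r m = ((∑ m, a (letter k m) * (chi r m).re : ℝ) : ℂ) := by
  have h : ∑ m, (a (letter k m) : ℂ) * chi r m = ∑ m, (a (letter k m) : ℂ) * star (chi r m) := by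
    rw [← Equiv.sum_comp (Equiv.neg (Fin k))]
    refine Finset.sum_congr rfl fun m _ => ?_
    rw [Equiv.neg_apply, letter_neg, chi_neg]
  have h2 : ∑ m, (a (letter k m) : ℂ) * chi r m
      = (∑ m, (a (letter k m) : ℂ) * chi r m + ∑ m, (a (letter k m) : ℂ) * star (chi r m)) / 2 := by
    rw [← h]; ring
  rw [h2, ← Finset.sum_add_distrib, Finset.sum_div]
  push_cast
  refine Finset.sum_congr rfl fun m _ => ?_
  rw [← mul_add, Complex.star_def, Complex.add_conj]
  push_cast
  ring

/-- The `r`-th eigenvalue of the symmetric circulant in the letters `x (e, 0), x (e, 1), …`. -/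
def blockEigenvalue (x : Sym2 ℕ × Fin (k / 2 + 1) → ℝ) (r : Fin k) (e : Sym2 ℕ) : ℝ :=
  ∑ m, cosCoeff r m * x (e, letter k m)

/-- The unitary matrix that diagonalizes all circulants. -/
def fourierMatrix (k : ℕ) [NeZero k] : Matrix (Fin k) (Fin k) ℂ :=
  Matrix.of fun p r => (((√(k : ℝ))⁻¹ : ℝ) : ℂ) * chi r p

lemma fourierMatrix_mul_conjTranspose : fourierMatrix k * (fourierMatrix k)ᴴ = 1 := by
  have hk : (0 : ℝ) < k := by exact_mod_cast Nat.pos_of_ne_zero (NeZero.ne k)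
  have hsq : (((√(k : ℝ))⁻¹ : ℝ) : ℂ) * (((√(k : ℝ))⁻¹ : ℝ) : ℂ) = (k : ℂ)⁻¹ := by
    rw [← Complex.ofReal_mul, ← mul_inv, Real.mul_self_sqrt hk.le]; push_cast; rfl
  ext p q
  rw [Matrix.mul_apply]
  have h : ∀ r, fourierMatrix k p r * (fourierMatrix k)ᴴ r q = (k : ℂ)⁻¹ * chi (p - q) r := fun r => by
    rw [Matrix.conjTranspose_apply]
    simp only [fourierMatrix, Matrix.of_apply]
    rw [chi_comm (p - q), sub_eq_add_neg, chi_add, chi_neg, ← hsq, star_mul', Complex.star_def,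
      Complex.conj_ofReal]
    ring
  simp_rw [h]
  rw [← Finset.mul_sum, sum_chi, Matrix.one_apply]
  have hk' : (k : ℂ) ≠ 0 := by exact_mod_cast hk.ne'
  by_cases hpq : p = q
  · subst hpq; simp [hk']
  · rw [if_neg (sub_ne_zero.2 hpq), if_neg hpq, mul_zero]

/-- The normalized trace of the resolvent of the block matrix is the mean of the normalized traces
of the resolvents of the matrices of block eigenvalues. -/
lemma stieltjes_spectralMeasure_blockMatrix (n : ℕ) (x : Sym2 ℕ × Fin (k / 2 + 1) → ℝ) {z : ℂ}
    (hz : z.im ≠ 0) :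
    stieltjes (spectralMeasure ((√((n + 1 : ℕ) : ℝ))⁻¹ • blockMatrix k (n + 1) x)
      (isHermitian_smul_blockMatrix (√((n + 1 : ℕ) : ℝ))⁻¹ k (n + 1) x)) z
      = (k : ℂ)⁻¹ * ∑ r : Fin k, trRes (n + 1) (blockEigenvalue x r) z := by
  rw [stieltjes_spectralMeasure _ _ hz]
  set c : ℝ := (√((n + 1 : ℕ) : ℝ))⁻¹ with hc
  set d : ℝ := (√(k : ℝ))⁻¹ with hd
  set M : Matrix (Fin (n + 1) × Fin k) (Fin (n + 1) × Fin k) ℂ :=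
    Matrix.of fun a b => ((c * (d * x (s((a.1 : ℕ), (b.1 : ℕ)), letter k (b.2 - a.2))) : ℝ) : ℂ) with hM
  have hmap : (c • blockMatrix k (n + 1) x).map Complex.ofRealHom
      = Matrix.reindex finProdFinEquiv finProdFinEquiv M := by
    ext i j
    simp [hM, blockMatrix, symCirculant, Matrix.comp_apply, d]
  -- The same Fourier matrix acts on all blocks, so it diagonalizes them simultaneously; what
  -- remains is block diagonal over the characters `r`.
  set V : Matrix (Fin (n + 1) × Fin k) (Fin (n + 1) × Fin k) ℂ :=
    (1 : Matrix (Fin (n + 1)) (Fin (n + 1)) ℂ) ⊗ₖ fourierMatrix k with hV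
  set D : Fin k → Matrix (Fin (n + 1)) (Fin (n + 1)) ℂ := fun r => wig (n + 1) (blockEigenvalue x r)
    with hD
  have hVW : V * ((1 : Matrix (Fin (n + 1)) (Fin (n + 1)) ℂ) ⊗ₖ (fourierMatrix k)ᴴ) = 1 := by
    rw [hV, ← Matrix.mul_kronecker_mul, fourierMatrix_mul_conjTranspose, Matrix.one_mul,
      Matrix.one_kronecker_one]
  have hMV : M * V = V * Matrix.blockDiagonal D := by
    ext ⟨i, p⟩ ⟨j, r⟩
    have hl : (M * V) (i, p) (j, r)
        = ∑ q, ((c * (d * x (s((i : ℕ), (j : ℕ)), letter k (q - p))) : ℝ) : ℂ) * fourierMatrix k q r := by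
      rw [Matrix.mul_apply, Fintype.sum_prod_type, Finset.sum_eq_single j]
      · simp only [hM, hV, Matrix.of_apply, Matrix.kroneckerMap_apply, Matrix.one_apply_eq, one_mul]
      · intro l _ hl
        refine Finset.sum_eq_zero fun s _ => ?_
        rw [hV, Matrix.kroneckerMap_apply, Matrix.one_apply_ne hl, zero_mul, mul_zero]
      · simp
    have hr : (V * Matrix.blockDiagonal D) (i, p) (j, r) = fourierMatrix k p r * D r i j := by
      rw [Matrix.mul_apply, Fintype.sum_prod_type, Finset.sum_eq_single i]
      · rw [Finset.sum_eq_single r]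
        · rw [Matrix.blockDiagonal_apply_eq D i j r]
          simp only [hV, Matrix.kroneckerMap_apply, Matrix.one_apply_eq, one_mul]
        · intro s _ hs
          rw [Matrix.blockDiagonal_apply_ne D i j hs, mul_zero]
        · simp
      · intro l _ hl
        refine Finset.sum_eq_zero fun s _ => ?_
        rw [hV, Matrix.kroneckerMap_apply, Matrix.one_apply_ne hl.symm, zero_mul, zero_mul]
      · simp
    -- Substituting `q = m + p` splits off the factor `chi r p`: the characters are eigenvectors of
    -- every circulant.
    rw [hl, hr, ← Equiv.sum_comp (Equiv.addRight p)]
    have h := sum_letter_mul_chi (fun l => x (s((i : ℕ), (j : ℕ)), l)) r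
    calc _ = (c : ℂ) * (d : ℂ) * ((d : ℂ) * chi r p)
          * ∑ m, (x (s((i : ℕ), (j : ℕ)), letter k m) : ℂ) * chi r m := by
          rw [Finset.mul_sum]
          refine Finset.sum_congr rfl fun m _ => ?_
          simp only [Equiv.coe_addRight, add_sub_cancel_right, fourierMatrix, Matrix.of_apply, chi_add, ← hd]
          push_cast
          ring
      _ = _ := by
          rw [h]
          simp only [hD, fourierMatrix, Matrix.of_apply, wig_apply, blockEigenvalue, cosCoeff, ← hd, ← hc]
          rw [show ∑ m, d * (chi r m).re * x (s((i : ℕ), (j : ℕ)), letter k m)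
            = d * ∑ m, x (s((i : ℕ), (j : ℕ)), letter k m) * (chi r m).re by
              rw [Finset.mul_sum]
              exact Finset.sum_congr rfl fun m _ => by ring]
          push_cast
          ring
  rw [hmap, trace_res_reindex, trace_res_conj hVW hMV,
    trace_res_blockDiagonal (fun r => wig_isHermitian _ _) hz, Fintype.card_fin]
  unfold trRes
  rw [← Finset.mul_sum, ← mul_assoc, Nat.cast_mul, mul_inv, mul_comm (_ : ℂ)⁻¹ (k : ℂ)⁻¹]

end Fourier

end CirculantBlocks
end

noncomputable section

namespace CirculantBlocks

/-! ### Repeated letters and eigenvalue variances -/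

variable {k : ℕ} [NeZero k]

lemma letter_eq_letter_iff (m m' : Fin k) : letter k m' = letter k m ↔ m' = m ∨ m' = -m := by
  have hm := m.isLt
  have hm' := m'.isLt
  simp only [letter, Fin.ext_iff, Fin.val_neg]
  split_ifs with h
  · rw [Fin.val_zero] at h
    omega
  · rw [Fin.val_zero] at h
    omega

/-- The characters of order at most two, or equivalently the positions of the first row of a
symmetric circulant that are equal to their own mirror image. -/
def selfInverse (k : ℕ) [NeZero k] : Finset (Fin k) := Finset.univ.filter fun m => m + m = 0

lemma mem_selfInverse {m : Fin k} : m ∈ selfInverse k ↔ m + m = 0 := by simp [selfInverse]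

lemma mem_selfInverse_iff_val {m : Fin k} :
    m ∈ selfInverse k ↔ (m : ℕ) = 0 ∨ 2 * (m : ℕ) = k := by
  have hm := m.isLt
  rw [mem_selfInverse, Fin.ext_iff, Fin.val_add, Fin.val_zero]
  by_cases h : (m : ℕ) + m < k
  · rw [Nat.mod_eq_of_lt h]; omega
  · rw [Nat.mod_eq_sub_mod (by omega), Nat.mod_eq_of_lt (by omega)]; omega

lemma card_selfInverse_of_odd (h : Odd k) : (selfInverse k).card = 1 := by
  rw [Finset.card_eq_one]
  refine ⟨0, Finset.ext fun m => ?_⟩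
  rw [mem_selfInverse_iff_val, Finset.mem_singleton, Fin.ext_iff, Fin.val_zero]
  obtain ⟨l, hl⟩ := h
  omega

lemma card_selfInverse_of_not_odd (h : ¬ Odd k) : (selfInverse k).card = 2 := by
  have hk := Nat.pos_of_ne_zero (NeZero.ne k)
  obtain ⟨l, hl⟩ := Nat.not_odd_iff_even.1 h
  rw [Finset.card_eq_two]
  refine ⟨0, ⟨l, by omega⟩, ?_, Finset.ext fun m => ?_⟩
  · rw [Ne, Fin.ext_iff, Fin.val_zero]
    change ¬ (0 = l)
    omega
  · rw [mem_selfInverse_iff_val, Finset.mem_insert, Finset.mem_singleton, Fin.ext_iff, Fin.ext_iff,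
      Fin.val_zero]
    change _ ↔ (m : ℕ) = 0 ∨ (m : ℕ) = l
    omega

lemma card_selfInverse_le : (selfInverse k).card ≤ k :=
  (Finset.card_le_univ _).trans_eq (Fintype.card_fin k)

lemma cosCoeff_neg (r m : Fin k) : cosCoeff r (-m) = cosCoeff r m := by
  unfold cosCoeff
  rw [chi_neg, Complex.star_def, Complex.conj_re]

/-- A letter occupies the mirror positions `m` and `-m`, which carry equal coefficients and coincide
exactly when `m` is its own inverse. -/
lemma sum_cosCoeff_of_letter_eq (r m : Fin k) :
    ∑ m', (if letter k m' = letter k m then cosCoeff r m' else 0)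
      = (if m ∈ selfInverse k then 1 else 2) * cosCoeff r m := by
  simp_rw [letter_eq_letter_iff]
  rw [← Finset.sum_filter]
  split_ifs with h
  · have hneg : -m = m := (eq_neg_of_add_eq_zero_left (mem_selfInverse.1 h)).symm
    have : (Finset.univ.filter fun m' => m' = m ∨ m' = -m) = {m} := by
      ext m'; simp [hneg]
    rw [this, Finset.sum_singleton, one_mul]
  · have hneg : m ≠ -m := fun h0 => h (mem_selfInverse.2 (by nth_rw 1 [h0]; exact neg_add_cancel m))
    have : (Finset.univ.filter fun m' => m' = m ∨ m' = -m) = {m, -m} := by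
      ext m'; simp
    rw [this, Finset.sum_pair hneg, cosCoeff_neg, two_mul]

lemma re_chi_sq (r m : Fin k) : (chi r m).re ^ 2 = (1 + (chi (r + r) m).re) / 2 := by
  have h : (chi r m).re ^ 2 + (chi r m).im ^ 2 = 1 := by
    have := norm_chi r m
    rw [← Complex.sq_norm_sub_sq_re, this]; ring
  rw [chi_add_left, Complex.mul_re]
  linarith

lemma sum_re_chi_sq (r : Fin k) :
    ∑ m, (chi r m).re ^ 2 = (k + if r ∈ selfInverse k then (k : ℝ) else 0) / 2 := by
  simp_rw [re_chi_sq]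
  rw [← Finset.sum_div, Finset.sum_add_distrib, ← Complex.re_sum, sum_chi]
  simp only [mem_selfInverse]
  split_ifs <;> simp

lemma re_chi_sq_of_mem (r : Fin k) {m : Fin k} (hm : m ∈ selfInverse k) : (chi r m).re ^ 2 = 1 := by
  rw [re_chi_sq, chi_add_left, ← chi_add, mem_selfInverse.1 hm, chi_zero]
  norm_num

/-- The variance of the `r`-th eigenvalue of a symmetric circulant in standardized letters. -/
def eigenvalueVariance (r : Fin k) : ℝ≥0 :=
  if r ∈ selfInverse k then ((2 * k - (selfInverse k).card : ℕ) : ℝ≥0) / k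
  else ((k - (selfInverse k).card : ℕ) : ℝ≥0) / k

/-- The double sum is `1/k` times `2 ∑ cos²` minus the number of self-inverse positions, where `cos²
= 1`. By orthogonality `∑ cos²` is `k` if the character `r` is self-inverse and `k / 2` otherwise.
-/
lemma sum_sum_cosCoeff (r : Fin k) :
    ∑ m, ∑ m', cosCoeff r m * (if letter k m' = letter k m then cosCoeff r m' else 0)
      = eigenvalueVariance r := by
  have hk : (0 : ℝ) < k := by exact_mod_cast Nat.pos_of_ne_zero (NeZero.ne k)
  have hle := card_selfInverse_le (k := k)
  have h : ∀ m, ∑ m', cosCoeff r m * (if letter k m' = letter k m then cosCoeff r m' else 0)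
      = (k : ℝ)⁻¹ * (2 * (chi r m).re ^ 2 - if m ∈ selfInverse k then 1 else 0) := fun m => by
    have hsq : (√(k : ℝ))⁻¹ * (√(k : ℝ))⁻¹ = (k : ℝ)⁻¹ := by
      rw [← mul_inv, Real.mul_self_sqrt hk.le]
    rw [← Finset.mul_sum, sum_cosCoeff_of_letter_eq, ← hsq]
    unfold cosCoeff
    split_ifs with hm
    · rw [re_chi_sq_of_mem r hm]
      have := re_chi_sq_of_mem r hm
      linear_combination (√(k : ℝ))⁻¹ * (√(k : ℝ))⁻¹ * this
    · ring
  simp_rw [h]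
  rw [← Finset.mul_sum, Finset.sum_sub_distrib, ← Finset.mul_sum, sum_re_chi_sq, Finset.sum_ite_mem,
    Finset.univ_inter, Finset.sum_const, nsmul_eq_mul, mul_one]
  unfold eigenvalueVariance
  split_ifs
  · rw [NNReal.coe_div, NNReal.coe_natCast, NNReal.coe_natCast, Nat.cast_sub (by omega)]
    push_cast
    ring
  · rw [NNReal.coe_div, NNReal.coe_natCast, NNReal.coe_natCast, Nat.cast_sub hle]
    ring

/-! ### The block eigenvalues as Wigner entries -/

section Probability

variable {k : ℕ} {Ω : Type*} [MeasurableSpace Ω] {P : Measure Ω}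
  {x : Sym2 ℕ × Fin (k / 2 + 1) → Ω → ℝ}

lemma measurable_blockEigenvalue (hmeas : ∀ s, Measurable (x s)) (r : Fin k) (e : Sym2 ℕ) :
    Measurable fun ω => blockEigenvalue (fun s => x s ω) r e := by
  unfold blockEigenvalue
  fun_prop

lemma memLp_blockEigenvalue (hL2 : ∀ s, MemLp (x s) 2 P) (r : Fin k) (e : Sym2 ℕ) :
    MemLp (fun ω => blockEigenvalue (fun s => x s ω) r e) 2 P := by
  unfold blockEigenvalue
  exact memLp_finsetSum _ fun m _ => (hL2 _).const_mul _

lemma variance_blockEigenvalue [NeZero k] [IsProbabilityMeasure P] (hindep : iIndepFun x P) (hL2 : ∀ s, MemLp (x s) 2 P)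
    (hvar : ∀ s, variance (x s) P = 1) (r : Fin k) (e : Sym2 ℕ) :
    variance (fun ω => blockEigenvalue (fun s => x s ω) r e) P = eigenvalueVariance r := by
  have hcov : ∀ l l', cov[x (e, l), x (e, l'); P] = if l' = l then 1 else 0 := fun l l' => by
    split_ifs with h
    · rw [h, covariance_self (hL2 _).1.aemeasurable, hvar]
    · exact (hindep.indepFun (by simp [Ne.symm h])).covariance_eq_zero (hL2 _) (hL2 _)
  rw [← covariance_self (memLp_blockEigenvalue hL2 r e).1.aemeasurable, ← sum_sum_cosCoeff]
  unfold blockEigenvalue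
  rw [covariance_fun_sum_fun_sum (fun m => (hL2 _).const_mul _) fun m => (hL2 _).const_mul _]
  refine Finset.sum_congr rfl fun m _ => Finset.sum_congr rfl fun m' _ => ?_
  rw [covariance_const_mul_left, covariance_const_mul_right, hcov]
  split_ifs <;> ring

lemma iIndepFun_letters (hmeas : ∀ s, Measurable (x s)) (hindep : iIndepFun x P) :
    iIndepFun (fun (e : Sym2 ℕ) ω (l : Fin (k / 2 + 1)) => x (e, l) ω) P := by
  have h := hindep.precomp (g := fun p : (_ : Sym2 ℕ) × Fin (k / 2 + 1) => (p.1, p.2))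
    (Equiv.sigmaEquivProd _ _).injective
  exact iIndepFun_curry (X := fun e l => x (e, l)) (fun e l => hmeas _) h

/-- For fixed `r`, the eigenvalue at `e` is a function of the letters of block `e` alone.
Independence between different `r` is neither claimed nor needed. -/
lemma iIndepFun_blockEigenvalue [IsProbabilityMeasure P] (hmeas : ∀ s, Measurable (x s)) (hindep : iIndepFun x P)
    (r : Fin k) : iIndepFun (fun e ω => blockEigenvalue (fun s => x s ω) r e) P :=
  (iIndepFun_letters hmeas hindep).comp
    (fun _ a => ∑ m, cosCoeff r m * a (letter k m)) fun _ => by fun_prop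

lemma identDistrib_blockEigenvalue (hindep : iIndepFun x P)
    (hident : ∀ s t, IdentDistrib (x s) (x t) P P) (r : Fin k) (e e' : Sym2 ℕ) :
    IdentDistrib (fun ω => blockEigenvalue (fun s => x s ω) r e)
      (fun ω => blockEigenvalue (fun s => x s ω) r e') P P := by
  have h : ∀ e, iIndepFun (fun (l : Fin (k / 2 + 1)) => x (e, l)) P := fun e =>
    hindep.precomp (g := fun l => (e, l)) fun l l' h => (Prod.ext_iff.1 h).2
  have hpi := IdentDistrib.pi (fun l => hident (e, l) (e', l)) (h e) (h e')
  exact hpi.comp (u := fun a : Fin (k / 2 + 1) → ℝ => ∑ m, cosCoeff r m * a (letter k m))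
    (by fun_prop)

end Probability

/-! ### The limit law and almost sure convergence -/

lemma stieltjes_mixture (w w' : ℝ≥0) (h : w + w' = 1) (μ μ' : ProbabilityMeasure ℝ) {z : ℂ}
    (hz : z.im ≠ 0) : stieltjes (mixture w w' h μ μ') z
      = ((w : ℝ) : ℂ) * stieltjes μ z + ((w' : ℝ) : ℂ) * stieltjes μ' z := by
  have hc : (mixture w w' h μ μ' : Measure ℝ) = w • (μ : Measure ℝ) + w' • (μ' : Measure ℝ) := rfl
  unfold stieltjes
  rw [hc, integral_add_measure (integrable_inv_sub _ hz) (integrable_inv_sub _ hz),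
    integral_smul_nnreal_measure, integral_smul_nnreal_measure]
  rfl

/-- Grouping the characters by variance: there are one or two self-inverse ones, according to the
parity of `k`, and this number fixes both weights and both variances. -/
lemma stieltjes_nu {z : ℂ} (hz : z.im ≠ 0) :
    stieltjes (nu k) z
      = (k : ℂ)⁻¹ * ∑ r : Fin k, stieltjes (semicircle 0 (eigenvalueVariance r)) z := by
  have h : ∑ r : Fin k, stieltjes (semicircle 0 (eigenvalueVariance r)) z
      = (selfInverse k).card
          * stieltjes (semicircle 0 (((2 * k - (selfInverse k).card : ℕ) : ℝ≥0) / k)) z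
        + (k - (selfInverse k).card : ℕ)
          * stieltjes (semicircle 0 (((k - (selfInverse k).card : ℕ) : ℝ≥0) / k)) z := by
    rw [← Finset.sum_add_sum_compl (selfInverse k)]
    congr 1
    · rw [Finset.sum_congr rfl fun r hr => by rw [eigenvalueVariance, if_pos hr], Finset.sum_const,
        nsmul_eq_mul]
    · rw [Finset.sum_congr rfl fun r hr => by
        rw [eigenvalueVariance, if_neg (Finset.mem_compl.1 hr)], Finset.sum_const,
        nsmul_eq_mul, Finset.card_compl, Fintype.card_fin]
  rw [h]
  unfold nu
  split_ifs with hodd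
  · rw [stieltjes_mixture _ _ _ _ _ hz, card_selfInverse_of_odd hodd]
    simp only [NNReal.coe_div, NNReal.coe_natCast, NNReal.coe_one, Complex.ofReal_div,
      Complex.ofReal_natCast, Complex.ofReal_one, Nat.cast_one]
    ring
  · rw [stieltjes_mixture _ _ _ _ _ hz, card_selfInverse_of_not_odd hodd]
    simp only [NNReal.coe_div, NNReal.coe_natCast, NNReal.coe_ofNat, Complex.ofReal_div,
      Complex.ofReal_natCast, Complex.ofReal_ofNat, Nat.cast_ofNat]
    ring

/-- The spectral measures of the block matrices converge almost surely to `ν_k`. -/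
theorem ae_tendsto_spectralMeasure_blockMatrix {Ω : Type*} [MeasurableSpace Ω] {P : Measure Ω}
    [IsProbabilityMeasure P] {x : Sym2 ℕ × Fin (k / 2 + 1) → Ω → ℝ}
    (hmeas : ∀ s, Measurable (x s)) (hindep : iIndepFun x P)
    (hident : ∀ s t, IdentDistrib (x s) (x t) P P) (hL2 : ∀ s, MemLp (x s) 2 P)
    (hvar : ∀ s, variance (x s) P = 1) :
    ∀ᵐ ω ∂P, Tendsto
      (fun n : ℕ => spectralMeasure
        ((√((n + 1 : ℕ) : ℝ))⁻¹ • blockMatrix k (n + 1) (fun s => x s ω))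
        (isHermitian_smul_blockMatrix (√((n + 1 : ℕ) : ℝ))⁻¹ k (n + 1) (fun s => x s ω)))
      atTop (𝓝 (nu k)) := by
  -- The exceptional null set depends on `z`; a countable dense set of points gives a single null
  -- set.
  obtain ⟨D, hDc, hD⟩ := TopologicalSpace.exists_countable_dense ℂ
  have hae : ∀ᵐ ω ∂P, ∀ z ∈ D, ∀ r : Fin k, 0 < z.im →
      Tendsto (fun n => trRes n (blockEigenvalue (fun s => x s ω) r) z) atTop
        (𝓝 (stieltjes (semicircle 0 (eigenvalueVariance r)) z)) := by
    rw [ae_ball_iff hDc]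
    intro z _
    rw [ae_all_iff]
    intro r
    by_cases hz : 0 < z.im
    · filter_upwards [ae_tendsto_trRes (measurable_blockEigenvalue hmeas r)
        (iIndepFun_blockEigenvalue hmeas hindep r) (identDistrib_blockEigenvalue hindep hident r)
        (memLp_blockEigenvalue hL2 r) (variance_blockEigenvalue hindep hL2 hvar r) hz] with ω h _
      exact h
    · exact Eventually.of_forall fun ω h => absurd h hz
  filter_upwards [hae] with ω hω
  refine tendsto_of_tendsto_stieltjes fun z hz => tendsto_stieltjes_of_dense hD (fun z hzD hz => ?_) hz
  simp_rw [stieltjes_spectralMeasure_blockMatrix _ _ hz.ne', stieltjes_nu hz.ne']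
  refine Tendsto.const_mul _ (tendsto_finsetSum _ fun r _ => ?_)
  exact (hω z hzD r hz).comp (tendsto_add_atTop_nat 1)

end CirculantBlocks
end

noncomputable section

namespace CirculantBlocks

/-! ### Finite dependence of the entries -/

section DependentField

variable {k : ℕ} [NeZero k]

/-- The index of the variable that stands in position `s` of the infinite block matrix. -/
def blockLetter (k : ℕ) [NeZero k] (s : ℕ × ℕ) : Sym2 ℕ × Fin (k / 2 + 1) :=
  (s(s.1 / k, s.2 / k), letter k (Fin.ofNat k s.2 - Fin.ofNat k s.1))

lemma blockMatrix_apply (n : ℕ) (x : Sym2 ℕ × Fin (k / 2 + 1) → ℝ) (i j : Fin (n * k)) :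
    blockMatrix k n x i j = (√(k : ℝ))⁻¹ * x (blockLetter k (i, j)) := rfl

lemma dist_le_of_div_eq {i j : ℕ} (h : i / k = j / k) : dist i j ≤ (k - 1 : ℕ) := by
  have hk := Nat.pos_of_ne_zero (NeZero.ne k)
  have hi := Nat.div_add_mod i k
  have hj := Nat.div_add_mod j k
  have hi' := Nat.mod_lt i hk
  have hj' := Nat.mod_lt j hk
  rw [h] at hi
  rw [Nat.dist_eq, abs_sub_le_iff]
  constructor <;> rw [sub_le_iff_le_add] <;> norm_cast <;> omega

lemma dist_le_of_blockLetter_eq {s t : ℕ × ℕ} (hs : s.1 ≤ s.2) (ht : t.1 ≤ t.2)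
    (h : blockLetter k s = blockLetter k t) : dist s t ≤ (k - 1 : ℕ) := by
  have hs' : s.1 / k ≤ s.2 / k := Nat.div_le_div_right hs
  have ht' : t.1 / k ≤ t.2 / k := Nat.div_le_div_right ht
  have h1 : s.1 / k = t.1 / k ∧ s.2 / k = t.2 / k := by
    -- Blocks are indexed by unordered pairs; since both positions are on or above the diagonal, the
    -- swapped alternative forces all four block indices to be equal.
    rcases Sym2.eq_iff.1 (Prod.ext_iff.1 h).1 with h | h
    · exact h
    · omega
  rw [Prod.dist_eq]
  exact max_le (dist_le_of_div_eq h1.1) (dist_le_of_div_eq h1.2)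

/-- Positions farther apart than `k - 1` cannot share a variable, so the two σ-fields are generated
by disjoint parts of an independent family. -/
lemma isDependentField_blockLetter {Ω : Type*} [MeasurableSpace Ω] {P : Measure Ω}
    {x : Sym2 ℕ × Fin (k / 2 + 1) → Ω → ℝ} (hmeas : ∀ s, Measurable (x s))
    (hindep : iIndepFun x P) (c : ℝ) :
    IsDependentField P (k - 1) fun i j ω => c * x (blockLetter k (i, j)) ω := by
  intro S T hS hT hST
  have hdisj : Disjoint (blockLetter k '' S) (blockLetter k '' T) := by
    rw [Set.disjoint_left]
    rintro _ ⟨s, hs, rfl⟩ ⟨t, ht, hts⟩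
    exact absurd (dist_le_of_blockLetter_eq (hS s hs) (hT t ht) hts.symm) (hST s hs t ht).not_ge
  have hle : ∀ U : Set (ℕ × ℕ),
      (⨆ s ∈ U, MeasurableSpace.comap (fun ω => c * x (blockLetter k (s.1, s.2)) ω) inferInstance)
        ≤ ⨆ p ∈ blockLetter k '' U, MeasurableSpace.comap (x p) inferInstance := fun U =>
    iSup₂_le fun s hs => by
      refine le_trans ?_ (le_iSup₂_of_le (blockLetter k s) (Set.mem_image_of_mem _ hs) le_rfl)
      rw [← measurable_iff_comap_le]
      exact (comap_measurable (x (blockLetter k s))).const_mul c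
  exact indep_of_indep_of_le_right (indep_of_indep_of_le_left
    (indep_iSup_of_disjoint (fun p => (hmeas p).comap_le) hindep.iIndep hdisj) (hle S)) (hle T)

end DependentField

/-! ### The limit is not a semicircle law -/

section SemicircleMixture

lemma ofReal_semicirclePDF_ne_zero_iff (α : ℝ) {v : ℝ≥0} (hv : v ≠ 0) (x : ℝ) :
    ENNReal.ofReal (semicirclePDF α v x) ≠ 0 ↔ x ∈ Set.Ioo (α - 2 * √v) (α + 2 * √v) := by
  have hv' : (0 : ℝ) < v := by exact_mod_cast pos_iff_ne_zero.mpr hv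
  have hs := Real.sqrt_pos.2 hv'
  have hsq := Real.sq_sqrt hv'.le
  rw [Ne, ENNReal.ofReal_eq_zero, not_le, semicirclePDF]
  by_cases hx : x ∈ Set.Icc (α - 2 * √v) (α + 2 * √v)
  · rw [Set.indicator_of_mem hx, mul_pos_iff_of_pos_left (by positivity), Real.sqrt_pos, sub_pos]
    have h4 : 4 * (v : ℝ) = (2 * √v) ^ 2 := by rw [mul_pow, hsq]; norm_num
    rw [h4, sq_lt_sq, abs_of_pos (by positivity : 0 < 2 * √(v : ℝ)), abs_lt, Set.mem_Ioo]
    constructor <;> rintro ⟨h1, h2⟩ <;> constructor <;> linarith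
  · rw [Set.indicator_of_notMem hx]
    exact ⟨fun h => absurd h (lt_irrefl _), fun h => absurd (Set.Ioo_subset_Icc_self h) hx⟩

lemma semicircle_apply_eq_zero_iff (α : ℝ) {v : ℝ≥0} (hv : v ≠ 0) (s : Set ℝ) :
    (semicircle α v : Measure ℝ) s = 0
      ↔ volume (Set.Ioo (α - 2 * √v) (α + 2 * √v) ∩ s) = 0 := by
  have hc : (semicircle α v : Measure ℝ)
      = volume.withDensity fun x => ENNReal.ofReal (semicirclePDF α v x) := if_neg hv
  have hm : Measurable (semicirclePDF α v) :=
    Measurable.indicator (by fun_prop) measurableSet_Icc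
  rw [hc, withDensity_apply_eq_zero hm.ennreal_ofReal]
  simp only [ofReal_semicirclePDF_ne_zero_iff α hv, Set.ofPred_mem_eq]

/-- Test on the half-lines outside `(c, d)`. Together with the previous lemma this recovers the
support of a semicircle law from its null sets. -/
lemma le_of_null_iff {a b c d : ℝ} (hab : a < b)
    (h : ∀ s : Set ℝ, volume (Set.Ioo c d ∩ s) = 0 → volume (Set.Ioo a b ∩ s) = 0) :
    c ≤ a ∧ b ≤ d := by
  constructor
  · have h1 := h (Set.Iio c) (by
      have hd : Disjoint (Set.Ioo c d) (Set.Iio c) :=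
        Set.disjoint_left.2 fun x hx hx' => lt_asymm hx.1 hx'
      rw [hd.inter_eq, measure_empty])
    rw [Set.Ioo_inter_Iio, Real.volume_Ioo, ENNReal.ofReal_eq_zero] at h1
    by_contra hc
    have := lt_min hab (not_le.1 hc)
    linarith
  · have h1 := h (Set.Ioi d) (by
      have hc : Disjoint (Set.Ioo c d) (Set.Ioi d) :=
        Set.disjoint_left.2 fun x hx hx' => lt_asymm hx.2 hx'
      rw [hc.inter_eq, measure_empty])
    rw [Set.Ioo_inter_Ioi, Real.volume_Ioo, ENNReal.ofReal_eq_zero] at h1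
    by_contra hc
    have := max_lt hab (not_le.1 hc)
    linarith

/-- A nontrivial mixture of two centered semicircle laws of different variances is not a semicircle
law. -/
lemma mixture_semicircle_ne_semicircle {w w' : ℝ≥0} (h : w + w' = 1) (hw : w ≠ 0) (hw' : w' ≠ 0)
    {v₁ v₂ : ℝ≥0} (hv₁ : v₁ ≠ 0) (hlt : v₁ < v₂) (α : ℝ) (v : ℝ≥0) :
    mixture w w' h (semicircle 0 v₁) (semicircle 0 v₂) ≠ semicircle α v := by
  intro heq
  have hv₂ : v₂ ≠ 0 := hlt.ne_bot
  have happ : ∀ s : Set ℝ, (w : ℝ≥0∞) * (semicircle 0 v₁ : Measure ℝ) s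
      + (w' : ℝ≥0∞) * (semicircle 0 v₂ : Measure ℝ) s = (semicircle α v : Measure ℝ) s := fun s => by
    rw [← heq]; rfl
  have hpos₁ : 0 < √(v₁ : ℝ) := Real.sqrt_pos.2 (by exact_mod_cast pos_iff_ne_zero.2 hv₁)
  have hsqrt : √(v₁ : ℝ) < √(v₂ : ℝ) := Real.sqrt_lt_sqrt v₁.2 (by exact_mod_cast hlt)
  have hnull : ∀ s : Set ℝ, (semicircle 0 v₂ : Measure ℝ) s = 0 →
      (semicircle 0 v₁ : Measure ℝ) s = 0 := fun s hs => by
    rw [semicircle_apply_eq_zero_iff 0 hv₂] at hs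
    rw [semicircle_apply_eq_zero_iff 0 hv₁]
    refine measure_mono_null (Set.inter_subset_inter_left s (Set.Ioo_subset_Ioo ?_ ?_)) hs <;>
      linarith
  -- The narrower component is absolutely continuous with respect to the wider one, so the mixture
  -- has the null sets of the wider one. This excludes a point mass and forces `α = 0` and `v = v₂`.
  have hnull' : ∀ s : Set ℝ, (semicircle 0 v₂ : Measure ℝ) s = 0
      ↔ (semicircle α v : Measure ℝ) s = 0 := fun s => by
    rw [← happ s, add_eq_zero, mul_eq_zero, mul_eq_zero, ENNReal.coe_eq_zero, ENNReal.coe_eq_zero]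
    exact ⟨fun hs => ⟨Or.inr (hnull s hs), Or.inr hs⟩, fun hs => hs.2.resolve_left hw'⟩
  by_cases hv : v = 0
  · have hd : (semicircle α v : Measure ℝ) = Measure.dirac α := if_pos hv
    have h0 : (semicircle 0 v₂ : Measure ℝ) {α} = 0 := by
      rw [semicircle_apply_eq_zero_iff 0 hv₂]
      exact measure_mono_null Set.inter_subset_right (by simp)
    rw [hnull', hd] at h0
    simp at h0
  · have hpos : 0 < √(v : ℝ) := Real.sqrt_pos.2 (by exact_mod_cast pos_iff_ne_zero.2 hv)
    simp_rw [semicircle_apply_eq_zero_iff 0 hv₂, semicircle_apply_eq_zero_iff α hv] at hnull'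
    obtain ⟨h1, h2⟩ := le_of_null_iff (by linarith) fun s => (hnull' s).1
    obtain ⟨h3, h4⟩ := le_of_null_iff (by linarith) fun s => (hnull' s).2
    have hα : α = 0 := by linarith
    have hvv : v = v₂ := by
      have hs : √(v : ℝ) = √(v₂ : ℝ) := by linarith
      exact NNReal.coe_injective ((Real.sqrt_inj v.2 v₂.2).1 hs)
    -- Beyond the edge of the narrow law only the wide one has mass, and comparing masses there
    -- forces `w' = 1`, hence `w = 0`.
    have h5 := happ (Set.Ioi (2 * √(v₁ : ℝ)))
    have h6 : (semicircle 0 v₁ : Measure ℝ) (Set.Ioi (2 * √(v₁ : ℝ))) = 0 := by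
      rw [semicircle_apply_eq_zero_iff 0 hv₁, Set.Ioo_inter_Ioi, Real.volume_Ioo,
        ENNReal.ofReal_eq_zero]
      have := le_max_right (0 - 2 * √(v₁ : ℝ)) (2 * √(v₁ : ℝ))
      linarith
    have h7 : (semicircle 0 v₂ : Measure ℝ) (Set.Ioi (2 * √(v₁ : ℝ))) ≠ 0 := by
      rw [Ne, semicircle_apply_eq_zero_iff 0 hv₂, Set.Ioo_inter_Ioi, Real.volume_Ioo,
        ENNReal.ofReal_eq_zero, not_le, sub_pos]
      exact max_lt (by linarith) (by linarith)
    rw [h6, mul_zero, zero_add, hα, hvv] at h5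
    have h8 : (w' : ℝ≥0∞) = 1 := by
      rwa [ENNReal.mul_eq_right h7 (measure_ne_top _ _)] at h5
    have h9 : w' = 1 := by exact_mod_cast h8
    rw [h9, add_eq_right] at h
    exact hw h

/-- From `k = 3` on, the component of smaller variance has positive weight and positive variance.
For `k ≤ 2` its weight is zero. -/
lemma nu_ne_semicircle {k : ℕ} [NeZero k] (hk : 3 ≤ k) (α : ℝ) (v : ℝ≥0) :
    nu k ≠ semicircle α v := by
  have hk0 : (k : ℝ≥0) ≠ 0 := by exact_mod_cast NeZero.ne k
  have hkpos : (0 : ℝ≥0) < k := pos_iff_ne_zero.2 hk0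
  unfold nu
  split_ifs with hodd
  · have h1 : ((k - 1 : ℕ) : ℝ≥0) / k ≠ 0 := div_ne_zero (by norm_cast; omega) hk0
    refine mixture_semicircle_ne_semicircle _ h1 (div_ne_zero one_ne_zero hk0) h1 ?_ α v
    rw [div_lt_div_iff_of_pos_right hkpos]
    norm_cast
    omega
  · have hk4 : k ≠ 3 := fun h => hodd (h ▸ by decide)
    have h1 : ((k - 2 : ℕ) : ℝ≥0) / k ≠ 0 := div_ne_zero (by norm_cast; omega) hk0
    refine mixture_semicircle_ne_semicircle _ h1 (div_ne_zero two_ne_zero hk0) h1 ?_ α v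
    rw [div_lt_div_iff_of_pos_right hkpos]
    norm_cast
    omega

end SemicircleMixture

end CirculantBlocks
end

theorem corollary4 (k : ℕ) [NeZero k]
    {Ω : Type*} [MeasurableSpace Ω] (P : Measure Ω) [IsProbabilityMeasure P]
    (x : Sym2 ℕ × Fin (k / 2 + 1) → Ω → ℝ)
    (hmeas : ∀ s, Measurable (x s))
    (hindep : iIndepFun x P)
    (hident : ∀ s t, IdentDistrib (x s) (x t) P P)
    (hL2 : ∀ s, MemLp (x s) 2 P)
    (hvar : ∀ s, variance (x s) P = 1) :
    (∀ᵐ ω ∂P, Tendsto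
      (fun n : ℕ => CirculantBlocks.spectralMeasure
        ((√((n + 1 : ℕ) : ℝ))⁻¹ • CirculantBlocks.blockMatrix k (n + 1) (fun s => x s ω))
        (CirculantBlocks.isHermitian_smul_blockMatrix (√((n + 1 : ℕ) : ℝ))⁻¹ k (n + 1)
          (fun s => x s ω)))
      atTop (𝓝 (CirculantBlocks.nu k))) ∧
    (∃ X : ℕ → ℕ → Ω → ℝ,
      (∀ (n : ℕ) (i j : Fin (n * k)) (ω : Ω),
        CirculantBlocks.blockMatrix k n (fun s => x s ω) i j = X i j ω) ∧
      CirculantBlocks.IsDependentField P (k - 1) X) ∧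
    (3 ≤ k → ∀ (α : ℝ) (v : ℝ≥0), CirculantBlocks.nu k ≠ CirculantBlocks.semicircle α v) := by
  refine ⟨CirculantBlocks.ae_tendsto_spectralMeasure_blockMatrix hmeas hindep hident hL2 hvar,
    ⟨fun i j ω => (√(k : ℝ))⁻¹ * x (CirculantBlocks.blockLetter k (i, j)) ω,
      fun n i j ω => CirculantBlocks.blockMatrix_apply n _ i j,
      CirculantBlocks.isDependentField_blockLetter hmeas hindep _⟩,
    fun hk => CirculantBlocks.nu_ne_semicircle hk⟩
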